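/- Conventions. Manifolds are smooth, nonempty, Hausdorff and second countable; a pseudo-Riemannian metric is a smooth field of nondegenerate symmetric bilinear forms on the tangent spaces. For a metric $g$ with curvature tensor $R(x,y,z,u)=g(R(x,y)z,u)$, $R(X,Y)Z=\nabla_X\nabla_YZ-\nabla_Y\nabla_XZ-\nabla_{[X,Y]}Z$, put $\pi_1(z,u,v,w)=g(z,w)g(u,v)-g(z,v)g(u,w)$ and $\varphi(Q)(x,y,z,u)=g(x,u)Q(y,z)-g(x,z)Q(y,u)+g(y,z)Q(x,u)-g(y,u)Q(x,z)$. A plane in a tangent space is nondegenerate, resp. weakly degenerate, if $g$ restricted to it has rank $2$, resp. $1$; the sectional curvature of a nondegenerate plane $\alpha=\operatorname{span}\{x,y\}$ is $K(\alpha)=R(x,y,y,x)/\pi_1(x,y,y,x)$. A metric is conformally flat if every point has a neighbourhood $U$ with a smooth function $\rho$ on $U$ such that $e^{2\rho}g$ has zero curvature on $U$; it is nowhere conformally flat if no nonempty open subset is conformally flat. A $K_n^*$-manifold is a nonflat manifold such that either $\nabla R=\alpha\otimes R$ for a smooth $1$-form $\alpha\not\equiv 0$, or $\nabla R=0$ and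 $\alpha(X)R(Y,Z,U,V)+\alpha(Y)R(Z,X,U,V)+\alpha(Z)R(X,Y,U,V)=0$ for a smooth $1$-form $\alpha\not\equiv0$. A function $v$ on an open set $U$, with nowhere vanishing gradient, is a recurrence function of $U$ if $\alpha=dv$ satisfies one of these two alternatives on $U$. $(M,g)$ is a manifold $M(H,N,V)$ of quasi-constant curvature if it is conformally flat and, for smooth functions $H,N$ and a smooth vector field $V$ with $g(V,V)=\pm1$ at each point, $R=(N-H)\varphi(B)+H\pi_1$, where $B(X,Y)=g(X,V)g(Y,V)$. Theorem 2. Let $(M,g)$ and $(\overline M,\bar g)$ be pseudo-Riemannian manifolds of dimension $n\ge3$, with $g$ indefinite at every point, and such that at no point of $M$ the sectional curvature of $g$ is constant. Let $f:M\to\overline M$ be a diffeomorphism such that for every weakly degenerate plane $\alpha_0\subset T_pM$, $p\in M$, $$\lim_{\alpha\to\alpha_0}\frac{\overline K(f_*\alpha)}{K(\alpha)}=1,$$ where $\alpha$ runs through the nondegenerate planes of $T_pM$ with nondegenerate image and $K(\alpha)\neq0$. Assume $f^*\bar g=e^{2\sigma}g$ for a smooth function $\sigma$ on $M$. Then: (a)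 if $\nabla\sigma$ vanishes identically, or if $n\ge4$ and $M$ is nowhere conformally flat, then $f$ is an isometry; (b) if $\nabla\sigma$ is isotropic (that is, $\nabla\sigma\ne0$ and $g(\nabla\sigma,\nabla\sigma)=0$ at every point) and either $n\ge4$, or $n=3$ and $M$ is conformally flat, then $M$ is a conformally flat $K_n^*$-manifold; moreover, every point $p$ such that $\nabla R\neq0$ at $p$, or $\nabla R=0$ in a neighbourhood of $p$, has an open neighbourhood $U$ with a recurrence function $v$ such that $\sigma=F\circ v$ on $U$, for a function $F$ smooth near each value of $v$; (c) if $g(\nabla\sigma,\nabla\sigma)$ vanishes nowhere and either $n\ge4$, or $n=3$ and $M$ is conformally flat, then there are $H,N,V$ such that $M$ is a manifold $M(H,N,V)$ of quasi-constant curvature, and $\nabla H$, $\nabla N$ and $V$ are proportional to $\nabla\sigma$ at each point. -/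

import Mathlib

open Set Filter Topology Manifold Bundle
open scoped ContDiff

noncomputable section

namespace PseudoRiem

/-! ### Tensor calculus of a metric on an open piece of a vector space

`G y` is the metric at the point `y`; constant vectors play the role of coordinate vector fields. -/

section Local

variable {E : Type*} [NormedAddCommGroup E] [NormedSpace ℝ E]

/-- The Christoffel map `Γ_y(u, v) = ∇_u v` of the Levi-Civita connection (for constant `v`):
`G(Γ(u,v),w) = (1/2) (D_u G(v,w) + D_v G(u,w) - D_w G(u,v))`, with the index raised by `G`. -/
def christoffel (G : E → E →L[ℝ] E →L[ℝ] ℝ) (y u v : E) : E :=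
  (G y).inverse ((1 / 2 : ℝ) •
    (fderiv ℝ G y u v + fderiv ℝ G y v u - fderiv ℝ (fun z => G z u v) y))

/-- `R(u,v)w = ∇_u ∇_v w - ∇_v ∇_u w` for constant vectors `u, v, w`. -/
def curvatureOp (G : E → E →L[ℝ] E →L[ℝ] ℝ) (y u v w : E) : E :=
  fderiv ℝ (fun z => christoffel G z v w) y u - fderiv ℝ (fun z => christoffel G z u w) y v
    + christoffel G y u (christoffel G y v w) - christoffel G y v (christoffel G y u w)

/-- The curvature tensor of type `(0,4)`: `R(u,v,w,t) = G(R(u,v)w, t)`. -/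
def curvatureForm (G : E → E →L[ℝ] E →L[ℝ] ℝ) (y u v w t : E) : ℝ :=
  G y (curvatureOp G y u v w) t

/-- The covariant derivative `(∇_a R)(u,v,w,t)` of the curvature tensor. -/
def covDerivCurvatureForm (G : E → E →L[ℝ] E →L[ℝ] ℝ) (y a u v w t : E) : ℝ :=
  fderiv ℝ (fun z => curvatureForm G z u v w t) y a
    - curvatureForm G y (christoffel G y a u) v w t
    - curvatureForm G y u (christoffel G y a v) w t
    - curvatureForm G y u v (christoffel G y a w) t
    - curvatureForm G y u v w (christoffel G y a t)

end Local

/-! ### Manifolds -/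

section Mfd

variable {n : ℕ} {M : Type*} [TopologicalSpace M] [ChartedSpace (EuclideanSpace ℝ (Fin n)) M]

/-- The metric field `g` written in the preferred chart at `p`: the pullback of `g` under the
inverse chart (tangent spaces are copies of the model space). -/
def inChart (g : ∀ q : M, TangentSpace (𝓡 n) q →L[ℝ] TangentSpace (𝓡 n) q →L[ℝ] ℝ) (p : M)
    (y : EuclideanSpace ℝ (Fin n)) :
    EuclideanSpace ℝ (Fin n) →L[ℝ] EuclideanSpace ℝ (Fin n) →L[ℝ] ℝ :=
  let B : EuclideanSpace ℝ (Fin n) →L[ℝ] EuclideanSpace ℝ (Fin n) →L[ℝ] ℝ :=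
    g ((extChartAt (𝓡 n) p).symm y)
  let D : EuclideanSpace ℝ (Fin n) →L[ℝ] EuclideanSpace ℝ (Fin n) :=
    mfderiv 𝓘(ℝ, EuclideanSpace ℝ (Fin n)) (𝓡 n) (extChartAt (𝓡 n) p).symm y
  B.bilinearComp D D

/-- The coordinates of a tangent vector at `p` in the preferred chart at `p`. -/
def coord (p : M) (x : TangentSpace (𝓡 n) p) : EuclideanSpace ℝ (Fin n) :=
  mfderiv (𝓡 n) 𝓘(ℝ, EuclideanSpace ℝ (Fin n)) (extChartAt (𝓡 n) p) p x

/-- The curvature tensor `R(x,y,z,u)` of the metric field `g` at `p`. -/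
def curv (g : ∀ q : M, TangentSpace (𝓡 n) q →L[ℝ] TangentSpace (𝓡 n) q →L[ℝ] ℝ) (p : M)
    (x y z u : TangentSpace (𝓡 n) p) : ℝ :=
  curvatureForm (inChart g p) (extChartAt (𝓡 n) p p) (coord p x) (coord p y) (coord p z) (coord p u)

/-- The covariant derivative `(∇_a R)(x,y,z,u)` at `p`. -/
def covDerivCurv (g : ∀ q : M, TangentSpace (𝓡 n) q →L[ℝ] TangentSpace (𝓡 n) q →L[ℝ] ℝ) (p : M)
    (a x y z u : TangentSpace (𝓡 n) p) : ℝ :=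
  covDerivCurvatureForm (inChart g p) (extChartAt (𝓡 n) p p)
    (coord p a) (coord p x) (coord p y) (coord p z) (coord p u)

/-- `π₁(z,u,v,w) = g(z,w) g(u,v) - g(z,v) g(u,w)`. -/
def pi1 (g : ∀ q : M, TangentSpace (𝓡 n) q →L[ℝ] TangentSpace (𝓡 n) q →L[ℝ] ℝ) (p : M)
    (z u v w : TangentSpace (𝓡 n) p) : ℝ :=
  g p z w * g p u v - g p z v * g p u w

/-- `φ(Q)(x,y,z,u) = g(x,u)Q(y,z) - g(x,z)Q(y,u) + g(y,z)Q(x,u) - g(y,u)Q(x,z)`. -/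
def phi (g : ∀ q : M, TangentSpace (𝓡 n) q →L[ℝ] TangentSpace (𝓡 n) q →L[ℝ] ℝ) (p : M)
    (Q : TangentSpace (𝓡 n) p → TangentSpace (𝓡 n) p → ℝ) (x y z u : TangentSpace (𝓡 n) p) : ℝ :=
  g p x u * Q y z - g p x z * Q y u + g p y z * Q x u - g p y u * Q x z

/-- The sectional curvature of the plane spanned by `x, y` (meaningful when `π₁(x,y,y,x) ≠ 0`,
that is, when `x, y` span a nondegenerate plane). -/
def sectional (g : ∀ q : M, TangentSpace (𝓡 n) q →L[ℝ] TangentSpace (𝓡 n) q →L[ℝ] ℝ) (p : M)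
    (x y : TangentSpace (𝓡 n) p) : ℝ :=
  curv g p x y y x / pi1 g p x y y x

/-- The differential of a real function, as a covector. -/
def diff (σ : M → ℝ) (p : M) : TangentSpace (𝓡 n) p →L[ℝ] ℝ :=
  mfderiv (𝓡 n) 𝓘(ℝ, ℝ) σ p

/-- The gradient `∇σ`: `g(∇σ, x) = dσ(x)`. -/
def grad (g : ∀ q : M, TangentSpace (𝓡 n) q →L[ℝ] TangentSpace (𝓡 n) q →L[ℝ] ℝ) (σ : M → ℝ)
    (p : M) : TangentSpace (𝓡 n) p :=
  (g p).inverse (diff σ p)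

/-- `x, y` span a plane on which `g` has rank one. -/
def WeaklyDegenerate (g : ∀ q : M, TangentSpace (𝓡 n) q →L[ℝ] TangentSpace (𝓡 n) q →L[ℝ] ℝ)
    (p : M) (x y : TangentSpace (𝓡 n) p) : Prop :=
  LinearIndependent ℝ ![x, y] ∧
    (!![g p x x, g p x y; g p y x, g p y y] : Matrix (Fin 2) (Fin 2) ℝ).rank = 1

/-- The sectional curvature of `g` is constant at the point `p`. -/
def ConstantCurvatureAt
    (g : ∀ q : M, TangentSpace (𝓡 n) q →L[ℝ] TangentSpace (𝓡 n) q →L[ℝ] ℝ) (p : M) : Prop :=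
  ∃ c : ℝ, ∀ x y : TangentSpace (𝓡 n) p, pi1 g p x y y x ≠ 0 → sectional g p x y = c

/-- Some neighbourhood `U` of `p` is conformally flat: `e^{2ρ} g` is a flat metric on `U` for
a smooth function `ρ` on `U`. -/
def ConformallyFlatAt
    (g : ∀ q : M, TangentSpace (𝓡 n) q →L[ℝ] TangentSpace (𝓡 n) q →L[ℝ] ℝ) (p : M) : Prop :=
  ∃ (U : Set M) (ρ : M → ℝ), IsOpen U ∧ p ∈ U ∧ ContMDiffOn (𝓡 n) 𝓘(ℝ, ℝ) ∞ ρ U ∧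
    ∀ q ∈ U, ∀ x y z u : TangentSpace (𝓡 n) q,
      curv (fun r => Real.exp (2 * ρ r) • g r) q x y z u = 0

/-- `g` is locally conformal to a flat metric. -/
def ConformallyFlat
    (g : ∀ q : M, TangentSpace (𝓡 n) q →L[ℝ] TangentSpace (𝓡 n) q →L[ℝ] ℝ) : Prop :=
  ∀ p : M, ConformallyFlatAt g p

/-- No nonempty open subset is conformally flat. -/
def NowhereConformallyFlat
    (g : ∀ q : M, TangentSpace (𝓡 n) q →L[ℝ] TangentSpace (𝓡 n) q →L[ℝ] ℝ) : Prop :=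
  ∀ p : M, ¬ ConformallyFlatAt g p

/-- On `U`, the form `α` satisfies the equations of a recurrence form: either `∇R = α ⊗ R`, or
`∇R = 0` and the cyclic sum of `α(x) R(y,z,u,v)` over `x, y, z` vanishes. -/
def RecurrenceEquations
    (g : ∀ q : M, TangentSpace (𝓡 n) q →L[ℝ] TangentSpace (𝓡 n) q →L[ℝ] ℝ) (U : Set M)
    (α : ∀ q : M, TangentSpace (𝓡 n) q →L[ℝ] ℝ) : Prop :=
  (∀ q ∈ U, ∀ a x y z u : TangentSpace (𝓡 n) q,
      covDerivCurv g q a x y z u = α q a * curv g q x y z u) ∨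
  ((∀ q ∈ U, ∀ a x y z u : TangentSpace (𝓡 n) q, covDerivCurv g q a x y z u = 0) ∧
    ∀ q ∈ U, ∀ x y z u v : TangentSpace (𝓡 n) q,
      α q x * curv g q y z u v + α q y * curv g q z x u v + α q z * curv g q x y u v = 0)

/-- `v` is a recurrence function on the open set `U` with nowhere vanishing gradient. -/
def IsRecurrenceFunctionOn
    (g : ∀ q : M, TangentSpace (𝓡 n) q →L[ℝ] TangentSpace (𝓡 n) q →L[ℝ] ℝ) (U : Set M)
    (v : M → ℝ) : Prop :=
  ContMDiffOn (𝓡 n) 𝓘(ℝ, ℝ) ∞ v U ∧ (∀ q ∈ U, diff (n := n) v q ≠ 0) ∧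
    RecurrenceEquations g U (diff v)

section Smooth

variable [IsManifold (𝓡 n) ∞ M]

/-- A pseudo-Riemannian metric: a smooth field of nondegenerate symmetric bilinear forms on the
tangent spaces. -/
structure Metric (n : ℕ) (M : Type*) [TopologicalSpace M]
    [ChartedSpace (EuclideanSpace ℝ (Fin n)) M] [IsManifold (𝓡 n) ∞ M] where
  /-- the scalar product on each tangent space -/
  val : ∀ q : M, TangentSpace (𝓡 n) q →L[ℝ] TangentSpace (𝓡 n) q →L[ℝ] ℝ
  symm : ∀ (q : M) (x y : TangentSpace (𝓡 n) q), val q x y = val q y x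
  nondeg : ∀ (q : M) (x : TangentSpace (𝓡 n) q), (∀ y, val q x y = 0) → x = 0
  smooth : ContMDiff (𝓡 n) ((𝓡 n).prod 𝓘(ℝ, EuclideanSpace ℝ (Fin n) →L[ℝ]
      EuclideanSpace ℝ (Fin n) →L[ℝ] ℝ)) ∞
    (fun q => TotalSpace.mk' (EuclideanSpace ℝ (Fin n) →L[ℝ] EuclideanSpace ℝ (Fin n) →L[ℝ] ℝ)
      (E := fun q : M => TangentSpace (𝓡 n) q →L[ℝ] TangentSpace (𝓡 n) q →L[ℝ] ℝ) q (val q))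

/-- The metric is indefinite at each point: every tangent space has an isotropic vector. -/
def Metric.Indefinite (g : Metric n M) : Prop :=
  ∀ p : M, ∃ x : TangentSpace (𝓡 n) p, x ≠ 0 ∧ g.val p x x = 0

/-- A smooth differential form of degree one. -/
def SmoothOneForm (α : ∀ q : M, TangentSpace (𝓡 n) q →L[ℝ] ℝ) : Prop :=
  ContMDiff (𝓡 n) ((𝓡 n).prod 𝓘(ℝ, EuclideanSpace ℝ (Fin n) →L[ℝ] ℝ)) ∞
    (fun q => TotalSpace.mk' (EuclideanSpace ℝ (Fin n) →L[ℝ] ℝ)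
      (E := fun q : M => TangentSpace (𝓡 n) q →L[ℝ] ℝ) q (α q))

/-- A `K_n^*`-manifold: nonflat, and recurrent with a recurrence form `α ≠ 0`, or symmetric with
a form `α ≠ 0` for which the cyclic sum of `α ⊗ R` vanishes. -/
def IsKStar (g : Metric n M) : Prop :=
  (∃ (p : M) (x y z u : TangentSpace (𝓡 n) p), curv g.val p x y z u ≠ 0) ∧
  ∃ α : ∀ q : M, TangentSpace (𝓡 n) q →L[ℝ] ℝ, SmoothOneForm α ∧ (∃ p, α p ≠ 0) ∧
    RecurrenceEquations g.val univ α

/-- `(M, g)` is a manifold `M(H,N,V)` of quasi-constant curvature. -/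
def IsQuasiConstantCurvature (g : Metric n M) (H N : M → ℝ)
    (V : ∀ q : M, TangentSpace (𝓡 n) q) : Prop :=
  ConformallyFlat g.val ∧
  ContMDiff (𝓡 n) 𝓘(ℝ, ℝ) ∞ H ∧ ContMDiff (𝓡 n) 𝓘(ℝ, ℝ) ∞ N ∧
  ContMDiff (𝓡 n) (𝓡 n).tangent ∞ (fun q => (⟨q, V q⟩ : TangentBundle (𝓡 n) M)) ∧
  (∀ q, g.val q (V q) (V q) = 1 ∨ g.val q (V q) (V q) = -1) ∧
  ∀ (q : M) (x y z u : TangentSpace (𝓡 n) q),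
    curv g.val q x y z u =
      (N q - H q) * phi g.val q (fun a b => g.val q a (V q) * g.val q b (V q)) x y z u
        + H q * pi1 g.val q x y z u

variable {M' : Type*} [TopologicalSpace M'] [ChartedSpace (EuclideanSpace ℝ (Fin n)) M']
  [IsManifold (𝓡 n) ∞ M']

/-- The condition `K̄(f_* α) / K(α) → 1` as `α → α₀`, where `α₀ ⊆ T_p M` is the plane spanned by
`x₀, y₀` and `α = span(x, y)` runs through the nondegenerate planes of `T_p M` whose images are
nondegenerate and for which the quotient is defined. -/
def CurvatureRatioTendstoOne (g : Metric n M) (g' : Metric n M') (f : M → M') (p : M)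
    (x₀ y₀ : TangentSpace (𝓡 n) p) : Prop :=
  Tendsto
    (fun w : TangentSpace (𝓡 n) p × TangentSpace (𝓡 n) p =>
      sectional g'.val (f p) (mfderiv (𝓡 n) (𝓡 n) f p w.1) (mfderiv (𝓡 n) (𝓡 n) f p w.2)
        / sectional g.val p w.1 w.2)
    (𝓝 (x₀, y₀) ⊓ 𝓟 {w | pi1 g.val p w.1 w.2 w.2 w.1 ≠ 0 ∧
      pi1 g'.val (f p) (mfderiv (𝓡 n) (𝓡 n) f p w.1) (mfderiv (𝓡 n) (𝓡 n) f p w.2)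
        (mfderiv (𝓡 n) (𝓡 n) f p w.2) (mfderiv (𝓡 n) (𝓡 n) f p w.1) ≠ 0 ∧
      sectional g.val p w.1 w.2 ≠ 0})
    (𝓝 1)

/-- `f` preserves the metric: `f^* ḡ = g`. -/
def IsIsometry (g : Metric n M) (g' : Metric n M') (f : M → M') : Prop :=
  ∀ (p : M) (x y : TangentSpace (𝓡 n) p),
    g'.val (f p) (mfderiv (𝓡 n) (𝓡 n) f p x) (mfderiv (𝓡 n) (𝓡 n) f p y) = g.val p x y

end Smooth

end Mfd

end PseudoRiem

end

noncomputable section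

set_option linter.unusedSectionVars false
set_option synthInstance.maxHeartbeats 200000
set_option maxSynthPendingDepth 6

/-! Write `R̄` for the pulled-back curvature tensor of the second metric. Since `π₁` is multiplied
by `e^{4σ}`, the quotient of sectional curvatures is `R̄ / (e^{4σ} R)`, and the hypothesis says that
`R̄ = e^{4σ} R` on weakly degenerate planes. For an indefinite form in dimension at least three, a
curvature-like tensor vanishing on these planes is a multiple of `π₁`
(`exists_eq_smul_of_isotropic`), so `R̄ = e^{4σ} R + k π₁` at each point. Comparison with the
conformal change formula `R̄ = e^{2σ} (R - φ(Hess σ - dσ ⊗ dσ + ½ |∇σ|² g))` and `φ(g) = 2 π₁` gives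
the identity on which everything rests (`curvatureRelation`): `(e^{2σ} - 1) R = φ(- Hess σ + dσ ⊗ dσ
+ l g)`.

(a) If `dσ = 0`, the right side is a multiple of `π₁`, so `σ ≠ 0` would force constant curvature. In
general `R = φ(P)` wherever `σ ≠ 0`. In dimension at least four the second Bianchi identity then
makes `P` a Codazzi tensor, and the Weyl–Schouten theorem (`IsMetricOn.exists_flat_conformal`, from
a Frobenius theorem for linear systems) yields conformal flatness.

(b), (c) If `∇σ` has no zeros, `σ ≠ 0` on a dense set. By continuity `R = φ(P)` everywhere, `P`
being the Schouten form, and `(e^{2σ} - 1) P = - Hess σ + dσ ⊗ dσ + λ g`. Differentiating,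
skew-symmetrizing and using the Ricci identity and the Codazzi equation leaves `dσ ∧ P = ν ∧ g`,
hence `P = κ g + τ dσ ⊗ dσ`. The Codazzi equation of this expression makes `dκ` and `dτ` multiples
of `dσ`.

If `∇σ` is isotropic, the constancy of its square forces `κ = 0`. Then `R = τ φ(dσ ⊗ dσ)` and `∇R =
ψ ⊗ R` with `ψ = dτ/τ + 2 (1 - (e^{2σ} - 1) τ) dσ`. Locally `ψ = d(K ∘ σ)`, and `K` is inverted
where `ψ ≠ 0`; where `∇R` vanishes on an open set, `σ` itself is a recurrence function. If `∇σ` is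
nowhere isotropic, normalizing it to a unit field gives quasi-constant curvature.

The calculus is carried out on open subsets of a vector space and transferred by naturality, because
`curv` at a point is computed in the preferred chart at that very point. -/

namespace PseudoRiem

/-! ### The Levi-Civita connection and the symmetries of its curvature. -/

section LeviCivita

variable {E : Type*} [NormedAddCommGroup E] [NormedSpace ℝ E] [FiniteDimensional ℝ E]

/-- `G` is a smooth pseudo-Riemannian metric on the open set `U`. -/
structure IsMetricOn (G : E → E →L[ℝ] E →L[ℝ] ℝ) (U : Set E) : Prop where
  isOpen : IsOpen U
  smooth : ContDiffOn ℝ ∞ G U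
  symm : ∀ y ∈ U, ∀ u v, G y u v = G y v u
  nondeg : ∀ y ∈ U, ∀ u, (∀ v, G y u v = 0) → u = 0

variable {G : E → E →L[ℝ] E →L[ℝ] ℝ} {U : Set E}

theorem IsMetricOn.mono (hG : IsMetricOn G U) {V : Set E} (hV : IsOpen V) (h : V ⊆ U) :
    IsMetricOn G V :=
  ⟨hV, hG.smooth.mono h, fun y hy => hG.symm y (h hy), fun y hy => hG.nondeg y (h hy)⟩

/-- A nondegenerate form is injective into the dual, which has the same dimension. On a
noninvertible map `inverse` is zero, so this is what gives the Christoffel map and the gradient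
their meaning. -/
theorem isInvertible_of_nondeg {B : E →L[ℝ] E →L[ℝ] ℝ} (hB : ∀ u, (∀ v, B u v = 0) → u = 0) :
    B.IsInvertible := by
  have hinj : Function.Injective (B : E →ₗ[ℝ] E →L[ℝ] ℝ) := by
    rw [← LinearMap.ker_eq_bot, LinearMap.ker_eq_bot']
    intro u hu
    exact hB u fun v => by
      have := congrArg (fun l : E →L[ℝ] ℝ => l v) hu
      simpa using this
  have hd : Module.finrank ℝ E = Module.finrank ℝ (E →L[ℝ] ℝ) := by
    rw [← (LinearMap.toContinuousLinearMap (𝕜 := ℝ) (E := E) (F' := ℝ)).finrank_eq]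
    exact (Subspace.dual_finrank_eq (K := ℝ) (V := E)).symm
  let e := LinearEquiv.ofInjectiveOfFinrankEq (B : E →ₗ[ℝ] E →L[ℝ] ℝ) hinj hd
  exact ⟨e.toContinuousLinearEquiv, by ext; rfl⟩

theorem apply_inverse {B : E →L[ℝ] E →L[ℝ] ℝ} (hB : ∀ u, (∀ v, B u v = 0) → u = 0)
    (l : E →L[ℝ] ℝ) (v : E) : B (B.inverse l) v = l v := by
  rw [(isInvertible_of_nondeg hB).self_apply_inverse]

theorem eq_of_forall_apply {B : E →L[ℝ] E →L[ℝ] ℝ} (hB : ∀ u, (∀ v, B u v = 0) → u = 0)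
    {a b : E} (h : ∀ v, B a v = B b v) : a = b := by
  rw [← sub_eq_zero]
  exact hB _ fun v => by simp [h]

theorem inverse_apply_eq {B : E →L[ℝ] E →L[ℝ] ℝ} (hB : ∀ u, (∀ v, B u v = 0) → u = 0)
    {l : E →L[ℝ] ℝ} {a : E} (h : ∀ v, B a v = l v) : B.inverse l = a :=
  eq_of_forall_apply hB fun v => by rw [apply_inverse hB, h]

theorem IsMetricOn.smooth_inverse (hG : IsMetricOn G U) :
    ContDiffOn ℝ ∞ (fun y => (G y).inverse) U := by
  intro y hy
  have := FiniteDimensional.complete ℝ E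
  have h := (isInvertible_of_nondeg (hG.nondeg y hy)).contDiffAt_map_inverse (n := ∞)
  exact h.comp_contDiffWithinAt y (hG.smooth y hy)

/-- The Levi-Civita connection as a field of bilinear maps. -/
def leviCivita (G : E → E →L[ℝ] E →L[ℝ] ℝ) (y : E) : E →L[ℝ] E →L[ℝ] E :=
  LinearMap.toContinuousLinearMap
    { toFun := fun u => (G y).inverse.comp ((1 / 2 : ℝ) •
        (fderiv ℝ G y u + (fderiv ℝ G y).flip u - ((fderiv ℝ G y).flip u).flip))
      map_add' := fun u v => by
        ext w; simp only [ContinuousLinearMap.comp_apply, add_apply, smul_apply]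
        rw [← map_add]; congr 1; ext; simp; ring
      map_smul' := fun c u => by
        ext w; simp only [RingHom.id_apply, ContinuousLinearMap.comp_apply,
          smul_apply]
        refine Eq.trans ?_ ((G y).inverse.map_smul c _); congr 1; ext; simp; ring }

theorem leviCivita_apply (G : E → E →L[ℝ] E →L[ℝ] ℝ) (y u v : E) :
    leviCivita G y u v = (G y).inverse ((1 / 2 : ℝ) •
        (fderiv ℝ G y u v + fderiv ℝ G y v u - ((fderiv ℝ G y).flip u).flip v)) := rfl

theorem IsMetricOn.contDiffAt (hG : IsMetricOn G U) {y : E} (hy : y ∈ U) : ContDiffAt ℝ ∞ G y :=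
  hG.smooth.contDiffAt (hG.isOpen.mem_nhds hy)

theorem IsMetricOn.differentiableAt (hG : IsMetricOn G U) {y : E} (hy : y ∈ U) :
    DifferentiableAt ℝ G y :=
  (hG.contDiffAt hy).differentiableAt (by simp)

theorem smooth_fderiv {F : Type*} [NormedAddCommGroup F] [NormedSpace ℝ F] {f : E → F}
    {U : Set E} (hU : IsOpen U) (hf : ContDiffOn ℝ ∞ f U) : ContDiffOn ℝ ∞ (fderiv ℝ f) U :=
  hf.fderiv_of_isOpen hU (by simp)

theorem IsMetricOn.smooth_leviCivita (hG : IsMetricOn G U) :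
    ContDiffOn ℝ ∞ (leviCivita G) U := by
  rw [contDiffOn_clm_apply]
  intro u
  rw [contDiffOn_clm_apply]
  intro v
  simp only [leviCivita_apply]
  have hD := smooth_fderiv hG.isOpen hG.smooth
  refine hG.smooth_inverse.clm_apply (ContDiffOn.const_smul _ ((ContDiffOn.add ?_ ?_).sub ?_))
  · exact (hD.clm_apply contDiffOn_const).clm_apply contDiffOn_const
  · exact (hD.clm_apply contDiffOn_const).clm_apply contDiffOn_const
  · rw [contDiffOn_clm_apply]
    intro w
    simp only [ContinuousLinearMap.flip_apply]
    exact ((hD.clm_apply contDiffOn_const).clm_apply contDiffOn_const).clm_apply contDiffOn_const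

theorem fderiv_apply₂ {F F' F'' : Type*} [NormedAddCommGroup F] [NormedSpace ℝ F]
    [NormedAddCommGroup F'] [NormedSpace ℝ F'] [NormedAddCommGroup F''] [NormedSpace ℝ F'']
    {B : E → F →L[ℝ] F' →L[ℝ] F''} {y : E}
    (hB : DifferentiableAt ℝ B y) (u : F) (v : F') (a : E) :
    fderiv ℝ (fun z => B z u v) y a = fderiv ℝ B y a u v := by
  have h1 : HasFDerivAt (fun z => B z u) ((fderiv ℝ B y).flip u) y := by
    have := hB.hasFDerivAt.clm_apply (hasFDerivAt_const u y)
    refine this.congr_fderiv ?_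
    ext; simp
  have h2 := h1.clm_apply (hasFDerivAt_const v y)
  rw [h2.fderiv]; simp

/-- The derivative of `z ↦ G z u v` contracts that of `G` because `G` is differentiable. From here
on the connection is a smooth field of bilinear maps that can itself be differentiated. -/
theorem IsMetricOn.christoffel_eq (hG : IsMetricOn G U) {y : E} (hy : y ∈ U) (u v : E) :
    christoffel G y u v = leviCivita G y u v := by
  rw [leviCivita_apply, christoffel]
  congr 3
  ext w
  simp [fderiv_apply₂ (hG.differentiableAt hy)]

theorem IsMetricOn.fderiv_symm (hG : IsMetricOn G U) {y : E} (hy : y ∈ U) (a u v : E) :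
    fderiv ℝ G y a u v = fderiv ℝ G y a v u := by
  rw [← fderiv_apply₂ (hG.differentiableAt hy), ← fderiv_apply₂ (hG.differentiableAt hy)]
  congr 1
  apply Filter.EventuallyEq.fderiv_eq
  filter_upwards [hG.isOpen.mem_nhds hy] with z hz using hG.symm z hz u v

theorem IsMetricOn.apply_leviCivita (hG : IsMetricOn G U) {y : E} (hy : y ∈ U) (u v w : E) :
    G y (leviCivita G y u v) w =
      1 / 2 * (fderiv ℝ G y u v w + fderiv ℝ G y v u w - fderiv ℝ G y w u v) := by
  rw [leviCivita_apply, apply_inverse (hG.nondeg y hy)]; simp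

theorem IsMetricOn.leviCivita_symm (hG : IsMetricOn G U) {y : E} (hy : y ∈ U) (u v : E) :
    leviCivita G y u v = leviCivita G y v u := by
  refine eq_of_forall_apply (hG.nondeg y hy) fun w => ?_
  rw [hG.apply_leviCivita hy, hG.apply_leviCivita hy, hG.fderiv_symm hy w u v]; ring

/-- Metric compatibility `∇G = 0`. It removes all derivatives of `G` from the later computations. -/
theorem IsMetricOn.fderiv_eq (hG : IsMetricOn G U) {y : E} (hy : y ∈ U) (a u v : E) :
    fderiv ℝ G y a u v = G y (leviCivita G y a u) v + G y u (leviCivita G y a v) := by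
  rw [hG.symm y hy u, hG.apply_leviCivita hy, hG.apply_leviCivita hy, hG.fderiv_symm hy a v u,
    hG.fderiv_symm hy v a u, hG.fderiv_symm hy u a v]; ring

/-- The Koszul formula: the Levi-Civita connection is the torsion-free metric connection. -/
theorem IsMetricOn.leviCivita_unique (hG : IsMetricOn G U) {y : E} (hy : y ∈ U)
    {B : E → E → E} (hB : ∀ u v, B u v = B v u)
    (h : ∀ a u v, fderiv ℝ G y a u v = G y (B a u) v + G y u (B a v)) (u v : E) :
    leviCivita G y u v = B u v := by
  refine eq_of_forall_apply (hG.nondeg y hy) fun w => ?_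
  rw [hG.apply_leviCivita hy, h, h, h, hB v u, hB w u, hB w v, hG.symm y hy v, hG.symm y hy u]
  ring

/-- The curvature of the connection `Γ` as a field of endomorphisms. -/
def curvEnd (Γ : E → E →L[ℝ] E →L[ℝ] E) (y u v : E) : E →L[ℝ] E :=
  fderiv ℝ Γ y u v - fderiv ℝ Γ y v u + (Γ y u).comp (Γ y v) - (Γ y v).comp (Γ y u)

theorem IsMetricOn.differentiableAt_leviCivita (hG : IsMetricOn G U) {y : E} (hy : y ∈ U) :
    DifferentiableAt ℝ (leviCivita G) y :=
  (hG.smooth_leviCivita.contDiffAt (hG.isOpen.mem_nhds hy)).differentiableAt (by simp)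

theorem IsMetricOn.curvatureOp_eq (hG : IsMetricOn G U) {y : E} (hy : y ∈ U) (u v w : E) :
    curvatureOp G y u v w = curvEnd (leviCivita G) y u v w := by
  have h : ∀ a b c : E, fderiv ℝ (fun z => christoffel G z a b) y c
      = fderiv ℝ (leviCivita G) y c a b := by
    intro a b c
    rw [← fderiv_apply₂ (hG.differentiableAt_leviCivita hy)]
    congr 1
    apply Filter.EventuallyEq.fderiv_eq
    filter_upwards [hG.isOpen.mem_nhds hy] with z hz using hG.christoffel_eq hz a b
  simp [curvatureOp, curvEnd, h, hG.christoffel_eq hy]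

theorem IsMetricOn.curvatureForm_eq (hG : IsMetricOn G U) {y : E} (hy : y ∈ U) (u v w t : E) :
    curvatureForm G y u v w t = G y (curvEnd (leviCivita G) y u v w) t := by
  rw [curvatureForm, hG.curvatureOp_eq hy]

theorem curvEnd_antisymm (Γ : E → E →L[ℝ] E →L[ℝ] E) (y u v : E) :
    curvEnd Γ y u v = - curvEnd Γ y v u := by
  simp only [curvEnd]; abel

/-- The curvature of `Γ` as a bilinear map. -/
theorem curvEnd_add_left (Γ : E → E →L[ℝ] E →L[ℝ] E) (y u u' v : E) :
    curvEnd Γ y (u + u') v = curvEnd Γ y u v + curvEnd Γ y u' v := by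
  simp only [curvEnd, map_add, add_apply, ContinuousLinearMap.add_comp,
    ContinuousLinearMap.comp_add]; abel

theorem curvEnd_smul_left (Γ : E → E →L[ℝ] E →L[ℝ] E) (y u v : E) (c : ℝ) :
    curvEnd Γ y (c • u) v = c • curvEnd Γ y u v := by
  simp only [curvEnd, map_smul, smul_apply, ContinuousLinearMap.smul_comp,
    ContinuousLinearMap.comp_smul, smul_add, smul_sub]

theorem curvEnd_add_right (Γ : E → E →L[ℝ] E →L[ℝ] E) (y u v v' : E) :
    curvEnd Γ y u (v + v') = curvEnd Γ y u v + curvEnd Γ y u v' := by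
  rw [curvEnd_antisymm, curvEnd_add_left, curvEnd_antisymm Γ y v, curvEnd_antisymm Γ y v']; abel

theorem curvEnd_smul_right (Γ : E → E →L[ℝ] E →L[ℝ] E) (y u v : E) (c : ℝ) :
    curvEnd Γ y u (c • v) = c • curvEnd Γ y u v := by
  rw [curvEnd_antisymm, curvEnd_smul_left, curvEnd_antisymm Γ y v]; simp

theorem IsMetricOn.fderiv_leviCivita_symm (hG : IsMetricOn G U) {y : E} (hy : y ∈ U)
    (a u v : E) : fderiv ℝ (leviCivita G) y a u v = fderiv ℝ (leviCivita G) y a v u := by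
  have hd := hG.differentiableAt_leviCivita hy
  rw [← fderiv_apply₂ hd, ← fderiv_apply₂ hd]
  congr 1
  apply Filter.EventuallyEq.fderiv_eq
  filter_upwards [hG.isOpen.mem_nhds hy] with z hz using hG.leviCivita_symm hz u v

theorem IsMetricOn.bianchi_first (hG : IsMetricOn G U) {y : E} (hy : y ∈ U) (u v w : E) :
    curvEnd (leviCivita G) y u v w + curvEnd (leviCivita G) y v w u
      + curvEnd (leviCivita G) y w u v = 0 := by
  simp only [curvEnd, add_apply, sub_apply,
    ContinuousLinearMap.comp_apply]
  rw [hG.fderiv_leviCivita_symm hy u v w, hG.fderiv_leviCivita_symm hy v u w,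
    hG.fderiv_leviCivita_symm hy w u v, hG.leviCivita_symm hy v w, hG.leviCivita_symm hy u w,
    hG.leviCivita_symm hy v u]
  abel

theorem fderiv_fderiv_symm {F : Type*} [NormedAddCommGroup F] [NormedSpace ℝ F] {f : E → F} {y : E}
    (hf : ContDiffAt ℝ ∞ f y) (u v : E) :
    fderiv ℝ (fderiv ℝ f) y u v = fderiv ℝ (fderiv ℝ f) y v u :=
  (hf.isSymmSndFDerivAt (by simp; exact WithTop.coe_le_coe.2 (by exact le_top))) u v

/-- The second derivatives of `G` commute; expanding both orders by metric compatibility leaves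
exactly the part of the curvature symmetric in `w, t`. -/
theorem IsMetricOn.curvature_skew (hG : IsMetricOn G U) {y : E} (hy : y ∈ U) (u v w t : E) :
    G y (curvEnd (leviCivita G) y u v w) t = - G y (curvEnd (leviCivita G) y u v t) w := by
  have hd := hG.differentiableAt_leviCivita hy
  have key : ∀ a b : E, fderiv ℝ (fderiv ℝ G) y a b w t =
      fderiv ℝ G y a (leviCivita G y b w) t + G y (fderiv ℝ (leviCivita G) y a b w) t
      + (fderiv ℝ G y a w (leviCivita G y b t) + G y w (fderiv ℝ (leviCivita G) y a b t)) := by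
    intro a b
    have h1 : HasFDerivAt (fun z => fderiv ℝ G z b)
        ((fderiv ℝ (fderiv ℝ G) y).flip b) y := by
      have h0 : DifferentiableAt ℝ (fderiv ℝ G) y :=
        ((smooth_fderiv hG.isOpen hG.smooth).contDiffAt
          (hG.isOpen.mem_nhds hy)).differentiableAt (by simp)
      refine (h0.hasFDerivAt.clm_apply (hasFDerivAt_const b y)).congr_fderiv ?_
      ext; simp
    have h2 := (h1.clm_apply (hasFDerivAt_const w y)).clm_apply (hasFDerivAt_const t y)
    have hΓ : ∀ c : E, HasFDerivAt (fun z => leviCivita G z b c)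
        (((fderiv ℝ (leviCivita G) y).flip b).flip c) y := by
      intro c
      refine ((hd.hasFDerivAt.clm_apply (hasFDerivAt_const b y)).clm_apply
        (hasFDerivAt_const c y)).congr_fderiv ?_
      ext; simp
    have hGd := (hG.differentiableAt hy).hasFDerivAt
    have h3 := ((hGd.clm_apply (hΓ w)).clm_apply (hasFDerivAt_const t y)).add
      ((hGd.clm_apply (hasFDerivAt_const w y)).clm_apply (hΓ t))
    have h4 := h2.unique (h3.congr_of_eventuallyEq (by
      filter_upwards [hG.isOpen.mem_nhds hy] with z hz using hG.fderiv_eq hz b w t))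
    have := congrArg (fun l : E →L[ℝ] ℝ => l a) h4
    simp at this
    rw [this]; ring
  have h := key u v
  rw [fderiv_fderiv_symm (hG.contDiffAt hy) u v, key v u, hG.fderiv_eq hy, hG.fderiv_eq hy,
    hG.fderiv_eq hy, hG.fderiv_eq hy] at h
  rw [← sub_eq_zero, sub_neg_eq_add, hG.symm y hy _ w]
  simp only [curvEnd, add_apply, sub_apply,
    ContinuousLinearMap.comp_apply, map_add, map_sub]
  linear_combination -h

/-- The octahedron argument: four Bianchi sums, combined by means of the two skew symmetries. No
linearity enters. -/
theorem pair_symmetry {E : Type*} {R : E → E → E → E → ℝ} (h1 : ∀ u v w t, R u v w t = - R v u w t)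
    (h2 : ∀ u v w t, R u v w t = - R u v t w)
    (h3 : ∀ u v w t, R u v w t + R v w u t + R w u v t = 0) (u v w t : E) :
    R u v w t = R w t u v := by
  linarith [h3 u v w t, h3 v w t u, h3 w t u v, h3 t u v w, h1 u v w t, h1 v w u t, h1 w u v t,
    h1 w t u v, h2 u v w t, h2 v w t u, h2 v w u t, h1 v w t u, h2 w t u v, h1 t u v w, h2 t u v w,
    h2 w u v t, h1 w t v u, h2 w t v u, h1 u v t w, h2 u v t w, h1 t v w u, h2 t v w u, h1 v t w u,
    h1 u w t v, h2 u w t v, h1 u t w v, h2 u t w v, h1 t u w v, h2 u w v t, h1 t w u v,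
    h2 v t u w, h2 v t w u, h1 v t u w]

end LeviCivita

/-! ### Hessian, gradient, Ricci identity and second Bianchi identity. -/

section Tensors

variable {E : Type*} [NormedAddCommGroup E] [NormedSpace ℝ E] [FiniteDimensional ℝ E]
variable {G : E → E →L[ℝ] E →L[ℝ] ℝ} {U : Set E}

theorem hasFDerivAt_apply₁ {F F' : Type*} [NormedAddCommGroup F] [NormedSpace ℝ F]
    [NormedAddCommGroup F'] [NormedSpace ℝ F'] {B : E → F →L[ℝ] F'} {y : E}
    (hB : DifferentiableAt ℝ B y) (u : F) :
    HasFDerivAt (fun z => B z u) ((fderiv ℝ B y).flip u) y := by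
  refine (hB.hasFDerivAt.clm_apply (hasFDerivAt_const u y)).congr_fderiv ?_
  ext; simp

theorem hasFDerivAt_apply₂ {F F' F'' : Type*} [NormedAddCommGroup F] [NormedSpace ℝ F]
    [NormedAddCommGroup F'] [NormedSpace ℝ F'] [NormedAddCommGroup F''] [NormedSpace ℝ F'']
    {B : E → F →L[ℝ] F' →L[ℝ] F''} {y : E} (hB : DifferentiableAt ℝ B y) (u : F) (v : F') :
    HasFDerivAt (fun z => B z u v) (((fderiv ℝ B y).flip u).flip v) y := by
  refine ((hasFDerivAt_apply₁ hB u).clm_apply (hasFDerivAt_const v y)).congr_fderiv ?_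
  ext; simp

theorem differentiableAt_of_smooth {F : Type*} [NormedAddCommGroup F] [NormedSpace ℝ F]
    {f : E → F} {y : E} (hU : IsOpen U) (hf : ContDiffOn ℝ ∞ f U) (hy : y ∈ U) :
    DifferentiableAt ℝ f y :=
  (hf.contDiffAt (hU.mem_nhds hy)).differentiableAt (by simp)

/-- The Hessian `∇dσ` of a function. -/
def hessian (G : E → E →L[ℝ] E →L[ℝ] ℝ) (σ : E → ℝ) (y : E) : E →L[ℝ] E →L[ℝ] ℝ :=
  fderiv ℝ (fderiv ℝ σ) y
    - (ContinuousLinearMap.compL ℝ E E ℝ (fderiv ℝ σ y)).comp (leviCivita G y)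

theorem hessian_apply (σ : E → ℝ) (y u v : E) :
    hessian G σ y u v = fderiv ℝ (fderiv ℝ σ) y u v - fderiv ℝ σ y (leviCivita G y u v) := rfl

/-- The covariant derivative of a bilinear form. -/
def covBil (G P : E → E →L[ℝ] E →L[ℝ] ℝ) (y a u v : E) : ℝ :=
  fderiv ℝ P y a u v - P y (leviCivita G y a u) v - P y u (leviCivita G y a v)

/-- The gradient of a function. -/
def gradient (G : E → E →L[ℝ] E →L[ℝ] ℝ) (σ : E → ℝ) (y : E) : E :=
  (G y).inverse (fderiv ℝ σ y)

/-- The Kulkarni–Nomizu product of `g` and `Q`, with the sign of the curvature of a sphere. -/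
def kn (g Q : E →L[ℝ] E →L[ℝ] ℝ) (x y z u : E) : ℝ :=
  g x u * Q y z - g x z * Q y u + g y z * Q x u - g y u * Q x z

theorem IsMetricOn.smooth_gradient (hG : IsMetricOn G U) {σ : E → ℝ} (hσ : ContDiffOn ℝ ∞ σ U) :
    ContDiffOn ℝ ∞ (gradient G σ) U :=
  hG.smooth_inverse.clm_apply (smooth_fderiv hG.isOpen hσ)

theorem IsMetricOn.smooth_hessian (hG : IsMetricOn G U) {σ : E → ℝ} (hσ : ContDiffOn ℝ ∞ σ U) :
    ContDiffOn ℝ ∞ (hessian G σ) U := by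
  have h1 := smooth_fderiv hG.isOpen hσ
  refine (smooth_fderiv hG.isOpen h1).sub (ContDiffOn.clm_comp ?_ hG.smooth_leviCivita)
  exact (ContinuousLinearMap.compL ℝ E E ℝ).contDiff.comp_contDiffOn h1

theorem IsMetricOn.apply_gradient (hG : IsMetricOn G U) (σ : E → ℝ) {y : E} (hy : y ∈ U) (v : E) :
    G y (gradient G σ y) v = fderiv ℝ σ y v := apply_inverse (hG.nondeg y hy) _ v

theorem IsMetricOn.hessian_symm (hG : IsMetricOn G U) {σ : E → ℝ} (hσ : ContDiffOn ℝ ∞ σ U)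
    {y : E} (hy : y ∈ U) (u v : E) : hessian G σ y u v = hessian G σ y v u := by
  rw [hessian_apply, hessian_apply, hG.leviCivita_symm hy u,
    fderiv_fderiv_symm (hσ.contDiffAt (hG.isOpen.mem_nhds hy))]

/-- The Ricci identity for the differential of a function. -/
theorem IsMetricOn.covBil_hessian (hG : IsMetricOn G U) {σ : E → ℝ} (hσ : ContDiffOn ℝ ∞ σ U)
    {y : E} (hy : y ∈ U) (a u v : E) :
    covBil G (hessian G σ) y a u v - covBil G (hessian G σ) y u a v
      = - fderiv ℝ σ y (curvEnd (leviCivita G) y a u v) := by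
  have s1 := smooth_fderiv hG.isOpen hσ
  have s2 := smooth_fderiv hG.isOpen s1
  have d1 := differentiableAt_of_smooth hG.isOpen s1 hy
  have d2 := differentiableAt_of_smooth hG.isOpen s2 hy
  have dΓ := hG.differentiableAt_leviCivita hy
  have dH := differentiableAt_of_smooth hG.isOpen (hG.smooth_hessian hσ) hy
  have key : ∀ a u : E, fderiv ℝ (hessian G σ) y a u v =
      fderiv ℝ (fderiv ℝ (fderiv ℝ σ)) y a u v
        - (fderiv ℝ (fderiv ℝ σ) y a (leviCivita G y u v)
          + fderiv ℝ σ y (fderiv ℝ (leviCivita G) y a u v)) := by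
    intro a u
    rw [← fderiv_apply₂ dH]
    simp only [hessian_apply]
    have h := (hasFDerivAt_apply₂ d2 u v).sub (d1.hasFDerivAt.clm_apply (hasFDerivAt_apply₂ dΓ u v))
    refine (congrArg (fun l : E →L[ℝ] ℝ => l a) h.fderiv).trans ?_
    simp; ring
  have s3 : fderiv ℝ (fderiv ℝ (fderiv ℝ σ)) y a u v = fderiv ℝ (fderiv ℝ (fderiv ℝ σ)) y u a v := by
    rw [fderiv_fderiv_symm (s1.contDiffAt (hG.isOpen.mem_nhds hy))]
  have s2' : ∀ b c, fderiv ℝ (fderiv ℝ σ) y b c = fderiv ℝ (fderiv ℝ σ) y c b :=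
    fderiv_fderiv_symm (hσ.contDiffAt (hG.isOpen.mem_nhds hy))
  rw [covBil, covBil, key, key, s3, hG.leviCivita_symm hy u a]
  simp only [hessian_apply, curvEnd, sub_apply, add_apply, ContinuousLinearMap.comp_apply, map_add,
    map_sub]
  rw [s2' a (leviCivita G y u v), s2' u (leviCivita G y a v)]
  ring

theorem IsMetricOn.smooth_curvEnd (hG : IsMetricOn G U) (u v : E) :
    ContDiffOn ℝ ∞ (fun y => curvEnd (leviCivita G) y u v) U := by
  have h := hG.smooth_leviCivita
  have h' := smooth_fderiv hG.isOpen h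
  unfold curvEnd
  refine ContDiffOn.sub (ContDiffOn.add (ContDiffOn.sub ?_ ?_) ?_) ?_
  · exact (h'.clm_apply contDiffOn_const).clm_apply contDiffOn_const
  · exact (h'.clm_apply contDiffOn_const).clm_apply contDiffOn_const
  · exact (h.clm_apply contDiffOn_const).clm_comp (h.clm_apply contDiffOn_const)
  · exact (h.clm_apply contDiffOn_const).clm_comp (h.clm_apply contDiffOn_const)

/-- The covariant derivative of the curvature endomorphisms. -/
def covCurvEnd (Γ : E → E →L[ℝ] E →L[ℝ] E) (y a u v : E) : E →L[ℝ] E :=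
  fderiv ℝ (fun z => curvEnd Γ z u v) y a + (Γ y a).comp (curvEnd Γ y u v)
    - (curvEnd Γ y u v).comp (Γ y a) - curvEnd Γ y (Γ y a u) v - curvEnd Γ y u (Γ y a v)

/-- Lowering an index commutes with `∇`: the derivative of `G` in the product rule supplies the term
`Γ ∘ R` and cancels the correction of the last slot. -/
theorem IsMetricOn.covDerivCurvatureForm_eq (hG : IsMetricOn G U) {y : E} (hy : y ∈ U)
    (a u v w t : E) :
    covDerivCurvatureForm G y a u v w t = G y (covCurvEnd (leviCivita G) y a u v w) t := by
  have h1 : HasFDerivAt (fun z => curvatureForm G z u v w t) _ y :=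
    (((hG.differentiableAt hy).hasFDerivAt.clm_apply
      ((differentiableAt_of_smooth hG.isOpen (hG.smooth_curvEnd u v) hy).hasFDerivAt.clm_apply
        (hasFDerivAt_const w y))).clm_apply (hasFDerivAt_const t y)).congr_of_eventuallyEq (by
      filter_upwards [hG.isOpen.mem_nhds hy] with z hz using hG.curvatureForm_eq hz u v w t)
  rw [covDerivCurvatureForm, h1.fderiv]
  simp only [hG.curvatureForm_eq hy, hG.christoffel_eq hy, covCurvEnd]
  simp [hG.fderiv_eq hy]
  ring

/-- The second Bianchi identity. -/
theorem IsMetricOn.bianchi_second (hG : IsMetricOn G U) {y : E} (hy : y ∈ U) (a u v : E) :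
    covCurvEnd (leviCivita G) y a u v + covCurvEnd (leviCivita G) y u v a
      + covCurvEnd (leviCivita G) y v a u = 0 := by
  set Γ := leviCivita G with hΓ
  have dΓ : DifferentiableAt ℝ Γ y := hG.differentiableAt_leviCivita hy
  have dΓ' : DifferentiableAt ℝ (fderiv ℝ Γ) y :=
    differentiableAt_of_smooth hG.isOpen (smooth_fderiv hG.isOpen hG.smooth_leviCivita) hy
  have key : ∀ a u v, fderiv ℝ (fun z => curvEnd Γ z u v) y a =
      fderiv ℝ (fderiv ℝ Γ) y a u v - fderiv ℝ (fderiv ℝ Γ) y a v u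
      + ((fderiv ℝ Γ y a u).comp (Γ y v) + (Γ y u).comp (fderiv ℝ Γ y a v))
      - ((fderiv ℝ Γ y a v).comp (Γ y u) + (Γ y v).comp (fderiv ℝ Γ y a u)) := by
    intro a u v
    have h := (((hasFDerivAt_apply₂ dΓ' u v).sub (hasFDerivAt_apply₂ dΓ' v u)).add
      ((hasFDerivAt_apply₁ dΓ u).clm_comp (hasFDerivAt_apply₁ dΓ v))).sub
      ((hasFDerivAt_apply₁ dΓ v).clm_comp (hasFDerivAt_apply₁ dΓ u))
    have h' : HasFDerivAt (fun z => curvEnd Γ z u v) _ y := h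
    rw [h'.fderiv]
    ext; simp; abel
  have sym : ∀ b c, fderiv ℝ (fderiv ℝ Γ) y b c = fderiv ℝ (fderiv ℝ Γ) y c b :=
    fderiv_fderiv_symm (hG.smooth_leviCivita.contDiffAt (hG.isOpen.mem_nhds hy))
  -- Torsion-freeness and skewness pair the corrections of the two plane slots across the cyclic
  -- sum, where they cancel.
  have e1 : curvEnd Γ y u (Γ y a v) = - curvEnd Γ y (Γ y v a) u := by
    rw [curvEnd_antisymm, hΓ, hG.leviCivita_symm hy v a]
  have e2 : curvEnd Γ y v (Γ y u a) = - curvEnd Γ y (Γ y a u) v := by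
    rw [curvEnd_antisymm, hΓ, hG.leviCivita_symm hy u a]
  have e3 : curvEnd Γ y a (Γ y v u) = - curvEnd Γ y (Γ y u v) a := by
    rw [curvEnd_antisymm, hΓ, hG.leviCivita_symm hy v u]
  simp only [covCurvEnd, e1, e2, e3]
  rw [key, key, key, sym u a, sym v u, sym v a]
  ext w
  simp [curvEnd]
  abel

end Tensors

/-! ### Conformal change of the metric. -/

section Conformal

variable {E : Type*} [NormedAddCommGroup E] [NormedSpace ℝ E] [FiniteDimensional ℝ E]
variable {G : E → E →L[ℝ] E →L[ℝ] ℝ} {U : Set E}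

/-- The bilinear form describing the change of the curvature under `G ↦ e^{2σ} G`. -/
def confSchouten (G : E → E →L[ℝ] E →L[ℝ] ℝ) (σ : E → ℝ) (y : E) : E →L[ℝ] E →L[ℝ] ℝ :=
  hessian G σ y - (fderiv ℝ σ y).smulRight (fderiv ℝ σ y)
    + (1 / 2 * G y (gradient G σ y) (gradient G σ y)) • G y

theorem confSchouten_apply (σ : E → ℝ) (y u v : E) :
    confSchouten G σ y u v = hessian G σ y u v - fderiv ℝ σ y u * fderiv ℝ σ y v
      + 1 / 2 * G y (gradient G σ y) (gradient G σ y) * G y u v := by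
  simp [confSchouten]

theorem IsMetricOn.conformal (hG : IsMetricOn G U) {σ : E → ℝ} (hσ : ContDiffOn ℝ ∞ σ U) :
    IsMetricOn (fun y => Real.exp (2 * σ y) • G y) U where
  isOpen := hG.isOpen
  smooth := (Real.contDiff_exp.comp_contDiffOn (contDiffOn_const.mul hσ)).smul hG.smooth
  symm y hy u v := by simp [hG.symm y hy u v]
  nondeg y hy u h := hG.nondeg y hy u fun v => by
    have := h v
    simpa [Real.exp_ne_zero] using this

/-- The right-hand side is torsion-free and compatible with `e^{2σ} G`, so uniqueness of the
Levi-Civita connection identifies it. -/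
theorem IsMetricOn.leviCivita_conformal (hG : IsMetricOn G U) {σ : E → ℝ}
    (hσ : ContDiffOn ℝ ∞ σ U) {y : E} (hy : y ∈ U) (u v : E) :
    leviCivita (fun y => Real.exp (2 * σ y) • G y) y u v =
      leviCivita G y u v + fderiv ℝ σ y u • v + fderiv ℝ σ y v • u
        - G y u v • gradient G σ y := by
  refine (hG.conformal hσ).leviCivita_unique hy (B := fun u v => leviCivita G y u v
    + fderiv ℝ σ y u • v + fderiv ℝ σ y v • u - G y u v • gradient G σ y) ?_ ?_ u v
  · intro u v
    rw [hG.leviCivita_symm hy, hG.symm y hy u v]; abel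
  · intro a u v
    have dσ := differentiableAt_of_smooth hG.isOpen hσ hy
    have h := (((dσ.hasFDerivAt.const_mul 2).exp).smul (hG.differentiableAt hy).hasFDerivAt)
    have h' : HasFDerivAt (fun y => Real.exp (2 * σ y) • G y) _ y := h
    rw [h'.fderiv]
    simp [hG.fderiv_eq hy, hG.apply_gradient σ hy, hG.symm y hy u (gradient G σ y)]
    rw [hG.symm y hy u a]
    ring

theorem IsMetricOn.apply_fderiv_gradient (hG : IsMetricOn G U) {σ : E → ℝ}
    (hσ : ContDiffOn ℝ ∞ σ U) {y : E} (hy : y ∈ U) (a t : E) :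
    G y (fderiv ℝ (gradient G σ) y a) t =
      hessian G σ y a t - G y (leviCivita G y a (gradient G σ y)) t := by
  have dN := differentiableAt_of_smooth hG.isOpen (hG.smooth_gradient hσ) hy
  have d1 := differentiableAt_of_smooth hG.isOpen (smooth_fderiv hG.isOpen hσ) hy
  have h1 : HasFDerivAt (fun z => fderiv ℝ σ z t) _ y :=
    (((hG.differentiableAt hy).hasFDerivAt.clm_apply dN.hasFDerivAt).clm_apply
      (hasFDerivAt_const t y)).congr_of_eventuallyEq (by
      filter_upwards [hG.isOpen.mem_nhds hy] with z hz using (hG.apply_gradient σ hz t).symm)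
  have h := congrArg (fun l : E →L[ℝ] ℝ => l a) (h1.unique (hasFDerivAt_apply₁ d1 t))
  simp [hG.fderiv_eq hy, hG.apply_gradient σ hy] at h
  rw [hessian_apply]
  linarith

/-- The derivative of the squared length of the gradient. -/
theorem IsMetricOn.fderiv_gradient_sq (hG : IsMetricOn G U) {σ : E → ℝ}
    (hσ : ContDiffOn ℝ ∞ σ U) {y : E} (hy : y ∈ U) (a : E) :
    fderiv ℝ (fun z => G z (gradient G σ z) (gradient G σ z)) y a =
      2 * hessian G σ y a (gradient G σ y) := by
  have dN := differentiableAt_of_smooth hG.isOpen (hG.smooth_gradient hσ) hy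
  have h := ((hG.differentiableAt hy).hasFDerivAt.clm_apply dN.hasFDerivAt).clm_apply
    dN.hasFDerivAt
  rw [h.fderiv]
  simp [hG.fderiv_eq hy]
  rw [hG.symm y hy (gradient G σ y) (fderiv ℝ (gradient G σ) y a),
    hG.apply_fderiv_gradient hσ hy, hG.symm y hy (gradient G σ y)]
  ring

theorem IsMetricOn.fderiv_leviCivita_conformal (hG : IsMetricOn G U) {σ : E → ℝ}
    (hσ : ContDiffOn ℝ ∞ σ U) {y : E} (hy : y ∈ U) (a u v : E) :
    fderiv ℝ (leviCivita (fun y => Real.exp (2 * σ y) • G y)) y a u v =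
      fderiv ℝ (leviCivita G) y a u v + fderiv ℝ (fderiv ℝ σ) y a u • v
        + fderiv ℝ (fderiv ℝ σ) y a v • u - fderiv ℝ G y a u v • gradient G σ y
        - G y u v • fderiv ℝ (gradient G σ) y a := by
  have dN := differentiableAt_of_smooth hG.isOpen (hG.smooth_gradient hσ) hy
  have d1 := differentiableAt_of_smooth hG.isOpen (smooth_fderiv hG.isOpen hσ) hy
  rw [← fderiv_apply₂ ((hG.conformal hσ).differentiableAt_leviCivita hy)]
  have h : HasFDerivAt
      (fun z => leviCivita (fun y => Real.exp (2 * σ y) • G y) z u v) _ y :=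
    ((((hasFDerivAt_apply₂ (hG.differentiableAt_leviCivita hy) u v).add
      ((hasFDerivAt_apply₁ d1 u).smul (hasFDerivAt_const v y))).add
      ((hasFDerivAt_apply₁ d1 v).smul (hasFDerivAt_const u y))).sub
      ((hasFDerivAt_apply₂ (hG.differentiableAt hy) u v).smul
        dN.hasFDerivAt)).congr_of_eventuallyEq (by
      filter_upwards [hG.isOpen.mem_nhds hy] with z hz using hG.leviCivita_conformal hσ hz u v)
  rw [h.fderiv]
  simp
  abel

/-- The curvature of a conformally changed metric. -/
theorem IsMetricOn.curvatureForm_conformal (hG : IsMetricOn G U) {σ : E → ℝ}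
    (hσ : ContDiffOn ℝ ∞ σ U) {y : E} (hy : y ∈ U) (u v w t : E) :
    curvatureForm (fun y => Real.exp (2 * σ y) • G y) y u v w t =
      Real.exp (2 * σ y) *
        (curvatureForm G y u v w t - kn (G y) (confSchouten G σ y) u v w t) := by
  rw [(hG.conformal hσ).curvatureForm_eq hy, hG.curvatureForm_eq hy, smul_apply, smul_apply,
    smul_eq_mul]
  congr 1
  have hH : ∀ a b, fderiv ℝ (fderiv ℝ σ) y a b =
      hessian G σ y a b + fderiv ℝ σ y (leviCivita G y a b) := fun a b => by
    rw [hessian_apply]; ring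
  have hNr : ∀ a, G y a (gradient G σ y) = fderiv ℝ σ y a := fun a => by
    rw [hG.symm y hy, hG.apply_gradient σ hy]
  obtain ⟨s, hN⟩ : ∃ s, fderiv ℝ σ y (gradient G σ y) = s := ⟨_, rfl⟩
  simp only [curvEnd, kn, sub_apply, add_apply, ContinuousLinearMap.comp_apply,
    hG.fderiv_leviCivita_conformal hσ hy, hG.leviCivita_conformal hσ hy, map_add, map_sub,
    map_smul, smul_apply, smul_eq_mul, hG.apply_fderiv_gradient hσ hy, hH, hG.fderiv_eq hy,
    confSchouten_apply, hG.apply_gradient σ hy, hN, hNr]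
  rw [hG.symm y hy v u, hG.leviCivita_symm hy v u, hG.hessian_symm hσ hy v u]
  ring

end Conformal

/-! ### Naturality of connection and curvature under local diffeomorphisms. -/

section Naturality

variable {E : Type*} [NormedAddCommGroup E] [NormedSpace ℝ E] [FiniteDimensional ℝ E]
variable {G : E → E →L[ℝ] E →L[ℝ] ℝ} {U V : Set E} {ψ : E → E}

/-- `ψ` maps the open set `V` into `U`, smoothly and with injective differentials. -/
structure IsLocalDiffeoOn (ψ : E → E) (V U : Set E) : Prop where
  isOpen : IsOpen V
  smooth : ContDiffOn ℝ ∞ ψ V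
  mapsTo : MapsTo ψ V U
  injective : ∀ y ∈ V, Function.Injective (fderiv ℝ ψ y)

/-- The pullback of a field of bilinear forms. -/
def pullback (G : E → E →L[ℝ] E →L[ℝ] ℝ) (ψ : E → E) (y : E) : E →L[ℝ] E →L[ℝ] ℝ :=
  (G (ψ y)).bilinearComp (fderiv ℝ ψ y) (fderiv ℝ ψ y)

theorem pullback_apply (y u v : E) :
    pullback G ψ y u v = G (ψ y) (fderiv ℝ ψ y u) (fderiv ℝ ψ y v) := rfl

theorem IsLocalDiffeoOn.surjective (hψ : IsLocalDiffeoOn ψ V U) {y : E} (hy : y ∈ V) :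
    Function.Surjective (fderiv ℝ ψ y) :=
  (LinearMap.injective_iff_surjective (f := (fderiv ℝ ψ y : E →ₗ[ℝ] E))).1 (hψ.injective y hy)

theorem IsMetricOn.pullback (hG : IsMetricOn G U) (hψ : IsLocalDiffeoOn ψ V U) :
    IsMetricOn (pullback G ψ) V where
  isOpen := hψ.isOpen
  smooth := by
    rw [contDiffOn_clm_apply]
    intro u
    rw [contDiffOn_clm_apply]
    intro v
    have h1 := smooth_fderiv hψ.isOpen hψ.smooth
    exact ((hG.smooth.comp hψ.smooth hψ.mapsTo).clm_apply (h1.clm_apply contDiffOn_const)).clm_apply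
      (h1.clm_apply contDiffOn_const)
  symm y hy u v := hG.symm _ (hψ.mapsTo hy) _ _
  nondeg y hy u h := by
    apply hψ.injective y hy
    rw [map_zero]
    refine hG.nondeg _ (hψ.mapsTo hy) _ fun v => ?_
    obtain ⟨v, rfl⟩ := hψ.surjective hy v
    exact h v

theorem IsMetricOn.fderiv_leviCivita_pullback_aux (hG : IsMetricOn G U)
    (hψ : IsLocalDiffeoOn ψ V U) {y : E} (hy : y ∈ V) :
    DifferentiableAt ℝ G (ψ y) ∧ DifferentiableAt ℝ (leviCivita G) (ψ y) ∧
      DifferentiableAt ℝ ψ y ∧ DifferentiableAt ℝ (fderiv ℝ ψ) y ∧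
      DifferentiableAt ℝ (fderiv ℝ (fderiv ℝ ψ)) y :=
  ⟨hG.differentiableAt (hψ.mapsTo hy), hG.differentiableAt_leviCivita (hψ.mapsTo hy),
    differentiableAt_of_smooth hψ.isOpen hψ.smooth hy,
    differentiableAt_of_smooth hψ.isOpen (smooth_fderiv hψ.isOpen hψ.smooth) hy,
    differentiableAt_of_smooth hψ.isOpen
      (smooth_fderiv hψ.isOpen (smooth_fderiv hψ.isOpen hψ.smooth)) hy⟩

/-- Applying the inverse `e` of the differential to the right side produces a torsion-free
connection compatible with the pullback metric, and uniqueness applies. The second derivative of `ψ`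
is the inhomogeneous term of the transformation law. -/
theorem IsMetricOn.leviCivita_pullback (hG : IsMetricOn G U) (hψ : IsLocalDiffeoOn ψ V U) {y : E}
    (hy : y ∈ V) (u v : E) :
    fderiv ℝ ψ y (leviCivita (PseudoRiem.pullback G ψ) y u v) =
      leviCivita G (ψ y) (fderiv ℝ ψ y u) (fderiv ℝ ψ y v) + fderiv ℝ (fderiv ℝ ψ) y u v := by
  obtain ⟨dG, -, d0, d1, -⟩ := hG.fderiv_leviCivita_pullback_aux hψ hy
  have hU := hψ.mapsTo hy
  let e : E ≃ₗ[ℝ] E := LinearEquiv.ofBijective (fderiv ℝ ψ y : E →ₗ[ℝ] E)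
    ⟨hψ.injective y hy, hψ.surjective hy⟩
  have he : ∀ x, fderiv ℝ ψ y (e.symm x) = x := fun x => e.apply_symm_apply x
  have hs : ∀ u v, fderiv ℝ (fderiv ℝ ψ) y u v = fderiv ℝ (fderiv ℝ ψ) y v u :=
    fderiv_fderiv_symm (hψ.smooth.contDiffAt (hψ.isOpen.mem_nhds hy))
  rw [(hG.pullback hψ).leviCivita_unique hy (B := fun u v => e.symm (leviCivita G (ψ y)
    (fderiv ℝ ψ y u) (fderiv ℝ ψ y v) + fderiv ℝ (fderiv ℝ ψ) y u v)) ?_ ?_ u v, he]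
  · intro u v
    rw [hs u v, hG.leviCivita_symm hU]
  · intro a u v
    have h : HasFDerivAt (fun z => PseudoRiem.pullback G ψ z u v) _ y :=
      ((dG.hasFDerivAt.comp y d0.hasFDerivAt).clm_apply (hasFDerivAt_apply₁ d1 u)).clm_apply
        (hasFDerivAt_apply₁ d1 v)
    rw [← fderiv_apply₂ ((hG.pullback hψ).differentiableAt hy), h.fderiv]
    simp [pullback_apply, he, hG.fderiv_eq hU]
    ring

theorem IsMetricOn.fderiv_leviCivita_pullback (hG : IsMetricOn G U) (hψ : IsLocalDiffeoOn ψ V U)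
    {y : E} (hy : y ∈ V) (a u v : E) :
    fderiv ℝ ψ y (fderiv ℝ (leviCivita (PseudoRiem.pullback G ψ)) y a u v) =
      fderiv ℝ (leviCivita G) (ψ y) (fderiv ℝ ψ y a) (fderiv ℝ ψ y u) (fderiv ℝ ψ y v)
      + leviCivita G (ψ y) (fderiv ℝ (fderiv ℝ ψ) y a u) (fderiv ℝ ψ y v)
      + leviCivita G (ψ y) (fderiv ℝ ψ y u) (fderiv ℝ (fderiv ℝ ψ) y a v)
      + fderiv ℝ (fderiv ℝ (fderiv ℝ ψ)) y a u v
      - fderiv ℝ (fderiv ℝ ψ) y a (leviCivita (PseudoRiem.pullback G ψ) y u v) := by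
  obtain ⟨-, dΓ, d0, d1, d2⟩ := hG.fderiv_leviCivita_pullback_aux hψ hy
  have dΓ' := (hG.pullback hψ).differentiableAt_leviCivita hy
  have h1 : HasFDerivAt (fun z => fderiv ℝ ψ z (leviCivita (PseudoRiem.pullback G ψ) z u v)) _ y :=
    d1.hasFDerivAt.clm_apply (hasFDerivAt_apply₂ dΓ' u v)
  have h2 := (((dΓ.hasFDerivAt.comp y d0.hasFDerivAt).clm_apply
    (hasFDerivAt_apply₁ d1 u)).clm_apply (hasFDerivAt_apply₁ d1 v)).add (hasFDerivAt_apply₂ d2 u v)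
  have h := congrArg (fun l : E →L[ℝ] E => l a) (h1.unique (h2.congr_of_eventuallyEq (by
    filter_upwards [hψ.isOpen.mem_nhds hy] with z hz using hG.leviCivita_pullback hψ hz u v)))
  simp at h
  rw [eq_sub_iff_add_eq, h]
  abel

/-- Skew-symmetrization in `u, v` removes the third derivatives of `ψ`, and the second derivatives
cancel against the inhomogeneous terms of the connection. -/
theorem IsMetricOn.curvEnd_pullback (hG : IsMetricOn G U) (hψ : IsLocalDiffeoOn ψ V U)
    {y : E} (hy : y ∈ V) (u v w : E) :
    fderiv ℝ ψ y (curvEnd (leviCivita (PseudoRiem.pullback G ψ)) y u v w) =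
      curvEnd (leviCivita G) (ψ y) (fderiv ℝ ψ y u) (fderiv ℝ ψ y v) (fderiv ℝ ψ y w) := by
  have hs : ∀ u v, fderiv ℝ (fderiv ℝ ψ) y u v = fderiv ℝ (fderiv ℝ ψ) y v u :=
    fderiv_fderiv_symm (hψ.smooth.contDiffAt (hψ.isOpen.mem_nhds hy))
  have hs' : fderiv ℝ (fderiv ℝ (fderiv ℝ ψ)) y u v = fderiv ℝ (fderiv ℝ (fderiv ℝ ψ)) y v u :=
    fderiv_fderiv_symm ((smooth_fderiv hψ.isOpen hψ.smooth).contDiffAt (hψ.isOpen.mem_nhds hy)) u v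
  simp only [curvEnd, sub_apply, add_apply, ContinuousLinearMap.comp_apply, map_add, map_sub,
    hG.fderiv_leviCivita_pullback hψ hy, hG.leviCivita_pullback hψ hy]
  rw [hs', hs v u]
  abel

theorem IsMetricOn.curvatureForm_pullback (hG : IsMetricOn G U) (hψ : IsLocalDiffeoOn ψ V U)
    {y : E} (hy : y ∈ V) (u v w t : E) :
    curvatureForm (PseudoRiem.pullback G ψ) y u v w t =
      curvatureForm G (ψ y) (fderiv ℝ ψ y u) (fderiv ℝ ψ y v) (fderiv ℝ ψ y w)
        (fderiv ℝ ψ y t) := by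
  rw [(hG.pullback hψ).curvatureForm_eq hy, hG.curvatureForm_eq (hψ.mapsTo hy), pullback_apply,
    hG.curvEnd_pullback hψ hy]

/-- The curvature as a field of trilinear maps. -/
def curvMap (Γ : E → E →L[ℝ] E →L[ℝ] E) (y : E) : E →L[ℝ] E →L[ℝ] E →L[ℝ] E :=
  (LinearMap.mk₂ ℝ (curvEnd Γ y) (curvEnd_add_left Γ y) (fun c u v => curvEnd_smul_left Γ y u v c)
    (curvEnd_add_right Γ y) (fun c u v => curvEnd_smul_right Γ y u v c)).toContinuousBilinearMap

theorem curvMap_apply (Γ : E → E →L[ℝ] E →L[ℝ] E) (y u v : E) :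
    curvMap Γ y u v = curvEnd Γ y u v := rfl

theorem IsMetricOn.smooth_curvMap (hG : IsMetricOn G U) :
    ContDiffOn ℝ ∞ (curvMap (leviCivita G)) U := by
  rw [contDiffOn_clm_apply]
  intro u
  rw [contDiffOn_clm_apply]
  exact fun v => hG.smooth_curvEnd u v

/-- The pullback law of the curvature is differentiated; the second derivatives of `ψ` that arise
are the inhomogeneous terms of the four connection corrections. -/
theorem IsMetricOn.covCurvEnd_pullback (hG : IsMetricOn G U) (hψ : IsLocalDiffeoOn ψ V U)
    {y : E} (hy : y ∈ V) (a u v w : E) :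
    fderiv ℝ ψ y (covCurvEnd (leviCivita (PseudoRiem.pullback G ψ)) y a u v w) =
      covCurvEnd (leviCivita G) (ψ y) (fderiv ℝ ψ y a) (fderiv ℝ ψ y u) (fderiv ℝ ψ y v)
        (fderiv ℝ ψ y w) := by
  obtain ⟨-, -, d0, d1, -⟩ := hG.fderiv_leviCivita_pullback_aux hψ hy
  have hU := hψ.mapsTo hy
  have hG' := hG.pullback hψ
  have dR := differentiableAt_of_smooth hG.isOpen hG.smooth_curvMap hU
  have dR' := differentiableAt_of_smooth hψ.isOpen hG'.smooth_curvMap hy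
  have h1 : HasFDerivAt (fun z => fderiv ℝ ψ z
      (curvMap (leviCivita (PseudoRiem.pullback G ψ)) z u v w)) _ y :=
    d1.hasFDerivAt.clm_apply ((hasFDerivAt_apply₂ dR' u v).clm_apply (hasFDerivAt_const w y))
  have h2 := (((dR.hasFDerivAt.comp y d0.hasFDerivAt).clm_apply
    (hasFDerivAt_apply₁ d1 u)).clm_apply (hasFDerivAt_apply₁ d1 v)).clm_apply
    (hasFDerivAt_apply₁ d1 w)
  have h := congrArg (fun l : E →L[ℝ] E => l a) (h1.unique (h2.congr_of_eventuallyEq (by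
    filter_upwards [hψ.isOpen.mem_nhds hy] with z hz
    exact hG.curvEnd_pullback hψ hz u v w)))
  simp [curvMap_apply] at h
  have e1 : ∀ a u v, fderiv ℝ (fun z => curvEnd (leviCivita G) z u v) (ψ y) a =
      fderiv ℝ (curvMap (leviCivita G)) (ψ y) a u v := fun a u v => by
    rw [← fderiv_apply₂ dR]; rfl
  have e2 : fderiv ℝ (fun z => curvEnd (leviCivita (PseudoRiem.pullback G ψ)) z u v) y a =
      fderiv ℝ (curvMap (leviCivita (PseudoRiem.pullback G ψ))) y a u v := by
    rw [← fderiv_apply₂ dR']; rfl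
  simp only [covCurvEnd, sub_apply, add_apply, ContinuousLinearMap.comp_apply, map_add, map_sub,
    hG.leviCivita_pullback hψ hy, hG.curvEnd_pullback hψ hy, e1, e2, curvEnd_add_left,
    curvEnd_add_right]
  rw [eq_sub_of_add_eq h]
  abel

theorem IsMetricOn.covDerivCurvatureForm_pullback (hG : IsMetricOn G U)
    (hψ : IsLocalDiffeoOn ψ V U) {y : E} (hy : y ∈ V) (a u v w t : E) :
    covDerivCurvatureForm (PseudoRiem.pullback G ψ) y a u v w t =
      covDerivCurvatureForm G (ψ y) (fderiv ℝ ψ y a) (fderiv ℝ ψ y u) (fderiv ℝ ψ y v)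
        (fderiv ℝ ψ y w) (fderiv ℝ ψ y t) := by
  rw [(hG.pullback hψ).covDerivCurvatureForm_eq hy, hG.covDerivCurvatureForm_eq (hψ.mapsTo hy),
    pullback_apply, hG.covCurvEnd_pullback hψ hy]

end Naturality

/-! ### Connection and curvature depend only on the germ of the metric. -/

section Congr

variable {E : Type*} [NormedAddCommGroup E] [NormedSpace ℝ E]
variable {G G' : E → E →L[ℝ] E →L[ℝ] ℝ} {y : E}

theorem christoffel_congr (h : G =ᶠ[𝓝 y] G') (u v : E) :
    christoffel G y u v = christoffel G' y u v := by
  have h' : (fun z => G z u v) =ᶠ[𝓝 y] fun z => G' z u v := by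
    filter_upwards [h] with z hz; rw [hz]
  simp only [christoffel, h.fderiv_eq, h'.fderiv_eq, h.eq_of_nhds]

theorem curvatureForm_congr (h : G =ᶠ[𝓝 y] G') (u v w t : E) :
    curvatureForm G y u v w t = curvatureForm G' y u v w t := by
  have h' : ∀ u v, (fun z => christoffel G z u v) =ᶠ[𝓝 y] fun z => christoffel G' z u v := by
    intro u v
    filter_upwards [h.eventuallyEq_nhds] with z hz using christoffel_congr hz u v
  simp only [curvatureForm, curvatureOp, (h' _ _).fderiv_eq, h.eq_of_nhds, christoffel_congr h]

theorem covDerivCurvatureForm_congr (h : G =ᶠ[𝓝 y] G') (a u v w t : E) :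
    covDerivCurvatureForm G y a u v w t = covDerivCurvatureForm G' y a u v w t := by
  have h' : (fun z => curvatureForm G z u v w t) =ᶠ[𝓝 y] fun z => curvatureForm G' z u v w t := by
    filter_upwards [h.eventuallyEq_nhds] with z hz using curvatureForm_congr hz u v w t
  simp only [covDerivCurvatureForm, h'.fderiv_eq, curvatureForm_congr h, christoffel_congr h]

end Congr

/-! ### A Frobenius theorem for linear total differential systems. -/

section FlatSystem

variable {E F : Type*} [NormedAddCommGroup E] [NormedSpace ℝ E] [FiniteDimensional ℝ E]
  [NormedAddCommGroup F] [NormedSpace ℝ F] [CompleteSpace F]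

/-- Grönwall with `K = 1` gives `ε (e^t - 1)`, and `e ≤ 3` yields the constant 2. -/
theorem norm_le_of_deriv_le_norm_add {f f' : ℝ → F} {ε : ℝ}
    (hf : ∀ t ∈ Icc (0 : ℝ) 1, HasDerivWithinAt f (f' t) (Icc 0 1) t) (h0 : f 0 = 0)
    (hb : ∀ t ∈ Icc (0 : ℝ) 1, ‖f' t‖ ≤ ‖f t‖ + ε) {t : ℝ} (ht : t ∈ Icc (0 : ℝ) 1) :
    ‖f t‖ ≤ 2 * ε := by
  have hε : 0 ≤ ε := by
    have := hb 0 (by simp)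
    rw [h0, norm_zero, zero_add] at this
    exact (norm_nonneg _).trans this
  have h := norm_le_gronwallBound_of_norm_deriv_right_le (δ := 0) (K := 1) (ε := ε)
    (fun t ht => (hf t ht).continuousWithinAt)
    (fun t ht => ((hf t ⟨ht.1, ht.2.le⟩).mono_of_mem_nhdsWithin (Icc_mem_nhdsGE_of_mem ht)))
    (by simp [h0]) (fun t ht => by simpa using hb t ⟨ht.1, ht.2.le⟩) t ht
  refine h.trans ?_
  rw [gronwallBound_of_K_ne_0 one_ne_zero]
  have h1 : Real.exp t ≤ 3 :=
    (Real.exp_le_exp.2 ht.2).trans (Real.exp_one_lt_d9.le.trans (by norm_num))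
  simp only [sub_zero, one_mul, zero_mul, zero_add, div_one]
  nlinarith

/-- Mean value inequalities on a compact ball, where `B` and its first two derivatives are bounded;
one constant serves all four estimates. -/
theorem exists_uniform_taylor_bound {H : Type*} [NormedAddCommGroup H] [NormedSpace ℝ H]
    {B : E → H} {U : Set E} (hU : IsOpen U)
    (hB : ContDiffOn ℝ ∞ B U) {y₀ : E} (hy₀ : y₀ ∈ U) :
    ∃ r > 0, ∃ C > 0, Metric.closedBall y₀ r ⊆ U ∧
      ∀ u ∈ Metric.closedBall y₀ r, ‖B u‖ ≤ C ∧ ‖fderiv ℝ B u‖ ≤ C ∧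
        ∀ u' ∈ Metric.closedBall y₀ r, ‖B u' - B u‖ ≤ C * ‖u' - u‖ ∧
          ‖B u' - B u - fderiv ℝ B u (u' - u)‖ ≤ C * ‖u' - u‖ * ‖u' - u‖ := by
  obtain ⟨r, hr, hrU⟩ := Metric.nhds_basis_closedBall.mem_iff.1 (hU.mem_nhds hy₀)
  have := FiniteDimensional.proper ℝ E
  have hK := isCompact_closedBall y₀ r
  have hB1 := smooth_fderiv hU hB
  have hB2 := smooth_fderiv hU hB1
  obtain ⟨C0, h0⟩ := hK.exists_bound_of_continuousOn (hB.continuousOn.mono hrU)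
  obtain ⟨C1, h1⟩ := hK.exists_bound_of_continuousOn (hB1.continuousOn.mono hrU)
  obtain ⟨C2, h2⟩ := hK.exists_bound_of_continuousOn (hB2.continuousOn.mono hrU)
  have hconv := convex_closedBall y₀ r
  refine ⟨r, hr, max 1 (max C0 (max C1 C2)), by positivity, hrU, fun u hu => ⟨(h0 u hu).trans
    (by simp), (h1 u hu).trans (by simp), fun u' hu' => ⟨?_, ?_⟩⟩⟩
  · refine (hconv.norm_image_sub_le_of_norm_fderiv_le
      (fun x hx => differentiableAt_of_smooth hU hB (hrU hx)) h1 hu hu').trans ?_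
    gcongr; simp
  -- On the segment the distance from `u` is at most `‖u' - u‖`, which supplies the second factor of
  -- the remainder.
  · have hs : segment ℝ u u' ⊆ Metric.closedBall y₀ r := hconv.segment_subset hu hu'
    refine ((convex_segment u u').norm_image_sub_le_of_norm_fderiv_le'
      (fun x hx => differentiableAt_of_smooth hU hB (hrU (hs hx)))
      (fun x hx => ?_) (left_mem_segment ℝ u u') (right_mem_segment ℝ u u'))
    refine (hconv.norm_image_sub_le_of_norm_fderiv_le
      (fun x hx => differentiableAt_of_smooth hU hB1 (hrU hx)) h2 hu (hs hx)).trans ?_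
    refine mul_le_mul (by simp) ?_ (norm_nonneg _) (by positivity)
    rw [segment_eq_image'] at hx
    obtain ⟨θ, hθ, rfl⟩ := hx
    simp only [add_sub_cancel_left, norm_smul]
    rw [Real.norm_of_nonneg hθ.1]
    exact mul_le_of_le_one_left (norm_nonneg _) hθ.2

/-- Picard–Lindelöf on all of `[0, 1]`: by `hx` a solution has speed at most one while it stays in
the unit ball about `s₀`, so it cannot leave this ball in unit time. -/
theorem exists_ray_solution {B : E → F →L[ℝ] E →L[ℝ] F} {y₀ x : E} {C : ℝ}
    (hB : ContinuousOn (fun t : ℝ => B (y₀ + t • x)) (Icc 0 1))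
    (hC : ∀ t ∈ Icc (0 : ℝ) 1, ‖B (y₀ + t • x)‖ ≤ C) (s₀ : F)
    (hx : C * ‖x‖ * (‖s₀‖ + 1) ≤ 1) :
    ∃ s : ℝ → F, s 0 = s₀ ∧ ∀ t ∈ Icc (0 : ℝ) 1,
      HasDerivWithinAt s (B (y₀ + t • x) (s t) x) (Icc 0 1) t := by
  have hC0 : 0 ≤ C := (norm_nonneg _).trans (hC 0 (by simp))
  have hb : ∀ t ∈ Icc (0 : ℝ) 1, ∀ v, ‖B (y₀ + t • x) v x‖ ≤ C * ‖x‖ * ‖v‖ := by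
    intro t ht v
    refine ((B _).le_opNorm₂ v x).trans ?_
    have := hC t ht
    calc _ ≤ C * ‖v‖ * ‖x‖ := by gcongr
      _ = _ := by ring
  have hp : IsPicardLindelof (fun t v => B (y₀ + t • x) v x) (tmin := 0) (tmax := 1)
      ⟨0, by simp⟩ s₀ 1 0 1 ⟨C * ‖x‖, by positivity⟩ := by
    refine ⟨fun t ht => ?_, fun v _ => ?_, fun t ht v hv => ?_, by simp⟩
    · apply LipschitzWith.lipschitzOnWith
      apply LipschitzWith.of_dist_le_mul
      intro v w
      rw [dist_eq_norm, dist_eq_norm, ← sub_apply, ← map_sub]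
      exact hb t ht _
    · exact (hB.clm_apply continuousOn_const).clm_apply continuousOn_const
    · refine (hb t ht v).trans (le_trans ?_ hx)
      gcongr
      have : ‖v - s₀‖ ≤ 1 := by simpa [dist_eq_norm] using hv
      calc ‖v‖ = ‖s₀ + (v - s₀)‖ := by simp
        _ ≤ _ := (norm_add_le _ _).trans (by gcongr)
  obtain ⟨s, h0, hs⟩ := hp.exists_eq_forall_mem_Icc_hasDerivWithinAt₀
  exact ⟨s, h0, hs⟩

/-- The radial solutions of a flat linear system depend differentiably on the end point. -/
theorem norm_ray_solution_sub_le {B : E → F →L[ℝ] E →L[ℝ] F} {y₀ x h : E} {r C M : ℝ}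
    (hM : 0 ≤ M) (hC : 0 < C) (hCr : C * r ≤ 1)
    (hbd : ∀ u ∈ Metric.closedBall y₀ r, ‖B u‖ ≤ C ∧ ‖fderiv ℝ B u‖ ≤ C ∧
        ∀ u' ∈ Metric.closedBall y₀ r, ‖B u' - B u‖ ≤ C * ‖u' - u‖ ∧
          ‖B u' - B u - fderiv ℝ B u (u' - u)‖ ≤ C * ‖u' - u‖ * ‖u' - u‖)
    (hd : ∀ u ∈ Metric.closedBall y₀ r, DifferentiableAt ℝ B u)
    (hflat : ∀ u ∈ Metric.closedBall y₀ r, ∀ s a b,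
      fderiv ℝ B u a s b + B u (B u s a) b = fderiv ℝ B u b s a + B u (B u s b) a)
    (hx : ‖x‖ ≤ r) (hxh : ‖x + h‖ ≤ r) {s s' : ℝ → F} (h0 : s 0 = s' 0)
    (hs : ∀ t ∈ Icc (0 : ℝ) 1, HasDerivWithinAt s (B (y₀ + t • x) (s t) x) (Icc 0 1) t)
    (hs' : ∀ t ∈ Icc (0 : ℝ) 1,
      HasDerivWithinAt s' (B (y₀ + t • (x + h)) (s' t) (x + h)) (Icc 0 1) t)
    (hsM : ∀ t ∈ Icc (0 : ℝ) 1, ‖s t‖ ≤ M) :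
    ‖s' 1 - s 1 - B (y₀ + x) (s 1) h‖ ≤
      2 * (2 * M + C * M + 2 * (M + C * M) + C * (2 * (M + C * M))) * ‖h‖ ^ 2 := by
  have hmem : ∀ z : E, ‖z‖ ≤ r → ∀ t ∈ Icc (0 : ℝ) 1, y₀ + t • z ∈ Metric.closedBall y₀ r := by
    intro z hz t ht
    simp only [Metric.mem_closedBall, dist_eq_norm, add_sub_cancel_left, norm_smul]
    rw [Real.norm_of_nonneg ht.1]
    exact (mul_le_of_le_one_left (norm_nonneg _) ht.2).trans hz
  have hsub : ∀ t : ℝ, y₀ + t • (x + h) - (y₀ + t • x) = t • h := by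
    intro t; rw [smul_add]; abel
  have hth : ∀ t ∈ Icc (0 : ℝ) 1, ‖t • h‖ ≤ ‖h‖ := by
    intro t ht
    rw [norm_smul, Real.norm_of_nonneg ht.1]
    exact mul_le_of_le_one_left (norm_nonneg _) ht.2
  have op2 : ∀ (A : F →L[ℝ] E →L[ℝ] F) (v : F) (z : E) {a b c : ℝ}, ‖A‖ ≤ a → ‖v‖ ≤ b → ‖z‖ ≤ c →
      ‖A v z‖ ≤ a * b * c := by
    intro A v z a b c ha hb hc
    refine (A.le_opNorm₂ v z).trans ?_
    have := (norm_nonneg A).trans ha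
    have := (norm_nonneg v).trans hb
    gcongr
  have hr : 0 ≤ r := (norm_nonneg _).trans hx
  have hBd : ∀ t ∈ Icc (0 : ℝ) 1, ‖B (y₀ + t • (x + h)) - B (y₀ + t • x)‖ ≤ C * ‖h‖ := by
    intro t ht
    have := ((hbd _ (hmem x hx t ht)).2.2 _ (hmem (x + h) hxh t ht)).1
    rw [hsub] at this
    exact this.trans (mul_le_mul_of_nonneg_left (hth t ht) hC.le)
  -- First order: by Grönwall the two solutions differ by `O(‖h‖)`.
  have hc1 : ∀ t ∈ Icc (0 : ℝ) 1, ‖s' t - s t‖ ≤ 2 * (M + C * M) * ‖h‖ := by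
    intro t ht
    have := norm_le_of_deriv_le_norm_add (f := fun t => s' t - s t) (ε := (M + C * M) * ‖h‖)
      (fun t ht => (hs' t ht).sub (hs t ht)) (by simp [h0]) ?_ ht
    · simpa [mul_assoc] using this
    intro t ht
    have hu := hmem x hx t ht
    have hu' := hmem (x + h) hxh t ht
    have e : B (y₀ + t • (x + h)) (s' t) (x + h) - B (y₀ + t • x) (s t) x =
        B (y₀ + t • (x + h)) (s' t - s t) (x + h)
        + ((B (y₀ + t • (x + h)) - B (y₀ + t • x)) (s t) (x + h) + B (y₀ + t • x) (s t) h) := by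
      simp only [map_sub, map_add, sub_apply]; abel
    rw [e]
    have b1 := op2 _ (s' t - s t) (x + h) (hbd _ hu').1 le_rfl hxh
    have b2 := op2 (B (y₀ + t • (x + h)) - B (y₀ + t • x)) (s t) (x + h)
      (hBd t ht) (hsM t ht) hxh
    have b3 := op2 _ (s t) h (hbd _ hu).1 (hsM t ht) le_rfl
    refine (norm_add_le _ _).trans (add_le_add (b1.trans ?_)
      ((norm_add_le _ _).trans ((add_le_add b2 b3).trans ?_)))
    · calc C * ‖s' t - s t‖ * r = (C * r) * ‖s' t - s t‖ := by ring
        _ ≤ 1 * ‖s' t - s t‖ := by gcongr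
        _ = _ := one_mul _
    · have : C * ‖h‖ * M * r ≤ M * ‖h‖ := by
        calc C * ‖h‖ * M * r = (C * r) * (M * ‖h‖) := by ring
          _ ≤ 1 * (M * ‖h‖) := by gcongr
          _ = _ := one_mul _
      linarith
  set c := 2 * (M + C * M) with hc
  have hc0 : 0 ≤ c := by positivity
  -- Second order: the expected variation of `s` is `t B(s t) h`. What remains after subtracting it
  -- vanishes at zero and solves the linear equation along `x` up to `O(‖h‖²)`.
  have key := norm_le_of_deriv_le_norm_add
    (f := fun t => s' t - s t - t • B (y₀ + t • x) (s t) h)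
    (f' := fun t => B (y₀ + t • (x + h)) (s' t) (x + h) - B (y₀ + t • x) (s t) x
      - (t • (fderiv ℝ B (y₀ + t • x) x (s t) h + B (y₀ + t • x) (B (y₀ + t • x) (s t) x) h)
        + (1 : ℝ) • B (y₀ + t • x) (s t) h))
    (ε := (2 * M + C * M + c + C * c) * ‖h‖ ^ 2) (fun t ht => ?_) (by simp [h0]) ?_
    (t := 1) (by simp)
  · simpa [mul_assoc] using key
  · refine ((hs' t ht).sub (hs t ht)).sub ?_
    have hl : HasDerivWithinAt (fun t : ℝ => y₀ + t • x) x (Icc 0 1) t := by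
      simpa using ((hasDerivAt_id t).smul_const x).const_add y₀ |>.hasDerivWithinAt
    have h1 := (hd _ (hmem x hx t ht)).hasFDerivAt.comp_hasDerivWithinAt t hl
    have h2 := (h1.clm_apply (hs t ht)).clm_apply (hasDerivWithinAt_const t _ h)
    have h3 := (hasDerivWithinAt_id t (Icc (0 : ℝ) 1)).smul h2
    convert! h3 using 1
    simp
  · intro t ht
    have hu := hmem x hx t ht
    have hu' := hmem (x + h) hxh t ht
    have e : B (y₀ + t • (x + h)) (s' t) (x + h) - B (y₀ + t • x) (s t) x
      - (t • (fderiv ℝ B (y₀ + t • x) x (s t) h + B (y₀ + t • x) (B (y₀ + t • x) (s t) x) h)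
        + (1 : ℝ) • B (y₀ + t • x) (s t) h) =
        B (y₀ + t • x) (s' t - s t - t • B (y₀ + t • x) (s t) h) x
        + ((B (y₀ + t • (x + h)) - B (y₀ + t • x) - fderiv ℝ B (y₀ + t • x) (t • h)) (s t) (x + h)
        + t • fderiv ℝ B (y₀ + t • x) h (s t) h
        + (B (y₀ + t • (x + h)) - B (y₀ + t • x)) (s' t - s t) (x + h)
        + B (y₀ + t • x) (s' t - s t) h) := by
      -- Integrability exchanges the directions `x` and `h` in the derivative of the variation.
      rw [hflat _ hu]
      simp only [map_sub, map_add, map_smul, sub_apply, smul_apply, smul_add, one_smul]; abel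
    rw [e]
    have b1 := op2 _ (s' t - s t - t • B (y₀ + t • x) (s t) h) x (hbd _ hu).1 le_rfl hx
    have b2 := op2 (B (y₀ + t • (x + h)) - B (y₀ + t • x) - fderiv ℝ B (y₀ + t • x) (t • h))
      (s t) (x + h) (a := C * ‖h‖ * ‖h‖) (by
        have := ((hbd _ hu).2.2 _ hu').2
        rw [hsub] at this
        refine this.trans ?_
        have := hth t ht
        gcongr) (hsM t ht) hxh
    have b3 : ‖t • fderiv ℝ B (y₀ + t • x) h (s t) h‖ ≤ (C * ‖h‖) * M * ‖h‖ := by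
      rw [norm_smul, Real.norm_of_nonneg ht.1]
      refine (mul_le_of_le_one_left (norm_nonneg _) ht.2).trans (op2 _ _ _ ?_ (hsM t ht) le_rfl)
      exact (ContinuousLinearMap.le_opNorm _ _).trans (by gcongr; exact (hbd _ hu).2.1)
    have b4 := op2 (B (y₀ + t • (x + h)) - B (y₀ + t • x)) (s' t - s t) (x + h)
      (hBd t ht) (hc1 t ht) hxh
    have b5 := op2 _ (s' t - s t) h (hbd _ hu).1 (hc1 t ht) le_rfl
    refine (norm_add_le _ _).trans (add_le_add (b1.trans ?_) ?_)
    · calc C * ‖s' t - s t - t • B (y₀ + t • x) (s t) h‖ * r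
          = (C * r) * ‖s' t - s t - t • B (y₀ + t • x) (s t) h‖ := by ring
        _ ≤ 1 * ‖s' t - s t - t • B (y₀ + t • x) (s t) h‖ := by gcongr
        _ = _ := one_mul _
    · refine (norm_add₄_le).trans ((add_le_add (add_le_add (add_le_add b2 b3) b4) b5).trans ?_)
      have i1 : C * ‖h‖ * ‖h‖ * M * r ≤ M * ‖h‖ ^ 2 := by
        calc C * ‖h‖ * ‖h‖ * M * r = (C * r) * (M * ‖h‖ ^ 2) := by ring
          _ ≤ 1 * (M * ‖h‖ ^ 2) := by gcongr
          _ = _ := one_mul _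
      have i2 : C * ‖h‖ * (c * ‖h‖) * r ≤ c * ‖h‖ ^ 2 := by
        calc C * ‖h‖ * (c * ‖h‖) * r = (C * r) * (c * ‖h‖ ^ 2) := by ring
          _ ≤ 1 * (c * ‖h‖ ^ 2) := by gcongr
          _ = _ := one_mul _
      have i3 : 0 ≤ M * ‖h‖ ^ 2 := by positivity
      nlinarith

/-- **Frobenius theorem** for a linear system `Ds = B(y)s` satisfying its integrability condition. -/
theorem exists_solution_of_flat {B : E → F →L[ℝ] E →L[ℝ] F} {U : Set E} (hU : IsOpen U)
    (hB : ContDiffOn ℝ ∞ B U)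
    (hflat : ∀ u ∈ U, ∀ s a b,
      fderiv ℝ B u a s b + B u (B u s a) b = fderiv ℝ B u b s a + B u (B u s b) a)
    {y₀ : E} (hy₀ : y₀ ∈ U) (s₀ : F) :
    ∃ V : Set E, IsOpen V ∧ y₀ ∈ V ∧ V ⊆ U ∧ ∃ s : E → F, ContDiffOn ℝ ∞ s V ∧ s y₀ = s₀ ∧
      ∀ y ∈ V, HasFDerivAt s (B y (s y)) y := by
  obtain ⟨R, hR, C, hC, hRU, hbd⟩ := exists_uniform_taylor_bound hU hB hy₀
  obtain ⟨r, hr, hrR, hrC⟩ : ∃ r > 0, r ≤ R ∧ C * r * (‖s₀‖ + 1) ≤ 1 := by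
    -- The first bound keeps the ball inside the region of the estimates, the second is the
    -- Picard–Lindelöf condition.
    refine ⟨min R (1 / (C * (‖s₀‖ + 1))), by positivity, min_le_left _ _, ?_⟩
    calc C * min R (1 / (C * (‖s₀‖ + 1))) * (‖s₀‖ + 1)
        ≤ C * (1 / (C * (‖s₀‖ + 1))) * (‖s₀‖ + 1) := by gcongr; exact min_le_right _ _
      _ = 1 := by field_simp
  have hCr : C * r ≤ 1 := by
    refine le_trans ?_ hrC
    have : 0 ≤ C * r * ‖s₀‖ := by positivity
    linarith
  have hsub : Metric.closedBall y₀ r ⊆ Metric.closedBall y₀ R :=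
    Metric.closedBall_subset_closedBall hrR
  have hmem : ∀ z : E, ‖z‖ ≤ r → ∀ t ∈ Icc (0 : ℝ) 1, y₀ + t • z ∈ Metric.closedBall y₀ r := by
    intro z hz t ht
    simp only [Metric.mem_closedBall, dist_eq_norm, add_sub_cancel_left, norm_smul]
    rw [Real.norm_of_nonneg ht.1]
    exact (mul_le_of_le_one_left (norm_nonneg _) ht.2).trans hz
  have hray : ∀ x : E, ∃ s : ℝ → F, ‖x‖ ≤ r → s 0 = s₀ ∧ ∀ t ∈ Icc (0 : ℝ) 1,
      HasDerivWithinAt s (B (y₀ + t • x) (s t) x) (Icc 0 1) t := by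
    intro x
    by_cases hx : ‖x‖ ≤ r
    · have hmt : MapsTo (fun t : ℝ => y₀ + t • x) (Icc 0 1) U :=
        fun t ht => hRU (hsub (hmem x hx t ht))
      obtain ⟨s, h1, h2⟩ := exists_ray_solution (B := B) (y₀ := y₀) (x := x) (C := C)
        (hB.continuousOn.comp (by fun_prop) hmt)
        (fun t ht => (hbd _ (hsub (hmem x hx t ht))).1) s₀ (le_trans (by gcongr) hrC)
      exact ⟨s, fun _ => ⟨h1, h2⟩⟩
    · exact ⟨fun _ => 0, fun h => absurd h hx⟩
  choose s hs using hray
  -- Grönwall bounds `s - s₀`, which starts at zero, by `2 ‖s₀‖`; a further `‖s₀‖` is added back.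
  have hsM : ∀ x : E, ‖x‖ ≤ r → ∀ t ∈ Icc (0 : ℝ) 1, ‖s x t‖ ≤ 3 * ‖s₀‖ := by
    intro x hx t ht
    have h := norm_le_of_deriv_le_norm_add (f := fun t => s x t - s₀)
      (f' := fun t => B (y₀ + t • x) (s x t) x) (ε := ‖s₀‖)
      (fun t ht => ((hs x hx).2 t ht).sub_const s₀) (by simp [(hs x hx).1]) (fun t ht => ?_) ht
    · calc ‖s x t‖ = ‖(s x t - s₀) + s₀‖ := by simp
        _ ≤ 2 * ‖s₀‖ + ‖s₀‖ := (norm_add_le _ _).trans (by gcongr)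
        _ = _ := by ring
    · refine ((B _).le_opNorm₂ _ x).trans ?_
      have h1 := (hbd _ (hsub (hmem x hx t ht))).1
      calc ‖B (y₀ + t • x)‖ * ‖s x t‖ * ‖x‖ ≤ C * ‖s x t‖ * r := by gcongr
        _ = (C * r) * ‖s x t‖ := by ring
        _ ≤ 1 * ‖s x t‖ := by gcongr
        _ = ‖(s x t - s₀) + s₀‖ := by simp
        _ ≤ _ := norm_add_le _ _
  have hder : ∀ y ∈ Metric.ball y₀ r,
      HasFDerivAt (fun y => s (y - y₀) 1) (B y (s (y - y₀) 1)) y := by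
    intro y hy
    have hx : ‖y - y₀‖ < r := by simpa [dist_eq_norm] using hy
    rw [hasFDerivAt_iff_isLittleO_nhds_zero]
    refine Asymptotics.IsBigO.trans_isLittleO (g := fun h : E => ‖h‖ ^ 2) ?_ ?_
    · apply Asymptotics.IsBigO.of_bound (2 * (2 * (3 * ‖s₀‖) + C * (3 * ‖s₀‖) + 2 * ((3 * ‖s₀‖)
        + C * (3 * ‖s₀‖)) + C * (2 * ((3 * ‖s₀‖) + C * (3 * ‖s₀‖)))))
      have : ∀ᶠ h : E in 𝓝 0, ‖y - y₀ + h‖ < r := by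
        have hcont : Continuous fun h : E => ‖y - y₀ + h‖ := by fun_prop
        exact hcont.continuousAt.eventually_lt continuousAt_const (by simpa using hx)
      filter_upwards [this] with h hh
      have := norm_ray_solution_sub_le (B := B) (y₀ := y₀) (x := y - y₀) (h := h) (r := r)
        (C := C) (M := 3 * ‖s₀‖) (by positivity) hC hCr
        (fun u hu => ⟨(hbd u (hsub hu)).1, (hbd u (hsub hu)).2.1,
          fun u' hu' => (hbd u (hsub hu)).2.2 u' (hsub hu')⟩)
        (fun u hu => differentiableAt_of_smooth hU hB (hRU (hsub hu)))
        (fun u hu => hflat u (hRU (hsub hu))) hx.le hh.le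
        (by rw [(hs _ hx.le).1, (hs _ hh.le).1]) (hs _ hx.le).2 (hs _ hh.le).2 (hsM _ hx.le)
      simpa [add_sub_right_comm] using this
    · have h1 : (fun h : E => ‖h‖ ^ 2) = fun h => ‖h‖ ^ 1 * ‖h‖ := by ext; ring
      have := Asymptotics.isLittleO_norm_pow_id (E' := E) (n := 2) (by norm_num)
      exact this
  have hrU : Metric.ball y₀ r ⊆ U := (Metric.ball_subset_closedBall.trans hsub).trans hRU
  refine ⟨Metric.ball y₀ r, Metric.isOpen_ball, Metric.mem_ball_self hr, hrU,
    fun y => s (y - y₀) 1, ?_, ?_, hder⟩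
  · have hd : DifferentiableOn ℝ (fun y => s (y - y₀) 1) (Metric.ball y₀ r) :=
      fun y hy => (hder y hy).differentiableAt.differentiableWithinAt
    -- Bootstrapping: the derivative of the solution is `B y (s y)`, so each degree of smoothness
    -- gives the next.
    rw [contDiffOn_infty]
    intro n
    induction n with
    | zero => exact contDiffOn_zero.2 hd.continuousOn
    | succ n ih =>
      have e : ((n + 1 : ℕ) : WithTop ℕ∞) = (n : WithTop ℕ∞) + 1 := by simp
      rw [e, contDiffOn_succ_iff_fderiv_of_isOpen Metric.isOpen_ball]
      refine ⟨hd, by simp, ?_⟩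
      have : ContDiffOn ℝ n (fun y => B y (s (y - y₀) 1)) (Metric.ball y₀ r) :=
        ((hB.mono hrU).of_le (by exact_mod_cast le_top)).clm_apply ih
      exact this.congr fun y hy => (hder y hy).fderiv
  -- At the centre the ray is constant and the equation reads `s' = 0`.
  · have h0 : ‖y₀ - y₀‖ ≤ r := by simpa using hr.le
    have hc := (hs (y₀ - y₀) h0).2
    have := norm_le_of_deriv_le_norm_add (f := fun t => s (y₀ - y₀) t - s₀)
      (f' := fun _ => 0) (ε := 0)
      (fun t ht => by simpa using (hc t ht).sub_const s₀) (sub_eq_zero.2 (hs _ h0).1)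
      (fun t ht => by simp) (t := 1) (by simp)
    simpa [sub_eq_zero] using this

end FlatSystem

/-! ### The Weyl–Schouten theorem through the tractor connection. -/

section WeylSchouten

variable {E : Type*} [NormedAddCommGroup E] [NormedSpace ℝ E] [FiniteDimensional ℝ E]
variable {G P : E → E →L[ℝ] E →L[ℝ] ℝ} {U : Set E}

/-- `P` is a smooth symmetric Codazzi tensor with `R = φ(P)`. -/
structure IsSchoutenOn (G P : E → E →L[ℝ] E →L[ℝ] ℝ) (U : Set E) : Prop where
  smooth : ContDiffOn ℝ ∞ P U
  symm : ∀ y ∈ U, ∀ u v, P y u v = P y v u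
  curvature : ∀ y ∈ U, ∀ u v w t, curvatureForm G y u v w t = kn (G y) (P y) u v w t
  codazzi : ∀ y ∈ U, ∀ a u v, covBil G P y a u v = covBil G P y u a v

/-- The connection on `ℝ ⊕ T* ⊕ ℝ` whose parallel sections are the conformally flat metrics. -/
def tractor (G P : E → E →L[ℝ] E →L[ℝ] ℝ) (y : E) :
    (ℝ × (E →L[ℝ] ℝ) × ℝ) →L[ℝ] E →L[ℝ] (ℝ × (E →L[ℝ] ℝ) × ℝ) :=
  (LinearMap.mk₂ ℝ (fun (s : ℝ × (E →L[ℝ] ℝ) × ℝ) (a : E) =>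
    ((s.2.1 a, s.2.1.comp (leviCivita G y a) - s.1 • P y a + s.2.2 • G y a,
      - P y a ((G y).inverse s.2.1)) : ℝ × (E →L[ℝ] ℝ) × ℝ))
    (fun s s' a => by
      ext
      · simp
      · simp; ring
      · simp; ring)
    (fun c s a => by
      ext
      · simp
      · simp; ring
      · simp)
    (fun s a a' => by
      ext
      · simp
      · simp; ring
      · simp; ring)
    (fun c s a => by
      ext
      · simp
      · simp; ring
      · simp)).toContinuousBilinearMap

theorem tractor_apply (y : E) (s : ℝ × (E →L[ℝ] ℝ) × ℝ) (a : E) :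
    tractor G P y s a =
    (s.2.1 a, s.2.1.comp (leviCivita G y a) - s.1 • P y a + s.2.2 • G y a,
      - P y a ((G y).inverse s.2.1)) := rfl

theorem IsMetricOn.smooth_tractor (hG : IsMetricOn G U) (hP : ContDiffOn ℝ ∞ P U) :
    ContDiffOn ℝ ∞ (tractor G P) U := by
  rw [contDiffOn_clm_apply]
  intro s
  rw [contDiffOn_clm_apply]
  intro a
  simp only [tractor_apply]
  refine contDiffOn_const.prodMk (ContDiffOn.prodMk ?_ ?_)
  · exact ((contDiffOn_const.clm_comp (hG.smooth_leviCivita.clm_apply contDiffOn_const)).sub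
      ((hP.clm_apply contDiffOn_const).const_smul _)).add
      ((hG.smooth.clm_apply contDiffOn_const).const_smul _)
  · exact ((hP.clm_apply contDiffOn_const).clm_apply
      (hG.smooth_inverse.clm_apply contDiffOn_const)).neg

/-- Raising an index commutes with `∇`; obtained by differentiating `G(G⁻¹ l, t) = l t`. -/
theorem IsMetricOn.fderiv_inverse (hG : IsMetricOn G U) {y : E} (hy : y ∈ U) (l : E →L[ℝ] ℝ)
    (a : E) :
    fderiv ℝ (fun z => (G z).inverse l) y a =
      - leviCivita G y a ((G y).inverse l) - (G y).inverse (l.comp (leviCivita G y a)) := by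
  have hs : ContDiffOn ℝ ∞ (fun z => (G z).inverse l) U :=
    hG.smooth_inverse.clm_apply contDiffOn_const
  have d := differentiableAt_of_smooth hG.isOpen hs hy
  refine eq_of_forall_apply (hG.nondeg y hy) fun t => ?_
  have h1 : HasFDerivAt (fun z => l t) _ y :=
    (((hG.differentiableAt hy).hasFDerivAt.clm_apply d.hasFDerivAt).clm_apply
      (hasFDerivAt_const t y)).congr_of_eventuallyEq (by
      filter_upwards [hG.isOpen.mem_nhds hy] with z hz using (apply_inverse (hG.nondeg z hz) _ _).symm)
  have h := congrArg (fun l : E →L[ℝ] ℝ => l a) (h1.unique (hasFDerivAt_const (l t) y))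
  simp [hG.fderiv_eq hy] at h
  simp [apply_inverse (hG.nondeg y hy)] at h ⊢
  linarith

/-- Integrability component by component: the first is the symmetry of `Γ`, `P` and `G`; the second
is `R = φ(P)` together with the Codazzi equation; the third is the Codazzi equation together with
the self-adjointness of `P`. -/
theorem IsMetricOn.tractor_flat (hG : IsMetricOn G U) (hP : IsSchoutenOn G P U) {y : E}
    (hy : y ∈ U) (s : ℝ × (E →L[ℝ] ℝ) × ℝ) (a b : E) :
    fderiv ℝ (tractor G P) y a s b + tractor G P y (tractor G P y s a) b =
      fderiv ℝ (tractor G P) y b s a + tractor G P y (tractor G P y s b) a := by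
  have dT := differentiableAt_of_smooth hG.isOpen (hG.smooth_tractor hP.smooth) hy
  have dΓ := hG.differentiableAt_leviCivita hy
  have dG := hG.differentiableAt hy
  have dP := differentiableAt_of_smooth hG.isOpen hP.smooth hy
  have dN : DifferentiableAt ℝ (fun z => (G z).inverse s.2.1) y :=
    differentiableAt_of_smooth hG.isOpen (hG.smooth_inverse.clm_apply contDiffOn_const) hy
  have nd := hG.nondeg y hy
  have key : ∀ a b, fderiv ℝ (tractor G P) y a s b =
      (0, s.2.1.comp (fderiv ℝ (leviCivita G) y a b) - s.1 • fderiv ℝ P y a b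
        + s.2.2 • fderiv ℝ G y a b,
        - (fderiv ℝ P y a b ((G y).inverse s.2.1)
          + P y b (fderiv ℝ (fun z => (G z).inverse s.2.1) y a))) := by
    intro a b
    rw [← fderiv_apply₂ dT]
    have h : HasFDerivAt (fun z => tractor G P z s b) _ y :=
      (hasFDerivAt_const (s.2.1 b) y).prodMk ((((
      (hasFDerivAt_const s.2.1 y).clm_comp (hasFDerivAt_apply₁ dΓ b)).sub
        ((hasFDerivAt_apply₁ dP b).const_smul s.1)).add
        ((hasFDerivAt_apply₁ dG b).const_smul s.2.2)).prodMk
        (((hasFDerivAt_apply₁ dP b).clm_apply dN.hasFDerivAt).neg))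
    rw [h.fderiv]
    ext
    · simp
    · simp
    · simp; ring
  obtain ⟨u, μ, w⟩ := s
  have cod : ∀ v, fderiv ℝ P y a b v - P y b (leviCivita G y a v) =
      fderiv ℝ P y b a v - P y a (leviCivita G y b v) := by
    intro v
    have h := hP.codazzi y hy a b v
    rw [covBil, covBil, hG.leviCivita_symm hy b a] at h
    linarith
  rw [key, key]
  simp only [tractor_apply, Prod.mk_add_mk, Prod.mk.injEq]
  refine ⟨?_, ?_, ?_⟩
  · simp
    rw [hG.leviCivita_symm hy b a, hP.symm y hy b a, hG.symm y hy b a]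
  · ext v
    have hc := hP.curvature y hy a b v ((G y).inverse μ)
    rw [hG.curvatureForm_eq hy, hG.symm y hy, apply_inverse nd] at hc
    simp only [kn, curvEnd, sub_apply, add_apply, ContinuousLinearMap.comp_apply, map_add,
      map_sub, hG.symm y hy _ ((G y).inverse μ), apply_inverse nd] at hc
    simp [hG.fderiv_eq hy]
    have := cod v
    rw [hG.leviCivita_symm hy b a]
    linear_combination hc - u * this
  · have e : P y b ((G y).inverse (P y a)) = P y a ((G y).inverse (P y b)) := by
      rw [← apply_inverse nd (P y b) ((G y).inverse (P y a)), hG.symm y hy, apply_inverse nd]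
    simp only [hG.fderiv_inverse hy, map_sub, map_add, map_neg, map_smul, smul_eq_mul]
    have e2 : ∀ c, (G y).inverse (G y c) = c := fun c => inverse_apply_eq nd fun _ => rfl
    rw [e2, e2]
    have := cod ((G y).inverse μ)
    rw [hP.symm y hy b a]
    linear_combination - this + u * e

/-- **Weyl–Schouten theorem**: a metric with `R = φ(P)` for a Codazzi tensor `P` is conformally
flat. -/
theorem IsMetricOn.exists_flat_conformal (hG : IsMetricOn G U) (hP : IsSchoutenOn G P U) {y₀ : E}
    (hy₀ : y₀ ∈ U) :
    ∃ V : Set E, IsOpen V ∧ y₀ ∈ V ∧ V ⊆ U ∧ ∃ ρ : E → ℝ, ContDiffOn ℝ ∞ ρ V ∧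
      ∀ y ∈ V, ∀ u v w t, curvatureForm (fun z => Real.exp (2 * ρ z) • G z) y u v w t = 0 := by
  have := FiniteDimensional.complete ℝ (ℝ × (E →L[ℝ] ℝ) × ℝ)
  -- The section is `(f, df, w)` and the flat metric will be `f⁻² G`. The initial value makes `f`
  -- positive near `y₀` and the constant `2 f w - |∇f|²` equal to zero.
  obtain ⟨V, hV, hyV, hVU, s, hs, hs0, hder⟩ := exists_solution_of_flat hG.isOpen
    (hG.smooth_tractor hP.smooth) (fun u hu s a b => hG.tractor_flat hP hu s a b) hy₀
    ((1, 0, 0) : ℝ × (E →L[ℝ] ℝ) × ℝ)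
  obtain ⟨r, hr, hrV⟩ : ∃ r > 0, Metric.ball y₀ r ⊆ {y | y ∈ V ∧ 0 < (s y).1} := by
    apply Metric.mem_nhds_iff.1
    have hc : ContinuousAt (fun y => (s y).1) y₀ :=
      (hs.continuousOn.continuousAt (hV.mem_nhds hyV)).fst
    have h0 : ∀ᶠ y in 𝓝 y₀, 0 < (s y).1 := by
      refine hc.eventually (lt_mem_nhds ?_)
      simp [hs0]
    filter_upwards [hV.mem_nhds hyV, h0] with y h1 h2 using ⟨h1, h2⟩
  -- A ball, because convexity is needed to pass from zero derivative to constancy.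
  set W := Metric.ball y₀ r with hW
  have hWV : W ⊆ V := fun y hy => (hrV hy).1
  have hWo : IsOpen W := Metric.isOpen_ball
  have hGW := hG.mono hWo (hWV.trans hVU)
  have hsW := hs.mono hWV
  set f : E → ℝ := fun y => (s y).1 with hf
  have hfs : ContDiffOn ℝ ∞ f W := hsW.fst
  have hpos : ∀ y ∈ W, 0 < f y := fun y hy => (hrV hy).2
  have hdf : ∀ y ∈ W, fderiv ℝ f y = (s y).2.1 := by
    intro y hy
    rw [(hder y (hWV hy)).fst.fderiv]
    rfl
  have hdf2 : ∀ y ∈ W, ∀ a t, hessian G f y a t = - f y * P y a t + (s y).2.2 * G y a t := by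
    intro y hy a t
    have h : fderiv ℝ (fderiv ℝ f) y = fderiv ℝ (fun z => (s z).2.1) y := by
      apply Filter.EventuallyEq.fderiv_eq
      filter_upwards [hWo.mem_nhds hy] with z hz using hdf z hz
    rw [hessian_apply, h, (hder y (hWV hy)).snd.fst.fderiv, hdf y hy]
    simp [tractor_apply]
    ring
  have hdw : ∀ y ∈ W, ∀ a, fderiv ℝ (fun z => (s z).2.2) y a = - P y a (gradient G f y) := by
    intro y hy a
    rw [(hder y (hWV hy)).snd.snd.fderiv, gradient, hdf y hy]
    simp [tractor_apply]
  -- The invariant quadratic form of the system is constant along parallel sections.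
  have hcons : ∀ y ∈ W, 2 * f y * (s y).2.2 = G y (gradient G f y) (gradient G f y) := by
    have dq : ∀ y ∈ W, HasFDerivAt (fun z => 2 * f z * (s z).2.2
        - G z (gradient G f z) (gradient G f z)) (0 : E →L[ℝ] ℝ) y := by
      intro y hy
      have d1 := differentiableAt_of_smooth hWo hfs hy
      have d2 := differentiableAt_of_smooth hWo (hsW.snd.snd) hy
      have dN := differentiableAt_of_smooth hWo (hGW.smooth_gradient hfs) hy
      have d3 : DifferentiableAt ℝ (fun z => G z (gradient G f z) (gradient G f z)) y :=
        ((hGW.differentiableAt hy).clm_apply dN).clm_apply dN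
      refine (((d1.hasFDerivAt.const_mul 2).mul d2.hasFDerivAt).sub d3.hasFDerivAt).congr_fderiv ?_
      ext a
      have e1 := hGW.fderiv_gradient_sq hfs hy a
      have e2 := hdw y hy a
      have e3 : fderiv ℝ f y a = G y a (gradient G f y) := by
        rw [hGW.symm y hy, hGW.apply_gradient f hy]
      rw [hdf2 y hy] at e1
      simp [e1, e2, e3]
      ring
    intro y hy
    have hcst := Convex.is_const_of_fderivWithin_eq_zero (𝕜 := ℝ) (convex_ball y₀ r)
      (f := fun z => 2 * f z * (s z).2.2 - G z (gradient G f z) (gradient G f z))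
      (fun z hz => (dq z hz).differentiableAt.differentiableWithinAt)
      (fun z hz => by rw [fderivWithin_of_isOpen hWo hz]; exact (dq z hz).fderiv)
      hy (Metric.mem_ball_self hr)
    have h0 : gradient G f y₀ = 0 := by
      rw [gradient, hdf y₀ (Metric.mem_ball_self hr), hs0]; simp
    simp only [h0, hs0] at hcst
    simp at hcst
    linarith
  refine ⟨W, hWo, Metric.mem_ball_self hr, hWV.trans hVU, fun y => - Real.log (f y),
    (hfs.log fun y hy => (hpos y hy).ne').neg, fun y hy u v w t => ?_⟩
  have hρs : ContDiffOn ℝ ∞ (fun y => - Real.log (f y)) W :=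
    (hfs.log fun y hy => (hpos y hy).ne').neg
  have hρ1 : ∀ z ∈ W, fderiv ℝ (fun y => - Real.log (f y)) z = - ((f z)⁻¹ • fderiv ℝ f z) := by
    intro z hz
    exact ((differentiableAt_of_smooth hWo hfs hz).hasFDerivAt.log (hpos z hz).ne').neg.fderiv
  have hρ2 : ∀ a b, fderiv ℝ (fderiv ℝ (fun y => - Real.log (f y))) y a b =
      - (f y)⁻¹ * fderiv ℝ (fderiv ℝ f) y a b
        + (f y)⁻¹ ^ 2 * fderiv ℝ f y a * fderiv ℝ f y b := by
    intro a b
    have d1 := differentiableAt_of_smooth hWo hfs hy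
    have d2 := differentiableAt_of_smooth hWo (smooth_fderiv hWo hfs) hy
    have h : HasFDerivAt (fderiv ℝ (fun y => - Real.log (f y))) _ y :=
      (((((hasDerivAt_inv (hpos y hy).ne').comp_hasFDerivAt y d1.hasFDerivAt).smul
        d2.hasFDerivAt).neg).congr_of_eventuallyEq (by
        filter_upwards [hWo.mem_nhds hy] with z hz using hρ1 z hz))
    rw [h.fderiv]
    simp
    ring
  have hgr : gradient G (fun y => - Real.log (f y)) y = - ((f y)⁻¹ • gradient G f y) := by
    rw [gradient, hρ1 y hy, gradient, map_neg, map_smul]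
  -- The Hessian equation gives `P` up to a multiple of `G`, and the first integral makes that
  -- multiple zero.
  have hS : confSchouten G (fun y => - Real.log (f y)) y = P y := by
    ext a b
    have h2 := hdf2 y hy a b
    have hc := hcons y hy
    have hp := (hpos y hy).ne'
    rw [hessian_apply] at h2
    rw [confSchouten_apply, hessian_apply, hρ2, hρ1 y hy, hgr]
    simp only [neg_apply, smul_apply, map_neg, map_smul, smul_eq_mul]
    rw [← hc]
    have e : fderiv ℝ (fderiv ℝ f) y a b = fderiv ℝ f y (leviCivita G y a b)
        + (- f y * P y a b + (s y).2.2 * G y a b) := by linarith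
    rw [e]
    field_simp
    ring
  rw [hGW.curvatureForm_conformal hρs hy, hS, hP.curvature y (hVU (hWV hy)), sub_self, mul_zero]

/-- The bilinear form of a flat conformal metric is a Codazzi tensor with `R = φ(P)`. -/
theorem IsMetricOn.isSchoutenOn_confSchouten (hG : IsMetricOn G U) {ρ : E → ℝ}
    (hρ : ContDiffOn ℝ ∞ ρ U)
    (h : ∀ y ∈ U, ∀ u v w t, curvatureForm (fun z => Real.exp (2 * ρ z) • G z) y u v w t = 0) :
    IsSchoutenOn G (confSchouten G ρ) U := by
  have s1 := smooth_fderiv hG.isOpen hρ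
  have sN := hG.smooth_gradient hρ
  have sH := hG.smooth_hessian hρ
  have sNN : ContDiffOn ℝ ∞ (fun y => G y (gradient G ρ y) (gradient G ρ y)) U :=
    (hG.smooth.clm_apply sN).clm_apply sN
  have hcurv : ∀ y ∈ U, ∀ u v w t, curvatureForm G y u v w t =
      kn (G y) (confSchouten G ρ y) u v w t := by
    intro y hy u v w t
    have := h y hy u v w t
    rw [hG.curvatureForm_conformal hρ hy] at this
    have := (mul_eq_zero.1 this).resolve_left (Real.exp_ne_zero _)
    linarith
  have sP : ContDiffOn ℝ ∞ (confSchouten G ρ) U :=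
    (sH.sub (s1.smulRight s1)).add ((contDiffOn_const.mul sNN).smul hG.smooth)
  refine ⟨sP, fun y hy u v => ?_, hcurv, fun y hy a u v => ?_⟩
  · rw [confSchouten_apply, confSchouten_apply, hG.hessian_symm hρ hy, hG.symm y hy u v]; ring
  · have d1 := differentiableAt_of_smooth hG.isOpen s1 hy
    have dH := differentiableAt_of_smooth hG.isOpen sH hy
    have dNN := differentiableAt_of_smooth hG.isOpen sNN hy
    have hcov : ∀ a u v, covBil G (confSchouten G ρ) y a u v =
        covBil G (hessian G ρ) y a u v
        - (hessian G ρ y a u * fderiv ℝ ρ y v + fderiv ℝ ρ y u * hessian G ρ y a v)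
        + hessian G ρ y a (gradient G ρ y) * G y u v := by
      intro a u v
      have h' : HasFDerivAt (fun z => confSchouten G ρ z u v) _ y :=
        (((hasFDerivAt_apply₂ dH u v).sub ((hasFDerivAt_apply₁ d1 u).mul
          (hasFDerivAt_apply₁ d1 v))).add ((dNN.hasFDerivAt.const_mul (1 / 2)).mul
          (hasFDerivAt_apply₂ (hG.differentiableAt hy) u v))).congr_of_eventuallyEq
          (Filter.Eventually.of_forall fun z => confSchouten_apply ρ z u v)
      have e := hG.fderiv_gradient_sq hρ hy a
      rw [covBil, ← fderiv_apply₂ (differentiableAt_of_smooth hG.isOpen sP hy), h'.fderiv, covBil]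
      simp [e, confSchouten_apply, hG.fderiv_eq hy, hessian_apply]
      ring
    -- The skew part of the third derivatives is `- dρ(R(a,u)v)`; through `R = φ(P)` it cancels what
    -- comes from differentiating `dρ ⊗ dρ` and `|∇ρ|² G`.
    have hr := hG.covBil_hessian hρ hy a u v
    have hc := hcurv y hy a u v (gradient G ρ y)
    rw [hG.curvatureForm_eq hy, hG.symm y hy, hG.apply_gradient ρ hy] at hc
    rw [hcov, hcov]
    have hNr : ∀ a, G y a (gradient G ρ y) = fderiv ℝ ρ y a := fun a => by
      rw [hG.symm y hy, hG.apply_gradient ρ hy]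
    simp only [kn, confSchouten_apply, hNr] at hc
    rw [hG.hessian_symm hρ hy u a]
    linear_combination hr - hc

end WeylSchouten

/-! ### Contractions: the Codazzi equation from Bianchi, and the Schouten form. -/

section Traces

variable {E : Type*} [NormedAddCommGroup E] [NormedSpace ℝ E] [FiniteDimensional ℝ E]

/-- The basis dual to the standard basis with respect to the form `g`. -/
def dualVec (g : E →L[ℝ] E →L[ℝ] ℝ) (i : Fin (Module.finrank ℝ E)) : E :=
  g.inverse (LinearMap.toContinuousLinearMap ((Module.finBasis ℝ E).coord i))

theorem dualVec_apply {g : E →L[ℝ] E →L[ℝ] ℝ} (hn : ∀ u, (∀ v, g u v = 0) → u = 0)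
    (i : Fin (Module.finrank ℝ E)) (v : E) :
    g (dualVec g i) v = (Module.finBasis ℝ E).repr v i := by
  rw [dualVec, apply_inverse hn]; rfl

theorem sum_dualVec_smul_basis {g : E →L[ℝ] E →L[ℝ] ℝ} (hs : ∀ u v, g u v = g v u)
    (hn : ∀ u, (∀ v, g u v = 0) → u = 0) (x : E) :
    ∑ i, g x (dualVec g i) • (Module.finBasis ℝ E) i = x := by
  simp_rw [hs x, dualVec_apply hn]
  exact (Module.finBasis ℝ E).sum_repr x

theorem sum_basis_smul_dualVec {g : E →L[ℝ] E →L[ℝ] ℝ} (hn : ∀ u, (∀ v, g u v = 0) → u = 0)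
    (z : E) : ∑ i, g z ((Module.finBasis ℝ E) i) • dualVec g i = z := by
  refine eq_of_forall_apply hn fun v => ?_
  simp only [map_sum, map_smul, sum_apply, smul_apply, dualVec_apply hn, smul_eq_mul]
  conv_rhs => rw [← (Module.finBasis ℝ E).sum_repr v]
  simp only [map_sum, map_smul, smul_eq_mul]
  exact Finset.sum_congr rfl fun i _ => mul_comm _ _

theorem sum_basis_dualVec {g : E →L[ℝ] E →L[ℝ] ℝ} (hn : ∀ u, (∀ v, g u v = 0) → u = 0) :
    ∑ i, g (dualVec g i) ((Module.finBasis ℝ E) i) = Module.finrank ℝ E := by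
  simp [dualVec_apply hn]

/-- A tensor of Cotton type satisfying the contracted second Bianchi identity vanishes in
dimension at least four. -/
theorem cotton_eq_zero {g : E →L[ℝ] E →L[ℝ] ℝ} (hs : ∀ u v, g u v = g v u)
    (hn : ∀ u, (∀ v, g u v = 0) → u = 0) (hd : 4 ≤ Module.finrank ℝ E)
    {C : E →L[ℝ] E →L[ℝ] E →L[ℝ] ℝ} (hC : ∀ x y z, C x y z = - C y x z)
    (h : ∀ a x y z u, g a u * C x y z + g x u * C y a z + g y u * C a x z
      - (g a z * C x y u + g x z * C y a u + g y z * C a x u) = 0) (x y z : E) :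
    C x y z = 0 := by
  set b := Module.finBasis ℝ E with hb
  have hd' : (4 : ℝ) ≤ Module.finrank ℝ E := by exact_mod_cast hd
  set n : ℝ := (Module.finrank ℝ E : ℝ) with hnn
  have s1 : ∀ x, ∑ i, g x (dualVec g i) • b i = x := sum_dualVec_smul_basis hs hn
  have s2 : ∀ z, ∑ i, g (b i) z • dualVec g i = z := fun z => by
    simp_rw [hs _ z]; exact sum_basis_smul_dualVec hn z
  have s3 : ∑ i, g (b i) (dualVec g i) = n := by
    simp_rw [hs (b _)]; exact sum_basis_dualVec hn
  obtain ⟨θ, hθ⟩ : ∃ θ : E → ℝ, ∀ y, θ y = ∑ i, C y (b i) (dualVec g i) := ⟨_, fun _ => rfl⟩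
  -- Contraction of `a` with `u`: the trace of `g` contributes `n`, and three further terms each
  -- contribute `- C x y z`.
  have e1 : ∀ x y z, (n - 3) * C x y z = g x z * θ y - g y z * θ x := by
    intro x y z
    have hsum : ∑ i, (g (b i) (dualVec g i) * C x y z + g x (dualVec g i) * C y (b i) z
        + g y (dualVec g i) * C (b i) x z - (g (b i) z * C x y (dualVec g i)
        + g x z * C y (b i) (dualVec g i) + g y z * C (b i) x (dualVec g i))) = 0 :=
      Finset.sum_eq_zero fun i _ => h _ _ _ _ _
    have t1 : ∑ i, g x (dualVec g i) * C y (b i) z = C y x z := by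
      conv_rhs => rw [← s1 x]
      simp
    have t2 : ∑ i, g y (dualVec g i) * C (b i) x z = C y x z := by
      conv_rhs => rw [← s1 y]
      simp
    have t3 : ∑ i, g (b i) z * C x y (dualVec g i) = C x y z := by
      conv_rhs => rw [← s2 z]
      simp
    have t4 : ∑ i, C (b i) x (dualVec g i) = - θ x := by
      rw [hθ, ← Finset.sum_neg_distrib]
      exact Finset.sum_congr rfl fun i _ => hC _ _ _
    rw [Finset.sum_sub_distrib, Finset.sum_add_distrib, Finset.sum_add_distrib,
      Finset.sum_add_distrib, Finset.sum_add_distrib, ← Finset.sum_mul, s3, t1, t2, t3,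
      ← Finset.mul_sum, ← Finset.mul_sum, ← hθ, t4] at hsum
    linear_combination hsum - 2 * hC x y z
  -- One more contraction gives `(n - 3) θ = θ - n θ`, so `θ = 0`; then `n > 3` ends the argument.
  have e2 : ∀ x, θ x = 0 := by
    intro x
    have hsum : ∑ i, (n - 3) * C x (b i) (dualVec g i) =
        ∑ i, (g x (dualVec g i) * θ (b i) - g (b i) (dualVec g i) * θ x) :=
      Finset.sum_congr rfl fun i _ => e1 _ _ _
    have hlin : ∑ i, g x (dualVec g i) * θ (b i) = θ x := by
      rw [hθ x]
      simp_rw [hθ, Finset.mul_sum]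
      rw [Finset.sum_comm]
      refine Finset.sum_congr rfl fun j _ => ?_
      conv_rhs => rw [← s1 x]
      simp
    rw [Finset.sum_sub_distrib, hlin, ← Finset.sum_mul, s3, ← Finset.mul_sum, ← hθ] at hsum
    have : (2 * n - 4) * θ x = 0 := by linarith
    exact (mul_eq_zero.1 this).resolve_left (by linarith)
  have := e1 x y z
  rw [e2, e2] at this
  have h3 : (n - 3) * C x y z = 0 := by linarith
  exact (mul_eq_zero.1 h3).resolve_left (by linarith)

variable {G P : E → E →L[ℝ] E →L[ℝ] ℝ} {U : Set E}

/-- The covariant derivative of a bilinear form as a trilinear map. -/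
def covBilMap (G P : E → E →L[ℝ] E →L[ℝ] ℝ) (y : E) : E →L[ℝ] E →L[ℝ] E →L[ℝ] ℝ :=
  LinearMap.toContinuousLinearMap
    { toFun := fun a => fderiv ℝ P y a - (P y).comp (leviCivita G y a)
        - ((P y).flip.comp (leviCivita G y a)).flip
      map_add' := fun a a' => by ext; simp; ring
      map_smul' := fun c a => by ext; simp; ring }

theorem covBilMap_apply (y a u v : E) : covBilMap G P y a u v = covBil G P y a u v := rfl

/-- Because `∇G = 0`, the covariant derivative passes through `φ` to its argument. -/
theorem IsMetricOn.covDerivCurvatureForm_of_kn (hG : IsMetricOn G U) (hP : ContDiffOn ℝ ∞ P U)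
    (h : ∀ y ∈ U, ∀ u v w t, curvatureForm G y u v w t = kn (G y) (P y) u v w t)
    {y : E} (hy : y ∈ U) (a x v z u : E) :
    covDerivCurvatureForm G y a x v z u =
      G y x u * covBil G P y a v z - G y x z * covBil G P y a v u
        + G y v z * covBil G P y a x u - G y v u * covBil G P y a x z := by
  have dP := differentiableAt_of_smooth hG.isOpen hP hy
  have dG := hG.differentiableAt hy
  have h1 : HasFDerivAt (fun q => curvatureForm G q x v z u) _ y :=
    (((((hasFDerivAt_apply₂ dG x u).mul (hasFDerivAt_apply₂ dP v z)).sub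
      ((hasFDerivAt_apply₂ dG x z).mul (hasFDerivAt_apply₂ dP v u))).add
      ((hasFDerivAt_apply₂ dG v z).mul (hasFDerivAt_apply₂ dP x u))).sub
      ((hasFDerivAt_apply₂ dG v u).mul (hasFDerivAt_apply₂ dP x z))).congr_of_eventuallyEq (by
      filter_upwards [hG.isOpen.mem_nhds hy] with q hq using h q hq x v z u)
  rw [covDerivCurvatureForm, h1.fderiv]
  simp only [h y hy, hG.christoffel_eq hy, kn, covBil]
  simp [hG.fderiv_eq hy]
  ring

/-- In dimension at least four, `R = φ(P)` forces `P` to be a Codazzi tensor. -/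
theorem IsMetricOn.isSchoutenOn_of_four_le (hG : IsMetricOn G U)
    (hd : 4 ≤ Module.finrank ℝ E) (hP : ContDiffOn ℝ ∞ P U)
    (hPs : ∀ y ∈ U, ∀ u v, P y u v = P y v u)
    (h : ∀ y ∈ U, ∀ u v w t, curvatureForm G y u v w t = kn (G y) (P y) u v w t) :
    IsSchoutenOn G P U := by
  refine ⟨hP, hPs, h, fun y hy a u v => ?_⟩
  have key := cotton_eq_zero (hG.symm y hy) (hG.nondeg y hy) hd
    (C := covBilMap G P y - (covBilMap G P y).flip) (fun x y z => by simp) ?_ a u v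
  · simp [covBilMap_apply] at key
    linarith
  · intro a x v z u
    have hb := congrArg (fun L : E →L[ℝ] E => G y (L z) u) (hG.bianchi_second hy a x v)
    simp only [add_apply, map_add, ← hG.covDerivCurvatureForm_eq hy,
      hG.covDerivCurvatureForm_of_kn hP h hy] at hb
    simp only [zero_apply, map_zero] at hb
    simp only [sub_apply, ContinuousLinearMap.flip_apply, covBilMap_apply]
    linear_combination -hb

/-- The Ricci form. -/
def ricci (G : E → E →L[ℝ] E →L[ℝ] ℝ) (y : E) : E →L[ℝ] E →L[ℝ] ℝ :=
  ∑ i, (ContinuousLinearMap.compL ℝ E E ℝ (G y (dualVec (G y) i))).comp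
    (curvMap (leviCivita G) y (Module.finBasis ℝ E i))

/-- The Schouten form, normalized by `R = φ(P)` for vanishing Weyl tensor. -/
def schouten (G : E → E →L[ℝ] E →L[ℝ] ℝ) (y : E) : E →L[ℝ] E →L[ℝ] ℝ :=
  (1 / (Module.finrank ℝ E - 2 : ℝ)) • (ricci G y -
    ((1 / (2 * (Module.finrank ℝ E - 1 : ℝ))) *
      ∑ i, ricci G y (Module.finBasis ℝ E i) (dualVec (G y) i)) • G y)

theorem IsMetricOn.smooth_dualVec (hG : IsMetricOn G U) (i : Fin (Module.finrank ℝ E)) :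
    ContDiffOn ℝ ∞ (fun y => dualVec (G y) i) U :=
  hG.smooth_inverse.clm_apply contDiffOn_const

theorem IsMetricOn.smooth_ricci (hG : IsMetricOn G U) : ContDiffOn ℝ ∞ (ricci G) U := by
  have : ∀ i, ContDiffOn ℝ ∞ (fun y => (ContinuousLinearMap.compL ℝ E E ℝ
      (G y (dualVec (G y) i))).comp (curvMap (leviCivita G) y (Module.finBasis ℝ E i))) U := by
    intro i
    refine ContDiffOn.clm_comp ?_ (hG.smooth_curvMap.clm_apply contDiffOn_const)
    exact (ContinuousLinearMap.compL ℝ E E ℝ).contDiff.comp_contDiffOn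
      (hG.smooth.clm_apply (hG.smooth_dualVec i))
  exact ContDiffOn.sum fun i _ => this i

theorem IsMetricOn.smooth_schouten (hG : IsMetricOn G U) : ContDiffOn ℝ ∞ (schouten G) U := by
  have h : ContDiffOn ℝ ∞ (fun y => ∑ i, ricci G y (Module.finBasis ℝ E i) (dualVec (G y) i)) U :=
    ContDiffOn.sum fun i _ =>
      (hG.smooth_ricci.clm_apply contDiffOn_const).clm_apply (hG.smooth_dualVec i)
  exact (hG.smooth_ricci.sub ((contDiffOn_const.mul h).smul hG.smooth)).const_smul _

theorem IsMetricOn.ricci_apply (hG : IsMetricOn G U) {y : E} (hy : y ∈ U) (u v : E) :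
    ricci G y u v =
      ∑ i, curvatureForm G y (Module.finBasis ℝ E i) u v (dualVec (G y) i) := by
  simp only [ricci, sum_apply, hG.curvatureForm_eq hy]
  exact Finset.sum_congr rfl fun i _ => hG.symm y hy _ _

/-- Contraction inverts `φ`: `Ric = (n - 2) Q + (tr Q) g`, with scalar curvature `2 (n - 1) tr Q`.
This uniqueness later turns pointwise choices of `Q` into one smooth tensor field. -/
theorem IsMetricOn.schouten_eq (hG : IsMetricOn G U) (hd : 3 ≤ Module.finrank ℝ E) {y : E}
    (hy : y ∈ U) {Q : E →L[ℝ] E →L[ℝ] ℝ}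
    (h : ∀ u v w t, curvatureForm G y u v w t = kn (G y) Q u v w t) : schouten G y = Q := by
  have hs := hG.symm y hy
  have hn := hG.nondeg y hy
  have hd' : (3 : ℝ) ≤ Module.finrank ℝ E := by exact_mod_cast hd
  set b := Module.finBasis ℝ E with hb
  set n : ℝ := (Module.finrank ℝ E : ℝ) with hnn
  have s1 : ∀ x, ∑ i, G y x (dualVec (G y) i) • b i = x := sum_dualVec_smul_basis hs hn
  have s2 : ∀ z, ∑ i, G y (b i) z • dualVec (G y) i = z := fun z => by
    simp_rw [hs _ z]; exact sum_basis_smul_dualVec hn z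
  have s3 : ∑ i, G y (b i) (dualVec (G y) i) = n := by
    simp_rw [hs (b _)]; exact sum_basis_dualVec hn
  obtain ⟨τ, hτ⟩ : ∃ τ, τ = ∑ i, Q (b i) (dualVec (G y) i) := ⟨_, rfl⟩
  have hric : ∀ u v, ricci G y u v = (n - 2) * Q u v + G y u v * τ := by
    intro u v
    have t1 : ∑ i, G y (b i) v * Q u (dualVec (G y) i) = Q u v := by
      conv_rhs => rw [← s2 v]
      simp
    have t2 : ∑ i, G y u (dualVec (G y) i) * Q (b i) v = Q u v := by
      conv_rhs => rw [← s1 u]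
      simp
    rw [hG.ricci_apply hy]
    simp_rw [h, kn]
    rw [Finset.sum_sub_distrib, Finset.sum_add_distrib, Finset.sum_sub_distrib, ← Finset.sum_mul,
      s3, t1, t2, ← Finset.mul_sum, ← hτ]
    ring
  have hscal : ∑ i, ricci G y (b i) (dualVec (G y) i) = 2 * (n - 1) * τ := by
    simp_rw [hric]
    rw [Finset.sum_add_distrib, ← Finset.mul_sum, ← Finset.sum_mul, s3, ← hτ]
    ring
  ext u v
  have hn2 : n - 2 ≠ 0 := by linarith
  have hn1 : n - 1 ≠ 0 := by linarith
  simp only [schouten, smul_apply, sub_apply, smul_eq_mul]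
  rw [← hb, hscal, hric, ← hnn]
  field_simp
  ring

theorem eq_zero_of_mem_closure {f : E → ℝ} {D : Set E} {y : E} (hf : ContinuousAt f y)
    (hD : y ∈ closure D) (h : ∀ z ∈ D, f z = 0) : f y = 0 := by
  by_contra hne
  obtain ⟨z, hz, hzD⟩ := (hf.eventually_ne hne).and_frequently (mem_closure_iff_frequently.1 hD)
    |>.exists
  exact hz (h z hzD)

/-- By uniqueness `Q` is the Schouten form at the points of `D`. That form is smooth on all of `U`,
so both identities pass to the closure. -/
theorem IsMetricOn.curvature_eq_schouten (hG : IsMetricOn G U) (hd : 3 ≤ Module.finrank ℝ E)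
    {D : Set E} (hDU : D ⊆ U) (hUD : U ⊆ closure D)
    (h : ∀ y ∈ D, ∃ Q : E →L[ℝ] E →L[ℝ] ℝ, (∀ u v, Q u v = Q v u) ∧
      ∀ u v w t, curvatureForm G y u v w t = kn (G y) Q u v w t) :
    ∀ y ∈ U, (∀ u v, schouten G y u v = schouten G y v u) ∧
      ∀ u v w t, curvatureForm G y u v w t = kn (G y) (schouten G y) u v w t := by
  have hsch : ∀ y ∈ D, (∀ u v, schouten G y u v = schouten G y v u) ∧
      ∀ u v w t, curvatureForm G y u v w t = kn (G y) (schouten G y) u v w t := by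
    intro y hy
    obtain ⟨Q, h1, h2⟩ := h y hy
    rw [hG.schouten_eq hd (hDU hy) h2]
    exact ⟨h1, h2⟩
  intro y hy
  have cS : ∀ u v, ContinuousAt (fun z => schouten G z u v) y := fun u v =>
    ((hG.smooth_schouten.clm_apply contDiffOn_const).clm_apply
      contDiffOn_const).continuousOn.continuousAt (hG.isOpen.mem_nhds hy)
  have cG : ∀ u v, ContinuousAt (fun z => G z u v) y := fun u v =>
    ((hG.smooth.clm_apply contDiffOn_const).clm_apply
      contDiffOn_const).continuousOn.continuousAt (hG.isOpen.mem_nhds hy)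
  have cR : ∀ u v w t, ContinuousAt (fun z => curvatureForm G z u v w t) y := by
    intro u v w t
    have : ContinuousAt (fun z => G z (curvEnd (leviCivita G) z u v w) t) y :=
      ((hG.smooth.clm_apply ((hG.smooth_curvEnd u v).clm_apply contDiffOn_const)).clm_apply
        contDiffOn_const).continuousOn.continuousAt (hG.isOpen.mem_nhds hy)
    refine this.congr ?_
    filter_upwards [hG.isOpen.mem_nhds hy] with z hz using (hG.curvatureForm_eq hz u v w t).symm
  refine ⟨fun u v => ?_, fun u v w t => ?_⟩
  · exact sub_eq_zero.1 (eq_zero_of_mem_closure (f := fun z => schouten G z u v - schouten G z v u)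
      ((cS u v).sub (cS v u)) (hUD hy)
      fun z hz => sub_eq_zero.2 ((hsch z hz).1 u v))
  · exact sub_eq_zero.1 (eq_zero_of_mem_closure (f := fun z => curvatureForm G z u v w t
      - kn (G z) (schouten G z) u v w t) ((cR u v w t).sub (((((cG u t).mul (cS v w)).sub
      ((cG u w).mul (cS v t))).add ((cG v w).mul (cS u t))).sub ((cG v t).mul (cS u w)))) (hUD hy)
      fun z hz => sub_eq_zero.2 ((hsch z hz).2 u v w t))

end Traces

/-! ### Algebraic curvature tensors and isotropic vectors. -/

section AlgebraicCurvature

variable {E : Type*} [AddCommGroup E] [Module ℝ E]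

/-- The algebraic properties of a curvature tensor of type `(0,4)`. -/
structure IsCurvatureLike (T : E → E → E → E → ℝ) : Prop where
  add₁ : ∀ x x' y z u, T (x + x') y z u = T x y z u + T x' y z u
  smul₁ : ∀ (c : ℝ) x y z u, T (c • x) y z u = c * T x y z u
  anti₁ : ∀ x y z u, T x y z u = - T y x z u
  anti₂ : ∀ x y z u, T x y z u = - T x y u z
  cyc : ∀ x y z u, T x y z u + T y z x u + T z x y u = 0

namespace IsCurvatureLike

variable {T : E → E → E → E → ℝ}

theorem pair (h : IsCurvatureLike T) (x y z u : E) : T x y z u = T z u x y := pair_symmetry h.anti₁ h.anti₂ h.cyc x y z u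

theorem add₂ (h : IsCurvatureLike T) (x y y' z u : E) : T x (y + y') z u = T x y z u + T x y' z u := by
  rw [h.anti₁, h.add₁, h.anti₁ y, h.anti₁ y']; ring

theorem smul₂ (h : IsCurvatureLike T) (c : ℝ) (x y z u : E) : T x (c • y) z u = c * T x y z u := by
  rw [h.anti₁, h.smul₁, h.anti₁ y]; ring

theorem add₃ (h : IsCurvatureLike T) (x y z z' u : E) : T x y (z + z') u = T x y z u + T x y z' u := by
  rw [h.pair, h.add₁, h.pair z, h.pair z']

theorem smul₃ (h : IsCurvatureLike T) (c : ℝ) (x y z u : E) : T x y (c • z) u = c * T x y z u := by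
  rw [h.pair, h.smul₁, h.pair z]

theorem add₄ (h : IsCurvatureLike T) (x y z u u' : E) : T x y z (u + u') = T x y z u + T x y z u' := by
  rw [h.pair, h.add₂, h.pair z, h.pair z]

theorem smul₄ (h : IsCurvatureLike T) (c : ℝ) (x y z u : E) : T x y z (c • u) = c * T x y z u := by
  rw [h.pair, h.smul₂, h.pair z]

theorem self₁ (h : IsCurvatureLike T) (x z u : E) : T x x z u = 0 := by linarith [h.anti₁ x x z u]

theorem self₂ (h : IsCurvatureLike T) (x y z : E) : T x y z z = 0 := by linarith [h.anti₂ x y z z]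

/-- Polarization makes `T` skew also in its outer slots; together with the cyclic identity this
leaves nothing. -/
theorem eq_zero_of_sectional (h : IsCurvatureLike T) (h0 : ∀ x y, T x y y x = 0) (x y z u : E) : T x y z u = 0 := by
  have h1 : ∀ x y z, T x y z x = 0 := by
    intro x y z
    have := h0 x (y + z)
    rw [h.add₂, h.add₃, h.add₃, h0, h0] at this
    have e : T x z y x = T x y z x := by rw [h.pair, h.anti₁, h.anti₂]; ring
    linarith
  have h2 : ∀ x y z u, T x y z u = - T u y z x := by
    intro x y z u
    have := h1 (x + u) y z
    rw [h.add₁, h.add₄, h.add₄, h1, h1] at this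
    linarith
  have e1 := h2 y z x u
  have e2 := h2 z x y u
  linarith [h.cyc x y z u, h.anti₁ x y z u, h.anti₁ y z x u, h.anti₁ z x y u, h.pair x y z u,
    h.pair y z x u, h.pair z x y u, h2 x y z u, h.anti₁ u y z x, h.anti₁ u z x y, h.anti₁ u x y z,
    h.anti₂ x y z u, h.anti₂ y z x u, h.anti₂ z x y u, h2 x z y u, h2 y x z u, h2 z y x u,
    h.anti₁ u z y x, h.pair u z y x, h.pair u y z x, h.pair u x z y, h.anti₂ u z y x,
    h.anti₂ u y z x, h.pair x z y u, h.anti₁ x z y u, h.anti₂ x z y u, h.pair z u x y,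
    h.anti₁ z u x y, h.anti₂ z u x y]

theorem sub {S : E → E → E → E → ℝ} (h : IsCurvatureLike T) (hS : IsCurvatureLike S) (c d : ℝ) :
    IsCurvatureLike fun x y z u => c * T x y z u - d * S x y z u := by
  refine ⟨fun x x' y z u => ?_, fun c x y z u => ?_, fun x y z u => ?_, fun x y z u => ?_,
    fun x y z u => ?_⟩
  · rw [h.add₁, hS.add₁]; ring
  · rw [h.smul₁, hS.smul₁]; ring
  · rw [h.anti₁, hS.anti₁]; ring
  · rw [h.anti₂, hS.anti₂]; ring
  · linear_combination c * h.cyc x y z u - d * hS.cyc x y z u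

end IsCurvatureLike

variable {g : E →ₗ[ℝ] E →ₗ[ℝ] ℝ}

theorem isCurvatureLike_of_form (hs : ∀ u v, g u v = g v u) :
    IsCurvatureLike fun x y z u => g x u * g y z - g x z * g y u := by
  refine ⟨fun x x' y z u => ?_, fun c x y z u => ?_, fun x y z u => ?_, fun x y z u => ?_,
    fun x y z u => ?_⟩
  · simp; ring
  · simp; ring
  · ring
  · ring
  · rw [hs y x, hs z x, hs z y]; ring

/-- If `w` is isotropic, the squares of `w + s w₀` and `w - s w₀` add up to `2 s² g(w₀,w₀) ≠ 0`, so
one of them is anisotropic and the product of the values of `h` vanishes. The limit `s → 0` gives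
`h(w)² = 0`. -/
theorem eq_zero_of_eq_zero_of_anisotropic {w w₀ : E}
    (h0 : g w₀ w₀ ≠ 0) {h : E → ℝ} (hc : Continuous fun s : ℝ => h (w + s • w₀))
    (hz : ∀ s : ℝ, g (w + s • w₀) (w + s • w₀) ≠ 0 → h (w + s • w₀) = 0) : h w = 0 := by
  by_cases hw : g w w = 0
  · have hφ : ∀ s ∈ ({0}ᶜ : Set ℝ), h (w + s • w₀) * h (w + (-s) • w₀) = 0 := by
      intro s hs0
      rw [mul_eq_zero]
      by_contra hne
      push Not at hne
      have h1 := not_imp_comm.1 (hz s) hne.1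
      have h2 := not_imp_comm.1 (hz (-s)) hne.2
      have : 2 * s ^ 2 * g w₀ w₀ = 0 := by
        simp only [map_add, map_smul, LinearMap.add_apply, LinearMap.smul_apply, smul_eq_mul,
          hw] at h1 h2
        linear_combination h1 + h2
      simp [h0] at this
      exact hs0 this
    have := hc.mul (hc.comp continuous_neg)
    have hcl : (0 : ℝ) ∈ closure ({0}ᶜ : Set ℝ) := by
      rw [(dense_compl_singleton (0 : ℝ)).closure_eq]; trivial
    have := eq_zero_of_mem_closure (this.continuousAt (x := (0 : ℝ))) hcl hφ
    simpa using this
  · simpa using hz 0 (by simpa using hw)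

/-- Every isotropic vector lies in a hyperbolic pair. The complement of the pair is nonzero in
dimension at least three and nondegenerate, so it contains an anisotropic vector. -/
theorem exists_hyperbolic (hs : ∀ u v, g u v = g v u) (hn : ∀ u, (∀ v, g u v = 0) → u = 0)
    (hd : 3 ≤ Module.finrank ℝ E) {e : E} (he : e ≠ 0) (hee : g e e = 0) :
    ∃ f w₀, g f f = 0 ∧ g e f = 1 ∧ g e w₀ = 0 ∧ g f w₀ = 0 ∧ g w₀ w₀ ≠ 0 := by
  obtain ⟨v, hv⟩ : ∃ v, g e v ≠ 0 := by
    by_contra hcon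
    push Not at hcon
    exact he (hn e hcon)
  obtain ⟨f, hff, hef⟩ : ∃ f, g f f = 0 ∧ g e f = 1 := by
    -- A vector scaled to pair to one with `e`, then moved along `e` until its square is zero.
    refine ⟨(g e v)⁻¹ • v - (1 / 2 * (g e v)⁻¹ ^ 2 * g v v) • e, ?_, ?_⟩
    · simp [hee, hs v e]
      field_simp
      ring
    · simp [hee, hv]
  refine ⟨f, ?_⟩
  by_contra hcon
  push Not at hcon
  have hW : ∀ w, g e w = 0 → g f w = 0 → w = 0 := by
    intro w hew hfw
    have hww : ∀ z, g e z = 0 → g f z = 0 → g w z = 0 := by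
      intro z hez hfz
      have h1 := hcon w hff hef hew hfw
      have h2 := hcon z hff hef hez hfz
      have h3 := hcon (w + z) hff hef (by simp [hew, hez]) (by simp [hfw, hfz])
      simp [h1, h2, hs z w] at h3
      linarith
    refine hn w fun x => ?_
    have := hww (x - g f x • e - g e x • f) (by simp [hee, hef]) (by simp [hff, hs f e, hef])
    simpa [hs w e, hs w f, hew, hfw] using this
  have hspan : (⊤ : Submodule ℝ E) ≤ Submodule.span ℝ (Set.range ![e, f]) := by
    intro x _
    have := hW (x - g f x • e - g e x • f) (by simp [hee, hef]) (by simp [hff, hs f e, hef])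
    have hx : x = g f x • e + g e x • f := by
      rw [sub_sub, sub_eq_zero] at this; exact this
    rw [hx]
    exact Submodule.add_mem _ (Submodule.smul_mem _ _ (Submodule.subset_span ⟨0, rfl⟩))
      (Submodule.smul_mem _ _ (Submodule.subset_span ⟨1, rfl⟩))
  have h2 := finrank_range_le_card (R := ℝ) (b := ![e, f])
  rw [Set.finrank, top_le_iff.1 hspan, finrank_top] at h2
  simp at h2
  omega

/-- The identities obtained from isotropic planes close to a given one. -/
theorem isotropic_expansion {S : E → E → E → E → ℝ} (h : IsCurvatureLike S)
    (hs : ∀ u v, g u v = g v u)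
    (hS : ∀ x y, g x x = 0 → g x y = 0 → S x y y x = 0) {e f w w' : E}
    (hee : g e e = 0) (hff : g f f = 0) (hef : g e f = 1) (hew : g e w = 0) (hfw : g f w = 0)
    (hew' : g e w' = 0) (hfw' : g f w' = 0) :
    S e w' w w' - g w w' * S e w' e f = 0 ∧
    S w w' w w' - 2 * g w w' * S e f w w' + g w w' ^ 2 * S e f e f
      - g w w * S e w' f w' + 2 * g w w' * S e w' f w = 0 := by
  -- A null rotation fixing `f`: it carries `e` to an isotropic vector `x(s)` and `w'` to a vector
  -- `y(s)` orthogonal to `x(s)`.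
  have key : ∀ s : ℝ, S (e + s • w + (-(s ^ 2 / 2 * g w w)) • f) (w' + (-(s * g w w')) • f)
      (w' + (-(s * g w w')) • f) (e + s • w + (-(s ^ 2 / 2 * g w w)) • f) = 0 := by
    intro s
    refine hS _ _ ?_ ?_
    · simp [hee, hff, hef, hew, hfw, hs f e, hs w e, hs w f]; ring
    · simp [hff, hef, hew', hfw', hs w f, hfw]
  have a1 := key 1
  have a2 := key (-1)
  have a3 := key 2
  have a4 := key (-2)
  have a0 := key 0
  have wf : ∀ z u, S w f z u = - S f w z u := h.anti₁ w f
  have fe' : ∀ z u, S z u f e = - S z u e f := fun z u => h.anti₂ z u f e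
  have w'e' : ∀ z u, S z u w' e = - S z u e w' := fun z u => h.anti₂ z u w' e
  have w'f' : ∀ z u, S z u w' f = - S z u f w' := fun z u => h.anti₂ z u w' f
  have w'w' : ∀ z u, S z u w' w = - S z u w w' := fun z u => h.anti₂ z u w' w
  simp only [h.add₁, h.add₂, h.add₃, h.add₄, h.smul₁, h.smul₂, h.smul₃, h.smul₄, h.self₁, h.self₂,
    wf, fe', w'e', w'f', w'w', h.pair e w' e f, h.pair w w' e f,
    h.pair w w' e w', h.pair f w' e w', h.pair f w e w', h.pair f w' e f, h.pair f w e f,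
    h.pair f w' f w, h.pair w w' f w', h.pair w w' f w] at a0 a1 a2 a3 a4 ⊢
  -- The bivector `x(s) ∧ y(s)` is quadratic in `s`, so `S` is quartic. The five-point difference
  -- formulas, exact in degree four, extract the coefficients of `s` and `s²`.
  constructor
  · linear_combination (-1 / 2 : ℝ) * ((8 * (a1 - a2) - (a3 - a4)) / 12)
  · linear_combination (-1 : ℝ) * ((16 * (a1 + a2) - (a3 + a4) - 30 * a0) / 24)

end AlgebraicCurvature

/-! ### Curvature tensors that vanish on weakly degenerate planes. -/

section IsotropicPlanes

variable {E : Type*} [AddCommGroup E] [Module ℝ E] {g : E →ₗ[ℝ] E →ₗ[ℝ] ℝ}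
  {S : E → E → E → E → ℝ}

/-- Components with one index along the isotropic line of `e` and three transversal indices. -/
theorem isotropic_component (h : IsCurvatureLike S) (hs : ∀ u v, g u v = g v u)
    (hS : ∀ x y, g x x = 0 → g x y = 0 → S x y y x = 0) {e f w₀ : E}
    (hee : g e e = 0) (hff : g f f = 0) (hef : g e f = 1) (hew₀ : g e w₀ = 0) (hfw₀ : g f w₀ = 0)
    (hw₀ : g w₀ w₀ ≠ 0) :
    (∀ w, g e w = 0 → g f w = 0 → S e w e f = 0) ∧
    ∀ a b c, g e a = 0 → g f a = 0 → g e b = 0 → g f b = 0 → g e c = 0 → g f c = 0 →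
      S e a b c = 0 := by
  have h1 : ∀ w, g e w = 0 → g f w = 0 → S e w e f = 0 := by
    intro w hew hfw
    refine eq_zero_of_eq_zero_of_anisotropic (g := g) (w := w) (h := fun w => S e w e f) hw₀ ?_ ?_
    · simp only [h.add₂, h.smul₂]; fun_prop
    · intro s hs0
      have h1 : g e (w + s • w₀) = 0 := by simp [hew, hew₀]
      have h2 : g f (w + s • w₀) = 0 := by simp [hfw, hfw₀]
      -- With `w' = w` the first identity reads `g(w,w) S(e,w,e,f) = 0`.
      have := (isotropic_expansion h hs hS hee hff hef h1 h2 h1 h2).1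
      rw [h.self₂] at this
      exact (mul_eq_zero.1 (by linarith)).resolve_left hs0
  refine ⟨h1, ?_⟩
  have h2 : ∀ a b c, g e a = 0 → g f a = 0 → g e b = 0 → g f b = 0 → g e c = 0 → g f c = 0 →
      S e a b c = - S e c b a := by
    intro a b c ha ha' hb hb' hc hc'
    have k : ∀ w', g e w' = 0 → g f w' = 0 → S e w' b w' = 0 := by
      intro w' hw hw'
      have := (isotropic_expansion h hs hS hee hff hef hb hb' hw hw').1
      rwa [h1 w' hw hw', mul_zero, sub_zero] at this
    have k1 := k (a + c) (by simp [ha, hc]) (by simp [ha', hc'])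
    rw [h.add₂, h.add₄, h.add₄, k a ha ha', k c hc hc'] at k1
    linarith
  intro a b c ha ha' hb hb' hc hc'
  -- `S(e,a,b,c)` is alternating in `a, b, c`, so the cyclic identity gives `3 S(e,a,b,c) = 0`.
  have k1 := h2 a b c ha ha' hb hb' hc hc'
  have k2 := h2 b a c hb hb' ha ha' hc hc'
  have k3 := h2 b c a hb hb' hc hc' ha ha'
  have k4 := h.cyc e a b c
  have k5 := h.pair a b e c
  have k6 := h.anti₁ b e a c
  linarith [h.anti₂ e a b c, h.anti₂ e b a c, h.anti₂ e c a b]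

/-- The components with respect to `ℝe ⊕ ℝf ⊕ {e, f}^⊥` are eliminated one type at a time. The
hypothesis `h0` removes the only freedom, a multiple of the constant curvature tensor. -/
theorem eq_zero_of_isotropic (h : IsCurvatureLike S) (hs : ∀ u v, g u v = g v u)
    (hS : ∀ x y, g x x = 0 → g x y = 0 → S x y y x = 0) {e f w₀ : E}
    (hee : g e e = 0) (hff : g f f = 0) (hef : g e f = 1) (hew₀ : g e w₀ = 0) (hfw₀ : g f w₀ = 0)
    (hw₀ : g w₀ w₀ ≠ 0) (h0 : S e f e f = 0) (x y z u : E) : S x y z u = 0 := by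
  have hfe : g f e = 1 := by rw [hs, hef]
  obtain ⟨e1, e3⟩ := isotropic_component h hs hS hee hff hef hew₀ hfw₀ hw₀
  obtain ⟨f1, f3⟩ := isotropic_component h hs hS hff hee hfe hfw₀ hew₀ hw₀
  have e2 : ∀ w, g e w = 0 → g f w = 0 → S e w e w = 0 := by
    intro w hw _
    rw [h.anti₂, hS e w hee hw, neg_zero]
  have f2 : ∀ w, g e w = 0 → g f w = 0 → S f w f w = 0 := by
    intro w _ hw
    rw [h.anti₂, hS f w hff hw, neg_zero]
  have c0 : ∀ w, g e w = 0 → g f w = 0 → S e w f w = 0 := by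
    intro w hew hfw
    refine eq_zero_of_eq_zero_of_anisotropic (g := g) (w := w) (h := fun w => S e w f w) hw₀ ?_ ?_
    · simp only [h.add₂, h.smul₂, h.add₄, h.smul₄]; fun_prop
    · intro s hs0
      have h1 : g e (w + s • w₀) = 0 := by simp [hew, hew₀]
      have h2 : g f (w + s • w₀) = 0 := by simp [hfw, hfw₀]
      have := (isotropic_expansion h hs hS hee hff hef h1 h2 h1 h2).2
      rw [h.self₂, h.self₂, h0] at this
      refine (mul_eq_zero.1 ?_).resolve_left hs0
      linarith
  have c1 : ∀ a b, g e a = 0 → g f a = 0 → g e b = 0 → g f b = 0 → S e a f b = - S e b f a := by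
    intro a b ha ha' hb hb'
    have := c0 (a + b) (by simp [ha, hb]) (by simp [ha', hb'])
    rw [h.add₂, h.add₄, h.add₄, c0 a ha ha', c0 b hb hb'] at this
    linarith
  have c2 : ∀ a b, g e a = 0 → g f a = 0 → g e b = 0 → g f b = 0 →
      S e f a b = 2 * S e a f b := by
    intro a b ha ha' hb hb'
    linarith [h.cyc e f a b, h.pair f a e b, h.anti₁ a e f b, c1 a b ha ha' hb hb']
  have c3 : ∀ a b, g e a = 0 → g f a = 0 → g e b = 0 → g f b = 0 →
      S a b a b = 0 ∧ g a b * S e a f b = 0 := by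
    intro a b ha ha' hb hb'
    -- The second identity for `(a, b)` and `(b, a)` gives `S(a,b,a,b) ∓ 6 g(a,b) S(e,a,f,b) = 0`;
    -- sum and difference separate the two terms.
    have k1 := (isotropic_expansion h hs hS hee hff hef ha ha' hb hb').2
    have k2 := (isotropic_expansion h hs hS hee hff hef hb hb' ha ha').2
    rw [c2 _ _ ha ha' hb hb', c0 b hb hb', h0, c1 b a hb hb' ha ha'] at k1
    rw [c2 _ _ hb hb' ha ha', c0 a ha ha', h0, c1 b a hb hb' ha ha', h.anti₁ b a, h.anti₂ a b b a,
      hs b a] at k2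
    constructor <;> linarith
  have c4 : ∀ a b, g e a = 0 → g f a = 0 → g e b = 0 → g f b = 0 → S e a f b = 0 := by
    intro a b ha ha' hb hb'
    refine eq_zero_of_eq_zero_of_anisotropic (g := g) (w := a) (h := fun a => S e a f b) hw₀ ?_ ?_
    · simp only [h.add₂, h.smul₂]; fun_prop
    · intro s hs0
      have h1 : g e (a + s • w₀) = 0 := by simp [ha, hew₀]
      have h2 : g f (a + s • w₀) = 0 := by simp [ha', hfw₀]
      have k1 := (c3 _ b h1 h2 hb hb').2
      -- Adding the anisotropic vector itself to `b` leaves `S(e,·,f,·)` unchanged by skewness but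
      -- changes the factor `g` by a nonzero amount.
      have k2 := (c3 _ (b + (a + s • w₀)) h1 h2 (by rw [map_add, hb, h1, add_zero])
        (by rw [map_add, hb', h2, add_zero])).2
      rw [h.add₄, c0 _ h1 h2, map_add] at k2
      refine (mul_eq_zero.1 ?_).resolve_left hs0
      linarith
  have dec : ∀ x, ∃ (a b : ℝ) (w : E), x = a • e + b • f + w ∧ g e w = 0 ∧ g f w = 0 := by
    intro x
    refine ⟨g f x, g e x, x - g f x • e - g e x • f, by abel, ?_, ?_⟩
    · simp [hee, hef]
    · simp [hff, hfe]
  refine h.eq_zero_of_sectional (fun x y => ?_) x y z u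
  obtain ⟨a, b, w, rfl, hw, hw'⟩ := dec x
  obtain ⟨c, d, v, rfl, hv, hv'⟩ := dec y
  have hwv : g e (w + v) = 0 := by simp [hw, hv]
  have hwv' : g f (w + v) = 0 := by simp [hw', hv']
  have j1 := e2 _ hw hw'
  have j2 := f2 _ hw hw'
  have j3 := e2 _ hv hv'
  have j4 := f2 _ hv hv'
  have k1 := e1 _ hw hw'
  have k2 := e1 _ hv hv'
  have m1 := e3 w w v hw hw' hw hw' hv hv'
  have m2 := e3 v w v hv hv' hw hw' hv hv'
  have o1 := c4 w w hw hw' hw hw'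
  have o2 := c4 w v hw hw' hv hv'
  have o3 := c4 v w hv hv' hw hw'
  have o4 := c4 v v hv hv' hv hv'
  have p1 := c2 w v hw hw' hv hv'
  rw [o2, mul_zero] at p1
  have q1 := (c3 w v hw hw' hv hv').1
  have fe : ∀ z u, S f e z u = - S e f z u := h.anti₁ f e
  have we : ∀ z u, S w e z u = - S e w z u := h.anti₁ w e
  have wf : ∀ z u, S w f z u = - S f w z u := h.anti₁ w f
  have fe' : ∀ z u, S z u f e = - S z u e f := fun z u => h.anti₂ z u f e
  have ve' : ∀ z u, S z u v e = - S z u e v := fun z u => h.anti₂ z u v e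
  have vf' : ∀ z u, S z u v f = - S z u f v := fun z u => h.anti₂ z u v f
  have vw' : ∀ z u, S z u v w = - S z u w v := fun z u => h.anti₂ z u v w
  simp only [h.add₁, h.add₂, h.add₃, h.add₄, h.smul₁, h.smul₂, h.smul₃, h.smul₄, h.self₁, h.self₂,
    fe, we, wf, fe', ve', vf', vw']
  simp only [h.pair f w e w, h.pair f w e v, h.pair f v e w, h.pair f v e v, h.pair w v e w,
    h.pair w v e v, h.pair w v f w, h.pair w v f v, h.pair w v e f, h.pair f w e f, h.pair f v e f,
    h.pair e f e w, h.pair e f e v, h.pair e v e w, h.pair f v f w]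
   
  have r1 : S e w e v = 0 := by
    have := e2 _ hwv hwv'
    rw [h.add₂, h.add₄, h.add₄, j1, j3, h.pair e v e w] at this
    linarith
  have r2 : S f w f v = 0 := by
    have := f2 _ hwv hwv'
    rw [h.add₂, h.add₄, h.add₄, j2, j4, h.pair f v f w] at this
    linarith
  have l3 : S e f f w = 0 := by rw [h.pair, h.anti₂, f1 _ hw' hw, neg_zero]
  have l4 : S e f f v = 0 := by rw [h.pair, h.anti₂, f1 _ hv' hv, neg_zero]
  have n3 := f3 w w v hw' hw hw' hw hv' hv
  have n4 := f3 v w v hv' hv hw' hw hv' hv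
  simp only [r1, r2, h0, j1, j2, j3, j4, k1, k2, l3, l4, m1, m2, n3, n4, o1, o2, o3, o4, p1, q1]
  ring

/-- A curvature-like tensor that vanishes on the isotropic planes is that of a space of constant
curvature. -/
theorem exists_eq_smul_of_isotropic {T : E → E → E → E → ℝ} (h : IsCurvatureLike T)
    (hs : ∀ u v, g u v = g v u) (hn : ∀ u, (∀ v, g u v = 0) → u = 0)
    (hd : 3 ≤ Module.finrank ℝ E) {e : E} (he : e ≠ 0) (hee : g e e = 0)
    (hT : ∀ x y, x ≠ 0 → g x x = 0 → g x y = 0 → g y y ≠ 0 → T x y y x = 0) :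
    ∃ c : ℝ, ∀ x y z u, T x y z u = c * (g x u * g y z - g x z * g y u) := by
  -- Totally isotropic planes are not weakly degenerate; they are reached as limits along an
  -- anisotropic `w₀` orthogonal to `x`.
  have hT' : ∀ x y, g x x = 0 → g x y = 0 → T x y y x = 0 := by
    intro x y hxx hxy
    by_cases hx : x = 0
    · subst hx
      have := h.smul₁ 0 0 y y 0
      simpa using this
    · obtain ⟨-, w₀, -, -, hw, -, hw₀⟩ := exists_hyperbolic hs hn hd hx hxx
      refine eq_zero_of_eq_zero_of_anisotropic (g := g) (w := y) (h := fun y => T x y y x) hw₀ ?_ ?_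
      · simp only [h.add₂, h.smul₂, h.add₃, h.smul₃]; fun_prop
      · exact fun s hs0 => hT x _ hx hxx (by simp [hxy, hw]) hs0
  obtain ⟨f, w₀, hff, hef, hew, hfw, hw₀⟩ := exists_hyperbolic hs hn hd he hee
  -- The model tensor takes the value one on `(e, f, e, f)`.
  refine ⟨T e f e f, fun x y z u => ?_⟩
  have := eq_zero_of_isotropic (h.sub (isCurvatureLike_of_form hs) 1 (T e f e f)) hs
    (fun x y hx hy => by rw [hT' x y hx hy, hx, hy]; ring) hee hff hef hew hfw hw₀
    (by rw [hs f e, hef, hee]; ring) x y z u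
  linarith

end IsotropicPlanes

/-! ### From the limit of curvature quotients to a tensor identity. -/

section CurvatureRatio

theorem IsCurvatureLike.analytic_line {E : Type*} [AddCommGroup E] [Module ℝ E]
    {S : E → E → E → E → ℝ} (h : IsCurvatureLike S) (x y a b : E) :
    AnalyticOnNhd ℝ (fun s : ℝ => S (x + s • a) (y + s • b) (y + s • b) (x + s • a)) univ := by
  intro s _
  simp only [h.add₁, h.add₂, h.add₃, h.add₄, h.smul₁, h.smul₂, h.smul₃, h.smul₄]
  fun_prop

theorem IsCurvatureLike.continuous_line {E : Type*} [AddCommGroup E] [Module ℝ E]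
    {S : E → E → E → E → ℝ} (h : IsCurvatureLike S) (x y a b : E) :
    Continuous (fun s : ℝ => S (x + s • a) (y + s • b) (y + s • b) (x + s • a)) :=
  continuousOn_univ.1 (h.analytic_line x y a b).continuousOn

/-- Along a line the expression is a polynomial that does not vanish at parameter one, so its zeros
are isolated. This provides admissible planes near any given pair. -/
theorem IsCurvatureLike.eventually_ne_zero {E : Type*} [AddCommGroup E] [Module ℝ E]
    {S : E → E → E → E → ℝ} (h : IsCurvatureLike S) (x y : E) {x₁ y₁ : E}
    (h1 : S x₁ y₁ y₁ x₁ ≠ 0) (s₀ : ℝ) :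
    ∀ᶠ s in 𝓝[≠] s₀, S (x + s • (x₁ - x)) (y + s • (y₁ - y)) (y + s • (y₁ - y))
      (x + s • (x₁ - x)) ≠ 0 := by
  by_contra hcon
  have := (h.analytic_line x y (x₁ - x) (y₁ - y)).eqOn_zero_of_preconnected_of_frequently_eq_zero
    isPreconnected_univ (mem_univ s₀)
    ((not_eventually.1 hcon).mono fun s hs => not_not.1 hs) (mem_univ 1)
  simp at this
  exact h1 this

variable {E : Type*} [NormedAddCommGroup E] [NormedSpace ℝ E]

/-- Where the quotient of two sectional curvatures tends to one, the numerators agree. -/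
theorem IsCurvatureLike.eq_of_tendsto_ratio {R R' B : E → E → E → E → ℝ} (hR : IsCurvatureLike R)
    (hR' : IsCurvatureLike R') (hB : IsCurvatureLike B) {x₁ y₁ x₂ y₂ x y : E} {c : ℝ} (hc : c ≠ 0)
    (h1 : R x₁ y₁ y₁ x₁ ≠ 0) (h2 : B x₂ y₂ y₂ x₂ ≠ 0)
    (h : Tendsto (fun w : E × E => R' w.1 w.2 w.2 w.1 / (c * B w.1 w.2 w.2 w.1)
        / (R w.1 w.2 w.2 w.1 / B w.1 w.2 w.2 w.1))
      (𝓝 (x, y) ⊓ 𝓟 {w | B w.1 w.2 w.2 w.1 ≠ 0 ∧ R w.1 w.2 w.2 w.1 ≠ 0}) (𝓝 1)) :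
    R' x y y x = c * R x y y x := by
  -- Moving slightly from `(x₂, y₂)` towards `(x₁, y₁)` keeps `B` nonzero by continuity and makes
  -- `R` nonzero.
  obtain ⟨x₃, y₃, h3, h4⟩ : ∃ x₃ y₃, R x₃ y₃ y₃ x₃ ≠ 0 ∧ B x₃ y₃ y₃ x₃ ≠ 0 := by
    obtain ⟨s, hs⟩ := ((hR.eventually_ne_zero x₂ y₂ h1 0).and
      ((((hB.continuous_line x₂ y₂ (x₁ - x₂) (y₁ - y₂)).tendsto 0).mono_left
        nhdsWithin_le_nhds).eventually_ne (b₂ := 0) (by simpa using h2))).exists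
    exact ⟨_, _, hs.1, hs.2⟩
  have hp : Tendsto (fun s : ℝ => (x + s • (x₃ - x), y + s • (y₃ - y))) (𝓝[≠] 0)
      (𝓝 (x, y) ⊓ 𝓟 {w | B w.1 w.2 w.2 w.1 ≠ 0 ∧ R w.1 w.2 w.2 w.1 ≠ 0}) := by
    refine tendsto_inf.2 ⟨?_, tendsto_principal.2 ((hB.eventually_ne_zero x y h4 0).and
      (hR.eventually_ne_zero x y h3 0))⟩
    have : Continuous fun s : ℝ => (x + s • (x₃ - x), y + s • (y₃ - y)) := by fun_prop
    simpa using (this.tendsto 0).mono_left (nhdsWithin_le_nhds (s := {0}ᶜ))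
  have k1 := h.comp hp
  have k2 : Tendsto _ (𝓝[≠] (0 : ℝ)) _ :=
    ((hR.continuous_line x y (x₃ - x) (y₃ - y)).tendsto 0).mono_left nhdsWithin_le_nhds
  have k3 : Tendsto _ (𝓝[≠] (0 : ℝ)) _ :=
    ((hR'.continuous_line x y (x₃ - x) (y₃ - y)).tendsto 0).mono_left nhdsWithin_le_nhds
  -- Off the zeros `R'` is `c` times the quotient times `R`, since the factors `B` cancel; both
  -- sides then have limits.
  have k4 := (k1.const_mul c).mul k2
  simp only [zero_smul, add_zero, mul_one] at k3 k4
  refine tendsto_nhds_unique k3 (k4.congr' ?_)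
  filter_upwards [hp.eventually (mem_inf_of_right (mem_principal_self _))] with s hs
  obtain ⟨hs1, hs2⟩ := hs
  simp only [Function.comp] at hs1 hs2 ⊢
  field_simp

/-- `R' - c R` vanishes on weakly degenerate planes, hence is a multiple of the constant curvature
tensor. The hypothesis `h1` guarantees that the quotient is defined somewhere, so that the limit is
not vacuous. -/
theorem exists_eq_of_tendsto_ratio [FiniteDimensional ℝ E] {g : E →L[ℝ] E →L[ℝ] ℝ}
    {R R' : E → E → E → E → ℝ}
    (hs : ∀ u v, g u v = g v u) (hn : ∀ u, (∀ v, g u v = 0) → u = 0)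
    (hd : 3 ≤ Module.finrank ℝ E) {e : E} (he : e ≠ 0) (hee : g e e = 0)
    (hR : IsCurvatureLike R) (hR' : IsCurvatureLike R') {c : ℝ} (hc : c ≠ 0)
    (h1 : ∃ x y z u, R x y z u ≠ 0)
    (h : ∀ x y, x ≠ 0 → g x x = 0 → g x y = 0 → g y y ≠ 0 →
      Tendsto (fun w : E × E =>
        R' w.1 w.2 w.2 w.1 / (c * (g w.1 w.1 * g w.2 w.2 - g w.1 w.2 * g w.2 w.1))
        / (R w.1 w.2 w.2 w.1 / (g w.1 w.1 * g w.2 w.2 - g w.1 w.2 * g w.2 w.1)))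
      (𝓝 (x, y) ⊓ 𝓟 {w | g w.1 w.1 * g w.2 w.2 - g w.1 w.2 * g w.2 w.1 ≠ 0 ∧
        R w.1 w.2 w.2 w.1 ≠ 0}) (𝓝 1)) :
    ∃ k, ∀ x y z u, R' x y z u = c * R x y z u + k * (g x u * g y z - g x z * g y u) := by
  let g' : E →ₗ[ℝ] E →ₗ[ℝ] ℝ := (ContinuousLinearMap.coeLM ℝ).comp (g : E →ₗ[ℝ] E →L[ℝ] ℝ)
  have hB : IsCurvatureLike fun x y z u => g x u * g y z - g x z * g y u :=
    isCurvatureLike_of_form (g := g') hs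
  obtain ⟨x₁, y₁, h1⟩ : ∃ x y, R x y y x ≠ 0 := by
    by_contra hcon
    push Not at hcon
    obtain ⟨x, y, z, u, h1⟩ := h1
    exact h1 (hR.eq_zero_of_sectional hcon x y z u)
  obtain ⟨f, -, hff, hef, -, -, -⟩ := exists_hyperbolic (g := g') hs hn hd he hee
  have h2 : g e e * g f f - g e f * g f e ≠ 0 := by
    have e1 : g e f = 1 := hef
    rw [hs f e, hee, e1]; simp
  obtain ⟨k, hk⟩ := exists_eq_smul_of_isotropic (g := g') (hR'.sub hR 1 c) hs hn hd he hee
    (fun x y hx hxx hxy hyy => by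
      have := hR.eq_of_tendsto_ratio hR' hB hc h1 h2 (h x y hx hxx hxy hyy)
      rw [this]; ring)
  refine ⟨k, fun x y z u => ?_⟩
  have : 1 * R' x y z u - c * R x y z u = k * (g x u * g y z - g x z * g y u) := hk x y z u
  linarith

end CurvatureRatio

/-! ### Divisibility of double forms by a covector. -/

section Pointwise

variable {E : Type*} [NormedAddCommGroup E] [NormedSpace ℝ E] [FiniteDimensional ℝ E]
  {g : E →L[ℝ] E →L[ℝ] ℝ}

/-- If `ν ∧ g` is divisible by `w`, then `ν` is a multiple of `w`. -/
theorem exists_eq_of_wedge (hn : ∀ u, (∀ v, g u v = 0) → u = 0)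
    (hd : 3 ≤ Module.finrank ℝ E) {w ν : E →L[ℝ] ℝ} {a : E} (ha : w a = 1)
    {Q : E → E → ℝ}
    (h : ∀ x u v, w x * Q u v - w u * Q x v = ν x * g u v - ν u * g x v) :
    (∀ x, ν x = ν a * w x) ∧ ∀ u v, Q u v = ν a * g u v + w u * (Q a v - ν a * g a v) := by
  -- Otherwise every vector of `ker w` is a multiple of `x`, and the dimension is at most two.
  have hker : ∀ x, w x = 0 → ν x = 0 := by
    intro x hx
    by_contra hνx
    have hspan : ∀ u, w u = 0 → u = (ν u / ν x) • x := by
      intro u hu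
      refine sub_eq_zero.1 (hn _ fun v => ?_)
      have := h x u v
      rw [hx, hu] at this
      simp only [map_sub, map_smul, sub_apply, smul_apply, smul_eq_mul]
      field_simp
      linarith
    have htop : (⊤ : Submodule ℝ E) ≤ Submodule.span ℝ (Set.range ![a, x]) := by
      intro u _
      have h1 := hspan (u - w u • a) (by simp [ha])
      rw [sub_eq_iff_eq_add] at h1
      rw [h1]
      exact Submodule.add_mem _ (Submodule.smul_mem _ _ (Submodule.subset_span ⟨1, rfl⟩))
        (Submodule.smul_mem _ _ (Submodule.subset_span ⟨0, rfl⟩))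
    have h2 := finrank_range_le_card (R := ℝ) (b := ![a, x])
    rw [Set.finrank, top_le_iff.1 htop, finrank_top] at h2
    simp at h2
    omega
  have hν : ∀ x, ν x = ν a * w x := by
    intro x
    have := hker (x - w x • a) (by simp [ha])
    simp at this
    linarith
  refine ⟨hν, fun u v => ?_⟩
  have := h a u v
  rw [hν u, ha] at this
  linarith

/-- A form `θ` with `θ ∧ g = (w ∧ η) ⊗ w` vanishes, and `η` is a multiple of `w`. -/
theorem eq_zero_of_wedge (hn : ∀ u, (∀ v, g u v = 0) → u = 0)
    (hd : 3 ≤ Module.finrank ℝ E) {w θ η : E →L[ℝ] ℝ} {a : E} (ha : w a = 1)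
    (h : ∀ x u v, w x * (η u * w v) - w u * (η x * w v) = θ x * g u v - θ u * g x v) :
    (∀ x, θ x = 0) ∧ ∀ x, η x = η a * w x := by
  obtain ⟨h1, h2⟩ := exists_eq_of_wedge hn hd ha h
  -- Otherwise `ker w` is spanned by the vector dual to `w`, and again the dimension is at most two.
  have hθ : θ a = 0 := by
    by_contra hθ
    have hspan : ∀ u, w u = 0 → u = (η u / θ a) • g.inverse w := by
      intro u hu
      refine eq_of_forall_apply hn fun v => ?_
      have := h2 u v
      rw [hu] at this
      simp only [map_smul, smul_apply, smul_eq_mul, apply_inverse hn]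
      field_simp
      linarith
    have htop : (⊤ : Submodule ℝ E) ≤ Submodule.span ℝ (Set.range ![a, g.inverse w]) := by
      intro u _
      have h1 := hspan (u - w u • a) (by simp [ha])
      rw [sub_eq_iff_eq_add] at h1
      rw [h1]
      exact Submodule.add_mem _ (Submodule.smul_mem _ _ (Submodule.subset_span ⟨1, rfl⟩))
        (Submodule.smul_mem _ _ (Submodule.subset_span ⟨0, rfl⟩))
    have h2 := finrank_range_le_card (R := ℝ) (b := ![a, g.inverse w])
    rw [Set.finrank, top_le_iff.1 htop, finrank_top] at h2
    simp at h2
    omega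
  refine ⟨fun x => by rw [h1, hθ, zero_mul], fun x => ?_⟩
  have := h2 x a
  rw [hθ, ha] at this
  linarith

end Pointwise

/-! ### The curvature form is an algebraic curvature tensor. -/

section LocalCurvature

variable {E : Type*} [NormedAddCommGroup E] [NormedSpace ℝ E] [FiniteDimensional ℝ E]
  {G : E → E →L[ℝ] E →L[ℝ] ℝ} {U : Set E}

theorem IsMetricOn.isCurvatureLike (hG : IsMetricOn G U) {p : E} (hy : p ∈ U) :
    IsCurvatureLike (curvatureForm G p) := by
  refine ⟨fun x x' y z u => ?_, fun c x y z u => ?_, fun x y z u => ?_, fun x y z u => ?_,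
    fun x y z u => ?_⟩ <;> simp only [hG.curvatureForm_eq hy]
  · simp [curvEnd_add_left]
  · simp [curvEnd_smul_left]
  · rw [curvEnd_antisymm]; simp
  · exact hG.curvature_skew hy x y z u
  · have := congrArg (fun v => G p v u) (hG.bianchi_first hy x y z)
    simpa using this

end LocalCurvature

/-! ### The equation linking the Schouten form to the conformal factor. -/

section ConformalFactor

variable {E : Type*} [NormedAddCommGroup E] [NormedSpace ℝ E] [FiniteDimensional ℝ E]
  {G P : E → E →L[ℝ] E →L[ℝ] ℝ} {U : Set E} {σ lam κ τ : E → ℝ}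

/-- The auxiliary Euclidean gradient `∑ w(bᵢ) bᵢ` is normalized; the gradient for the metric could
be isotropic. -/
theorem exists_smooth_section {w : E → E →L[ℝ] ℝ} (hw : ContDiffOn ℝ ∞ w U)
    (h : ∀ y ∈ U, w y ≠ 0) : ∃ a : E → E, ContDiffOn ℝ ∞ a U ∧ ∀ y ∈ U, w y (a y) = 1 := by
  set b := Module.finBasis ℝ E
  have h0 : ∀ y ∈ U, ∑ i, w y (b i) ^ 2 ≠ 0 := by
    intro y hy h0
    rw [Finset.sum_eq_zero_iff_of_nonneg fun i _ => sq_nonneg _] at h0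
    refine h y hy (ContinuousLinearMap.coe_inj.1 (b.ext fun i => ?_))
    simpa using h0 i (Finset.mem_univ i)
  have hi : ∀ i, ContDiffOn ℝ ∞ (fun y => w y (b i)) U := fun i => hw.clm_apply contDiffOn_const
  refine ⟨fun y => (∑ i, w y (b i) ^ 2)⁻¹ • ∑ i, w y (b i) • b i, ?_, fun y hy => ?_⟩
  · exact ((ContDiffOn.sum fun i _ => (hi i).pow 2).inv h0).smul
      (ContDiffOn.sum fun i _ => (hi i).smul contDiffOn_const)
  · simp only [map_smul, map_sum, smul_eq_mul, ← pow_two]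
    exact inv_mul_cancel₀ (h0 y hy)

/-- The Schouten form `P` satisfies `(e^{2σ} - 1) P = - Hess σ + dσ ⊗ dσ + λ G`. -/
def SchoutenRelation (G P : E → E →L[ℝ] E →L[ℝ] ℝ) (σ lam : E → ℝ) (U : Set E) : Prop :=
  ∀ y ∈ U, ∀ u v, (Real.exp (2 * σ y) - 1) * P y u v =
    - hessian G σ y u v + fderiv ℝ σ y u * fderiv ℝ σ y v + lam y * G y u v

/-- The trace of the relation expresses `lam`, chosen only pointwise, through smooth quantities. -/
theorem SchoutenRelation.smooth (h : SchoutenRelation G P σ lam U) (hG : IsMetricOn G U)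
    (hσ : ContDiffOn ℝ ∞ σ U) (hP : ContDiffOn ℝ ∞ P U) (hd : Module.finrank ℝ E ≠ 0) :
    ContDiffOn ℝ ∞ lam U := by
  set b := Module.finBasis ℝ E
  have hw := smooth_fderiv hG.isOpen hσ
  have hsm : ContDiffOn ℝ ∞ (fun y => (Module.finrank ℝ E : ℝ)⁻¹ * ∑ i,
      ((Real.exp (2 * σ y) - 1) * P y (dualVec (G y) i) (b i)
        + hessian G σ y (dualVec (G y) i) (b i)
        - fderiv ℝ σ y (dualVec (G y) i) * fderiv ℝ σ y (b i))) U := by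
    refine contDiffOn_const.mul (ContDiffOn.sum fun i _ => ?_)
    have hdv := hG.smooth_dualVec i
    exact ((((Real.contDiff_exp.comp_contDiffOn (contDiffOn_const.mul hσ)).sub
      contDiffOn_const).mul ((hP.clm_apply hdv).clm_apply contDiffOn_const)).add
      (((hG.smooth_hessian hσ).clm_apply hdv).clm_apply contDiffOn_const)).sub
      ((hw.clm_apply hdv).mul (hw.clm_apply contDiffOn_const))
  refine hsm.congr fun y hy => ?_
  have : ∀ i, (Real.exp (2 * σ y) - 1) * P y (dualVec (G y) i) (b i)
        + hessian G σ y (dualVec (G y) i) (b i)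
        - fderiv ℝ σ y (dualVec (G y) i) * fderiv ℝ σ y (b i)
      = lam y * G y (dualVec (G y) i) (b i) := fun i => by rw [h y hy]; ring
  rw [Finset.sum_congr rfl fun i _ => this i, ← Finset.mul_sum, sum_basis_dualVec (hG.nondeg y hy)]
  have : (Module.finrank ℝ E : ℝ) ≠ 0 := by exact_mod_cast hd
  field_simp

theorem SchoutenRelation.covBil_add_eq_zero (h : SchoutenRelation G P σ lam U) (hG : IsMetricOn G U)
    (hσ : ContDiffOn ℝ ∞ σ U) (hP : ContDiffOn ℝ ∞ P U) (hl : ContDiffOn ℝ ∞ lam U)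
    {y : E} (hy : y ∈ U) (a u v : E) :
    2 * Real.exp (2 * σ y) * fderiv ℝ σ y a * P y u v
      + (Real.exp (2 * σ y) - 1) * covBil G P y a u v
      + covBil G (hessian G σ) y a u v
      - hessian G σ y a u * fderiv ℝ σ y v - fderiv ℝ σ y u * hessian G σ y a v
      - fderiv ℝ lam y a * G y u v = 0 := by
  have dσ := (differentiableAt_of_smooth hG.isOpen hσ hy).hasFDerivAt
  have dw := differentiableAt_of_smooth hG.isOpen (smooth_fderiv hG.isOpen hσ) hy
  have dH := differentiableAt_of_smooth hG.isOpen (hG.smooth_hessian hσ) hy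
  have dP := differentiableAt_of_smooth hG.isOpen hP hy
  have dl := (differentiableAt_of_smooth hG.isOpen hl hy).hasFDerivAt
  have k : HasFDerivAt (fun z => (Real.exp (2 * σ z) - 1) * P z u v + hessian G σ z u v
      - fderiv ℝ σ z u * fderiv ℝ σ z v - lam z * G z u v) _ y :=
    ((((((dσ.const_mul 2).exp).sub_const 1).mul (hasFDerivAt_apply₂ dP u v)).add
      (hasFDerivAt_apply₂ dH u v)).sub
      ((hasFDerivAt_apply₁ dw u).mul (hasFDerivAt_apply₁ dw v))).sub
      (dl.mul (hasFDerivAt_apply₂ (hG.differentiableAt hy) u v))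
  have k0 : HasFDerivAt (fun z => (Real.exp (2 * σ z) - 1) * P z u v + hessian G σ z u v
      - fderiv ℝ σ z u * fderiv ℝ σ z v - lam z * G z u v) (0 : E →L[ℝ] ℝ) y := by
    refine (hasFDerivAt_const (0 : ℝ) y).congr_of_eventuallyEq ?_
    filter_upwards [hG.isOpen.mem_nhds hy] with z hz
    rw [h z hz]; ring
  have k1 := congrArg (fun l => l a) (k.unique k0)
  simp only [add_apply, sub_apply, smul_apply, smul_eq_mul, ContinuousLinearMap.flip_apply,
    zero_apply] at k1
  have r1 := h y hy (leviCivita G y a u) v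
  have r2 := h y hy u (leviCivita G y a v)
  have hGd := hG.fderiv_eq hy a u v
  unfold covBil
  rw [hessian_apply (y := y) σ a u, hessian_apply (y := y) σ a v]
  linear_combination k1 - r1 - r2 + lam y * hGd

/-- Skew part of the differentiated relation: the Codazzi equation removes `∇P`, the Ricci identity
turns `∇ Hess σ` into a curvature term, and `R = φ(P)` evaluates that term. -/
theorem SchoutenRelation.wedge (h : SchoutenRelation G P σ lam U) (hG : IsMetricOn G U)
    (hσ : ContDiffOn ℝ ∞ σ U) (hP : IsSchoutenOn G P U) (hl : ContDiffOn ℝ ∞ lam U)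
    {y : E} (hy : y ∈ U) (a u v : E) :
    Real.exp (2 * σ y) * (fderiv ℝ σ y a * P y u v - fderiv ℝ σ y u * P y a v) =
      (P y a (gradient G σ y) + fderiv ℝ lam y a - lam y * fderiv ℝ σ y a) * G y u v
      - (P y u (gradient G σ y) + fderiv ℝ lam y u - lam y * fderiv ℝ σ y u) * G y a v := by
  have e1 := h.covBil_add_eq_zero hG hσ hP.smooth hl hy a u v
  have e2 := h.covBil_add_eq_zero hG hσ hP.smooth hl hy u a v
  have e3 := hG.covBil_hessian hσ hy a u v
  have e4 := hP.codazzi y hy a u v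
  have e5 := hP.curvature y hy a u v (gradient G σ y)
  rw [hG.curvatureForm_eq hy, hG.symm y hy, hG.apply_gradient σ hy] at e5
  unfold kn at e5
  have e6 : ∀ x, G y x (gradient G σ y) = fderiv ℝ σ y x := fun x => by
    rw [hG.symm y hy, hG.apply_gradient σ hy]
  rw [e6, e6] at e5
  have e7 := h y hy a v
  have e8 := h y hy u v
  have e9 := hG.hessian_symm hσ hy a u
  linear_combination e1 - e2 - e3 - (Real.exp (2 * σ y) - 1) * e4 + e5
    + fderiv ℝ σ y u * e7 - fderiv ℝ σ y a * e8 + fderiv ℝ σ y v * e9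

/-- The identity `dσ ∧ P = ν ∧ g` is solved by `exists_eq_of_wedge`; evaluating on a smooth field
`a` with `dσ(a) = 1` makes the coefficients smooth. -/
theorem SchoutenRelation.exists_eq (h : SchoutenRelation G P σ lam U) (hG : IsMetricOn G U)
    (hσ : ContDiffOn ℝ ∞ σ U) (hw : ∀ y ∈ U, fderiv ℝ σ y ≠ 0) (hP : IsSchoutenOn G P U)
    (hl : ContDiffOn ℝ ∞ lam U) (hd : 3 ≤ Module.finrank ℝ E) :
    ∃ κ τ : E → ℝ, ContDiffOn ℝ ∞ κ U ∧ ContDiffOn ℝ ∞ τ U ∧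
      (∀ y ∈ U, ∀ u v,
        P y u v = κ y * G y u v + τ y * (fderiv ℝ σ y u * fderiv ℝ σ y v)) ∧
      ∀ y ∈ U, ∀ x, Real.exp (2 * σ y) * κ y * fderiv ℝ σ y x =
        P y x (gradient G σ y) + fderiv ℝ lam y x - lam y * fderiv ℝ σ y x := by
  have hws := smooth_fderiv hG.isOpen hσ
  have hls := smooth_fderiv hG.isOpen hl
  obtain ⟨a, ha, ha1⟩ := exists_smooth_section hws hw
  let ν : E → E →L[ℝ] ℝ := fun y => (Real.exp (2 * σ y))⁻¹ •
    ((P y).flip (gradient G σ y) + fderiv ℝ lam y - lam y • fderiv ℝ σ y)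
  have hν : ∀ y x, ν y x = (Real.exp (2 * σ y))⁻¹ *
      (P y x (gradient G σ y) + fderiv ℝ lam y x - lam y * fderiv ℝ σ y x) := fun y x => rfl
  have key : ∀ y ∈ U, ∀ x u v, fderiv ℝ σ y x * P y u v - fderiv ℝ σ y u * P y x v =
      ν y x * G y u v - ν y u * G y x v := by
    intro y hy x u v
    have := h.wedge hG hσ hP hl hy x u v
    have h0 := Real.exp_ne_zero (2 * σ y)
    rw [hν, hν]
    field_simp
    linear_combination this
  have hPa := hP.smooth.clm_apply ha
  have hκ : ContDiffOn ℝ ∞ (fun y => ν y (a y)) U := by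
    simp only [hν]
    exact ((Real.contDiff_exp.comp_contDiffOn (contDiffOn_const.mul hσ)).inv
      fun y _ => Real.exp_ne_zero _).mul (((hPa.clm_apply (hG.smooth_gradient hσ)).add
      (hls.clm_apply ha)).sub (hl.mul (hws.clm_apply ha)))
  refine ⟨fun y => ν y (a y), fun y => P y (a y) (a y) - ν y (a y) * G y (a y) (a y), hκ,
    (hPa.clm_apply ha).sub (hκ.mul ((hG.smooth.clm_apply ha).clm_apply ha)), ?_, ?_⟩
  · intro y hy u v
    have k := (exists_eq_of_wedge (hG.nondeg y hy) hd (ha1 y hy)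
      (Q := fun u v => P y u v) (key y hy)).2
    have k1 := k u v
    have k2 := k v (a y)
    rw [hP.symm y hy (a y) v, k2, hG.symm y hy v] at k1
    rw [k1]; ring
  · intro y hy x
    have k := (exists_eq_of_wedge (hG.nondeg y hy) hd (ha1 y hy)
      (Q := fun u v => P y u v) (key y hy)).1 x
    have h0 := Real.exp_ne_zero (2 * σ y)
    rw [mul_assoc, ← k, hν]
    field_simp

/-- The Codazzi equation of `κ G + τ dσ ⊗ dσ`, with the Hessian replaced through the relation, has
the shape required by `eq_zero_of_wedge`. -/
theorem SchoutenRelation.fderiv_coeff (h : SchoutenRelation G P σ lam U) (hG : IsMetricOn G U)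
    (hσ : ContDiffOn ℝ ∞ σ U) (hw : ∀ y ∈ U, fderiv ℝ σ y ≠ 0) (hP : IsSchoutenOn G P U)
    (hd : 3 ≤ Module.finrank ℝ E) (hκ : ContDiffOn ℝ ∞ κ U) (hτ : ContDiffOn ℝ ∞ τ U)
    (hPe : ∀ y ∈ U, ∀ u v,
      P y u v = κ y * G y u v + τ y * (fderiv ℝ σ y u * fderiv ℝ σ y v))
    {y : E} (hy : y ∈ U) :
    (∀ a u v, covBil G P y a u v = fderiv ℝ κ y a * G y u v
      + fderiv ℝ τ y a * (fderiv ℝ σ y u * fderiv ℝ σ y v)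
      + τ y * (hessian G σ y a u * fderiv ℝ σ y v + fderiv ℝ σ y u * hessian G σ y a v)) ∧
    (∀ x, fderiv ℝ κ y x =
      τ y * (lam y - (Real.exp (2 * σ y) - 1) * κ y) * fderiv ℝ σ y x) ∧
    ∃ k : ℝ, ∀ x, fderiv ℝ τ y x = k * fderiv ℝ σ y x := by
  have dw := differentiableAt_of_smooth hG.isOpen (smooth_fderiv hG.isOpen hσ) hy
  have dP := differentiableAt_of_smooth hG.isOpen hP.smooth hy
  have dκ := (differentiableAt_of_smooth hG.isOpen hκ hy).hasFDerivAt
  have dτ := (differentiableAt_of_smooth hG.isOpen hτ hy).hasFDerivAt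
  have hcov : ∀ a u v, covBil G P y a u v = fderiv ℝ κ y a * G y u v
      + fderiv ℝ τ y a * (fderiv ℝ σ y u * fderiv ℝ σ y v)
      + τ y * (hessian G σ y a u * fderiv ℝ σ y v + fderiv ℝ σ y u * hessian G σ y a v) := by
    intro a u v
    have k : HasFDerivAt (fun z => κ z * G z u v + τ z * (fderiv ℝ σ z u * fderiv ℝ σ z v)) _ y :=
      (dκ.mul (hasFDerivAt_apply₂ (hG.differentiableAt hy) u v)).add
        (dτ.mul ((hasFDerivAt_apply₁ dw u).mul (hasFDerivAt_apply₁ dw v)))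
    have k0 := (hasFDerivAt_apply₂ dP u v).congr_of_eventuallyEq (f₁ := fun z =>
      κ z * G z u v + τ z * (fderiv ℝ σ z u * fderiv ℝ σ z v)) (by
        filter_upwards [hG.isOpen.mem_nhds hy] with z hz using (hPe z hz u v).symm)
    have k1 := congrArg (fun l => l a) (k.unique k0)
    simp only [add_apply, smul_apply, smul_eq_mul, ContinuousLinearMap.flip_apply] at k1
    have hGd := hG.fderiv_eq hy a u v
    unfold covBil
    rw [hessian_apply (y := y) σ a u, hessian_apply (y := y) σ a v, hPe y hy, hPe y hy]
    linear_combination -k1 + κ y * hGd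
  obtain ⟨a, ha⟩ : ∃ a, fderiv ℝ σ y a = 1 := by
    obtain ⟨a, ha⟩ : ∃ a, fderiv ℝ σ y a ≠ 0 := by
      by_contra hcon
      push Not at hcon
      exact hw y hy (ContinuousLinearMap.ext hcon)
    exact ⟨(fderiv ℝ σ y a)⁻¹ • a, by simp [ha]⟩
  obtain ⟨k1, k2⟩ := eq_zero_of_wedge (hG.nondeg y hy) hd ha
    (θ := fderiv ℝ κ y - (τ y * (lam y - (Real.exp (2 * σ y) - 1) * κ y)) • fderiv ℝ σ y)
    (η := fderiv ℝ τ y) (fun x u v => by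
      have c1 := hP.codazzi y hy x u v
      rw [hcov, hcov, hG.hessian_symm hσ hy u x] at c1
      have e7 := h y hy x v
      have e8 := h y hy u v
      rw [hPe y hy] at e7 e8
      simp only [sub_apply, smul_apply, smul_eq_mul]
      linear_combination -c1 + τ y * fderiv ℝ σ y u * e7 - τ y * fderiv ℝ σ y x * e8)
  refine ⟨hcov, fun x => ?_, _, k2⟩
  have := k1 x
  simp only [sub_apply, smul_apply, smul_eq_mul] at this
  linarith

/-- The case of an isotropic gradient. -/
theorem SchoutenRelation.isotropic (h : SchoutenRelation G P σ lam U) (hG : IsMetricOn G U)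
    (hσ : ContDiffOn ℝ ∞ σ U) (hw : ∀ y ∈ U, fderiv ℝ σ y ≠ 0) (hP : IsSchoutenOn G P U)
    (hl : ContDiffOn ℝ ∞ lam U) (hd : 3 ≤ Module.finrank ℝ E)
    (hN : ∀ y ∈ U, G y (gradient G σ y) (gradient G σ y) = 0) :
    ∃ τ : E → ℝ, ContDiffOn ℝ ∞ τ U ∧ ∀ y ∈ U,
      (∀ u v, P y u v = τ y * (fderiv ℝ σ y u * fderiv ℝ σ y v)) ∧
      (∃ k : ℝ, ∀ x, fderiv ℝ τ y x = k * fderiv ℝ σ y x) ∧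
      ∀ a u v, covBil G P y a u v = (fderiv ℝ τ y a + 2 * τ y *
        (1 - (Real.exp (2 * σ y) - 1) * τ y) * fderiv ℝ σ y a) *
        (fderiv ℝ σ y u * fderiv ℝ σ y v) := by
  obtain ⟨κ, τ, hκ, hτ, hPe, hν⟩ := h.exists_eq hG hσ hw hP hl hd
  have hwN : ∀ y ∈ U, fderiv ℝ σ y (gradient G σ y) = 0 := fun y hy => by
    rw [← hG.apply_gradient σ hy, hN y hy]
  have hxN : ∀ y ∈ U, ∀ x, G y x (gradient G σ y) = fderiv ℝ σ y x := fun y hy x => by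
    rw [hG.symm y hy, hG.apply_gradient σ hy]
  -- Since the square of the gradient is constant, `Hess σ(·, ∇σ) = 0`; the relation is evaluated on
  -- `∇σ`.
  have hlam : ∀ y ∈ U, lam y = (Real.exp (2 * σ y) - 1) * κ y := by
    intro y hy
    obtain ⟨a, ha⟩ : ∃ a, fderiv ℝ σ y a ≠ 0 := by
      by_contra hcon
      push Not at hcon
      exact hw y hy (ContinuousLinearMap.ext hcon)
    have k1 := hG.fderiv_gradient_sq hσ hy a
    have k2 : fderiv ℝ (fun z => G z (gradient G σ z) (gradient G σ z)) y = 0 := by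
      rw [Filter.EventuallyEq.fderiv_eq (f := fun _ => (0 : ℝ))]
      · simp
      · filter_upwards [hG.isOpen.mem_nhds hy] with z hz using hN z hz
    rw [k2, zero_apply] at k1
    have k3 := h y hy a (gradient G σ y)
    rw [hPe y hy, hxN y hy, hwN y hy] at k3
    refine mul_right_cancel₀ ha ?_
    linear_combination -k3 - 1 / 2 * k1
  -- By `hlam` and `dκ = 0`, `dλ = 2 e^{2σ} κ dσ`, whereas the second identity of `exists_eq` gives
  -- `dλ = 2 (e^{2σ} - 1) κ dσ`.
  have hκ0 : ∀ y ∈ U, κ y = 0 := by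
    intro y hy
    obtain ⟨a, ha⟩ : ∃ a, fderiv ℝ σ y a ≠ 0 := by
      by_contra hcon
      push Not at hcon
      exact hw y hy (ContinuousLinearMap.ext hcon)
    have dσ := (differentiableAt_of_smooth hG.isOpen hσ hy).hasFDerivAt
    have dκ := (differentiableAt_of_smooth hG.isOpen hκ hy).hasFDerivAt
    have dl := (differentiableAt_of_smooth hG.isOpen hl hy).hasFDerivAt
    have k : HasFDerivAt (fun z => (Real.exp (2 * σ z) - 1) * κ z) _ y :=
      (((dσ.const_mul 2).exp).sub_const 1).mul dκ
    have k1 := congrArg (fun l => l a) (k.unique (dl.congr_of_eventuallyEq (by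
      filter_upwards [hG.isOpen.mem_nhds hy] with z hz using (hlam z hz).symm)))
    have k2 := (h.fderiv_coeff hG hσ hw hP hd hκ hτ hPe hy).2.1 a
    have k3 := hν y hy a
    rw [hPe y hy, hxN y hy, hwN y hy] at k3
    simp only [add_apply, smul_apply, smul_eq_mul] at k1
    have e := hlam y hy
    rw [k2] at k1
    rw [e] at k1 k3
    refine (mul_eq_zero.1 (?_ : κ y * fderiv ℝ σ y a = 0)).resolve_right ha
    linear_combination (-1 / 2 : ℝ) * k3 + 1 / 2 * k1
  refine ⟨τ, hτ, fun y hy => ⟨fun u v => by rw [hPe y hy, hκ0 y hy]; ring,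
    (h.fderiv_coeff hG hσ hw hP hd hκ hτ hPe hy).2.2, fun a u v => ?_⟩⟩
  obtain ⟨k1, k2, -⟩ := h.fderiv_coeff hG hσ hw hP hd hκ hτ hPe hy
  -- With `κ = λ = 0` the relation makes `Hess σ` equal to `(1 - (e^{2σ} - 1) τ) dσ ⊗ dσ`.
  have e1 := h y hy a u
  have e2 := h y hy a v
  rw [hPe y hy, hlam y hy, hκ0 y hy] at e1 e2
  rw [k1, k2, hlam y hy, hκ0 y hy]
  linear_combination (τ y * fderiv ℝ σ y v) * e1 + (τ y * fderiv ℝ σ y u) * e2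

end ConformalFactor

/-! ### Functions of `σ` and the potential of the recurrence form. -/

section FunctionalDependence

variable {E : Type*} [NormedAddCommGroup E] [NormedSpace ℝ E] [FiniteDimensional ℝ E]
  {U : Set E} {σ τ : E → ℝ}

/-- A function whose differential is a multiple of `dσ ≠ 0` is locally a function of `σ`. -/
theorem exists_comp_of_fderiv_proportional (hU : IsOpen U) (hσ : ContDiffOn ℝ ∞ σ U)
    (hτ : ContDiffOn ℝ ∞ τ U) (h : ∀ y ∈ U, ∃ k : ℝ, ∀ x, fderiv ℝ τ y x = k * fderiv ℝ σ y x)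
    {y₀ : E} (hy₀ : y₀ ∈ U) (h0 : fderiv ℝ σ y₀ ≠ 0) :
    ∃ ε > 0, ∃ T : ℝ → ℝ, ContDiffOn ℝ ∞ T (Metric.ball (σ y₀) ε) ∧
      ∀ᶠ y in 𝓝 y₀, σ y ∈ Metric.ball (σ y₀) ε ∧ τ y = T (σ y) := by
  have : CompleteSpace E := FiniteDimensional.complete ℝ E
  obtain ⟨a, ha⟩ : ∃ a, fderiv ℝ σ y₀ a = 1 := by
    obtain ⟨a, ha⟩ : ∃ a, fderiv ℝ σ y₀ a ≠ 0 := by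
      by_contra hcon
      push Not at hcon
      exact h0 (ContinuousLinearMap.ext hcon)
    exact ⟨(fderiv ℝ σ y₀ a)⁻¹ • a, by simp [ha]⟩
  set l := fderiv ℝ σ y₀ with hl
  -- A chart straightening `σ`: the fixed linear form `l` composed with `Φ` is `σ`, and the
  -- differential at `y₀` is the identity.
  let Φ : E → E := fun y => y + (σ y - l y) • a
  have hΦ : ContDiffOn ℝ ∞ Φ U :=
    contDiffOn_id.add ((hσ.sub l.contDiff.contDiffOn).smul contDiffOn_const)
  have hlΦ : ∀ y, l (Φ y) = σ y := fun y => by simp [Φ, ha]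
  have hΦ₀ : HasFDerivAt Φ ((ContinuousLinearEquiv.refl ℝ E : E ≃L[ℝ] E) : E →L[ℝ] E) y₀ := by
    have h1 := (differentiableAt_of_smooth hU hσ hy₀).hasFDerivAt
    have h2 : HasFDerivAt Φ _ y₀ := (hasFDerivAt_id y₀).add
      ((h1.sub l.hasFDerivAt).smul_const a)
    convert h2 using 1
    ext x
    simp [← hl]
  have hΦc : ContDiffAt ℝ ∞ Φ y₀ := hΦ.contDiffAt (hU.mem_nhds hy₀)
  let e := hΦc.toOpenPartialHomeomorph Φ hΦ₀ (by simp)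
  have he : ∀ y, e y = Φ y := fun y => rfl
  have hy₀s : y₀ ∈ e.source := hΦc.mem_toOpenPartialHomeomorph_source hΦ₀ (by simp)
  have hinv : ∀ᶠ y in 𝓝 y₀, y ∈ U ∧ ∃ A : E ≃L[ℝ] E, (A : E →L[ℝ] E) = fderiv ℝ Φ y := by
    have hc : ContinuousAt (fderiv ℝ Φ) y₀ :=
      (smooth_fderiv hU hΦ).continuousOn.continuousAt (hU.mem_nhds hy₀)
    have hn := ContinuousLinearEquiv.nhds (ContinuousLinearEquiv.refl ℝ E)
    rw [← hΦ₀.fderiv] at hn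
    filter_upwards [hU.mem_nhds hy₀, hc hn] with y h1 h2 using ⟨h1, h2⟩
  have hback : Tendsto e.symm (𝓝 (Φ y₀)) (𝓝 y₀) := by
    have := e.symm.continuousAt (e.map_source hy₀s)
    unfold ContinuousAt at this
    rwa [e.left_inv hy₀s] at this
  obtain ⟨r, hr, hB⟩ := Metric.eventually_nhds_iff_ball.1
    ((hback.eventually hinv).and (e.open_target.mem_nhds (e.map_source hy₀s)))
  have hsm : ∀ z ∈ Metric.ball (Φ y₀) r, ContDiffAt ℝ ∞ e.symm z := by
    intro z hz
    obtain ⟨⟨hzU, A, hA⟩, hzt⟩ := hB z hz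
    have hc := hΦ.contDiffAt (hU.mem_nhds hzU)
    exact e.contDiffAt_symm hzt (f₀' := A)
      (by rw [hA]; exact (hc.differentiableAt (by simp)).hasFDerivAt) hc
  have hσe : ∀ z ∈ Metric.ball (Φ y₀) r, σ (e.symm z) = l z := by
    intro z hz
    rw [← hlΦ, ← he, e.right_inv (hB z hz).2]
  have hτe : ∀ z ∈ Metric.ball (Φ y₀) r, ContDiffAt ℝ ∞ (fun z => τ (e.symm z)) z := fun z hz =>
    (hτ.contDiffAt (hU.mem_nhds (hB z hz).1.1)).comp z (hsm z hz)
  have hd : ∀ z ∈ Metric.ball (Φ y₀) r, ∀ d, l d = 0 →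
      fderiv ℝ (fun z => τ (e.symm z)) z d = 0 := by
    intro z hz d hd
    have hzU := (hB z hz).1.1
    have h1 := ((hsm z hz).differentiableAt (by simp)).hasFDerivAt
    have h2 := (differentiableAt_of_smooth hU hτ hzU).hasFDerivAt.comp z h1
    have h3 := (differentiableAt_of_smooth hU hσ hzU).hasFDerivAt.comp z h1
    have h4 := h3.unique (l.hasFDerivAt.congr_of_eventuallyEq (by
      filter_upwards [Metric.isOpen_ball.mem_nhds hz] with z hz using hσe z hz))
    obtain ⟨k, hk⟩ := h _ hzU
    rw [HasFDerivAt.fderiv (f := fun z => τ (e.symm z)) h2]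
    have h5 := congrArg (fun l => l d) h4
    simp only [ContinuousLinearMap.comp_apply] at h5 ⊢
    rw [hk, h5, hd, mul_zero]
  -- In the straightened ball the level sets are convex, so a function with vanishing derivative
  -- along `ker l` is constant on them.
  have hconst : ∀ z ∈ Metric.ball (Φ y₀) r, ∀ z' ∈ Metric.ball (Φ y₀) r, l z = l z' →
      τ (e.symm z) = τ (e.symm z') := by
    intro z hz z' hz' hzz
    have hmem : ∀ s ∈ Icc (0 : ℝ) 1, z + s • (z' - z) ∈ Metric.ball (Φ y₀) r := fun s hs =>
      (convex_ball (Φ y₀) r).add_smul_sub_mem hz hz' hs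
    have hder : ∀ s ∈ Icc (0 : ℝ) 1,
        HasDerivAt (fun s : ℝ => τ (e.symm (z + s • (z' - z)))) 0 s := by
      intro s hs
      have h1 : HasDerivAt (fun s : ℝ => z + s • (z' - z)) (z' - z) s := by
        simpa using ((hasDerivAt_id s).smul_const (z' - z)).const_add z
      have h2 := ((hτe _ (hmem s hs)).differentiableAt (by simp)).hasFDerivAt.comp_hasDerivAt s h1
      rwa [hd _ (hmem s hs) _ (by simp [hzz])] at h2
    have := constant_of_has_deriv_right_zero
      (fun s hs => (hder s hs).continuousAt.continuousWithinAt)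
      (fun s hs => (hder s (Ico_subset_Icc_self hs)).hasDerivWithinAt) 1 (by simp)
    simpa using this.symm
  -- `T` is `τ` along the transversal line through `Φ y₀` in direction `a`; the radius keeps this
  -- line inside the ball.
  refine ⟨r / (‖a‖ + 1), by positivity, fun s => τ (e.symm (Φ y₀ + (s - σ y₀) • a)), ?_, ?_⟩
  all_goals
    have hline : ∀ s ∈ Metric.ball (σ y₀) (r / (‖a‖ + 1)),
        Φ y₀ + (s - σ y₀) • a ∈ Metric.ball (Φ y₀) r := by
      intro s hs
      rw [Metric.mem_ball, Real.dist_eq, lt_div_iff₀ (by positivity)] at hs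
      rw [Metric.mem_ball, dist_eq_norm, add_sub_cancel_left, norm_smul, Real.norm_eq_abs]
      nlinarith [abs_nonneg (s - σ y₀), norm_nonneg a]
  · intro s hs
    refine ContDiffAt.contDiffWithinAt ?_
    have h1 : ContDiffAt ℝ ∞ (fun s : ℝ => Φ y₀ + (s - σ y₀) • a) s :=
      contDiffAt_const.add ((contDiffAt_id.sub contDiffAt_const).smul contDiffAt_const)
    exact ContDiffAt.comp (g := fun z => τ (e.symm z)) s (hτe _ (hline s hs)) h1
  · have hσc : ContinuousAt σ y₀ := (differentiableAt_of_smooth hU hσ hy₀).continuousAt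
    filter_upwards [e.open_source.mem_nhds hy₀s, hσc (Metric.ball_mem_nhds (σ y₀)
      (show 0 < r / (‖a‖ + 1) by positivity)), hΦc.continuousAt (Metric.ball_mem_nhds _ hr)]
      with y hy1 hy2 hy3
    refine ⟨hy2, ?_⟩
    have := hconst _ hy3 _ (hline _ hy2) (by simp [hlΦ, ha])
    rw [← this, ← he, e.left_inv hy1]

theorem exists_local_inverse {K : ℝ → ℝ} {I : Set ℝ} (hI : IsOpen I) (hK : ContDiffOn ℝ ∞ K I)
    {s₀ : ℝ} (hs : s₀ ∈ I) (h0 : deriv K s₀ ≠ 0) :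
    ∃ F : ℝ → ℝ, ∀ᶠ s in 𝓝 s₀, ContDiffAt ℝ ∞ F (K s) ∧ F (K s) = s := by
  have hc := hK.contDiffAt (hI.mem_nhds hs)
  have hd : HasFDerivAt K ((ContinuousLinearEquiv.unitsEquivAut ℝ (Units.mk0 _ h0) : ℝ ≃L[ℝ] ℝ) :
      ℝ →L[ℝ] ℝ) s₀ := by
    have h1 := (hc.differentiableAt (by simp)).hasFDerivAt
    have h2 : ((ContinuousLinearEquiv.unitsEquivAut ℝ (Units.mk0 _ h0) : ℝ ≃L[ℝ] ℝ) : ℝ →L[ℝ] ℝ)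
        = fderiv ℝ K s₀ := by
      refine ContinuousLinearMap.ext_ring ?_
      simp
    rw [h2]
    exact h1
  let e := hc.toOpenPartialHomeomorph K hd (by simp)
  have hs₀ : s₀ ∈ e.source := hc.mem_toOpenPartialHomeomorph_source hd (by simp)
  have hcd : ContinuousAt (deriv K) s₀ :=
    (hK.continuousOn_deriv_of_isOpen hI (by simp)).continuousAt (hI.mem_nhds hs)
  refine ⟨e.symm, ?_⟩
  filter_upwards [e.open_source.mem_nhds hs₀, hI.mem_nhds hs, hcd.eventually_ne h0] with s h1 h2 h3
  have hl : e.symm (K s) = s := e.left_inv h1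
  have hcs := hK.contDiffAt (hI.mem_nhds h2)
  refine ⟨e.contDiffAt_symm_deriv h3 (e.map_source h1) ?_ ?_, hl⟩
  · rw [hl]; exact (hcs.differentiableAt (by simp)).hasDerivAt
  · rw [hl]; exact hcs

theorem exists_primitive {B : ℝ → ℝ} {s₀ ε : ℝ} (hB : ContDiffOn ℝ ∞ B (Metric.ball s₀ ε)) :
    ∃ A : ℝ → ℝ, ContDiffOn ℝ ∞ A (Metric.ball s₀ ε) ∧
      ∀ s ∈ Metric.ball s₀ ε, HasDerivAt A (B s) s := by
  have hd : ∀ s ∈ Metric.ball s₀ ε, HasDerivAt (fun s => ∫ x in s₀..s, B x) (B s) s := by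
    intro s hs
    have hs₀ : s₀ ∈ Metric.ball s₀ ε := Metric.mem_ball_self (Metric.pos_of_mem_ball hs)
    have hsub : uIcc s₀ s ⊆ Metric.ball s₀ ε :=
      (convex_ball s₀ ε).ordConnected.uIcc_subset hs₀ hs
    exact intervalIntegral.integral_hasDerivAt_right
      ((hB.continuousOn.mono hsub).intervalIntegrable)
      (hB.continuousOn.stronglyMeasurableAtFilter Metric.isOpen_ball s hs)
      (hB.continuousOn.continuousAt (Metric.isOpen_ball.mem_nhds hs))
  refine ⟨_, ?_, hd⟩
  rw [contDiffOn_infty_iff_deriv_of_isOpen Metric.isOpen_ball]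
  exact ⟨fun s hs => (hd s hs).differentiableAt.differentiableWithinAt,
    hB.congr fun s hs => (hd s hs).deriv⟩

/-- A primitive, as a function of `σ`, of the recurrence form of a metric with isotropic `∇σ`. -/
theorem exists_recurrence_potential (hU : IsOpen U) (hσ : ContDiffOn ℝ ∞ σ U)
    (hτ : ContDiffOn ℝ ∞ τ U) (h : ∀ y ∈ U, ∃ k : ℝ, ∀ x, fderiv ℝ τ y x = k * fderiv ℝ σ y x)
    {y₀ : E} (hy₀ : y₀ ∈ U) (h0 : fderiv ℝ σ y₀ ≠ 0) (hτ0 : τ y₀ ≠ 0)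
    (hψ : ∃ x, fderiv ℝ τ y₀ x / τ y₀
      + 2 * (1 - (Real.exp (2 * σ y₀) - 1) * τ y₀) * fderiv ℝ σ y₀ x ≠ 0) :
    ∃ K F : ℝ → ℝ, ∀ᶠ y in 𝓝 y₀, ContDiffAt ℝ ∞ (fun y => K (σ y)) y ∧
      (∀ x, fderiv ℝ (fun y => K (σ y)) y x = fderiv ℝ τ y x / τ y
        + 2 * (1 - (Real.exp (2 * σ y) - 1) * τ y) * fderiv ℝ σ y x) ∧
      ContDiffAt ℝ ∞ F (K (σ y)) ∧ F (K (σ y)) = σ y := by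
  obtain ⟨ε, hε, T, hT, hTe⟩ := exists_comp_of_fderiv_proportional hU hσ hτ h hy₀ h0
  have hT0 : T (σ y₀) ≠ 0 := by rw [← hTe.self_of_nhds.2]; exact hτ0
  have hTc : ContinuousAt T (σ y₀) := hT.continuousOn.continuousAt (Metric.ball_mem_nhds _ hε)
  obtain ⟨δ, hδ, hδT⟩ := Metric.eventually_nhds_iff_ball.1
    ((hTc.eventually_ne hT0).and (Metric.ball_mem_nhds (σ y₀) hε))
  have hT' : ContDiffOn ℝ ∞ T (Metric.ball (σ y₀) δ) := hT.mono fun s hs => (hδT s hs).2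
  obtain ⟨A, hA, hA'⟩ := exists_primitive (B := fun s => 2 * (1 - (Real.exp (2 * s) - 1) * T s))
    (s₀ := σ y₀) (ε := δ) (contDiffOn_const.mul (contDiffOn_const.sub
      (((Real.contDiff_exp.comp_contDiffOn (contDiffOn_const.mul contDiffOn_id)).sub
        contDiffOn_const).mul hT')))
  -- The two summands of the recurrence form are integrated separately. `Real.log` is the logarithm
  -- of the absolute value, so the sign of `T` does not matter.
  let K : ℝ → ℝ := fun s => Real.log (T s) + A s
  have hK : ContDiffOn ℝ ∞ K (Metric.ball (σ y₀) δ) := (hT'.log fun s hs => (hδT s hs).1).add hA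
  have hKd : ∀ s ∈ Metric.ball (σ y₀) δ,
      HasDerivAt K (deriv T s / T s + 2 * (1 - (Real.exp (2 * s) - 1) * T s)) s := by
    intro s hs
    have h1 := ((hT'.contDiffAt (Metric.isOpen_ball.mem_nhds hs)).differentiableAt
      (by simp)).hasDerivAt
    exact (h1.log (hδT s hs).1).add (hA' s hs)
  have hσd : ∀ y ∈ U, HasFDerivAt σ (fderiv ℝ σ y) y := fun y hy =>
    (differentiableAt_of_smooth hU hσ hy).hasFDerivAt
  have hev : ∀ᶠ y in 𝓝 y₀, y ∈ U ∧ σ y ∈ Metric.ball (σ y₀) δ ∧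
      (∀ x, fderiv ℝ (fun y => K (σ y)) y x = fderiv ℝ τ y x / τ y
        + 2 * (1 - (Real.exp (2 * σ y) - 1) * τ y) * fderiv ℝ σ y x) := by
    filter_upwards [hU.mem_nhds hy₀, hTe.eventually_nhds,
      (hσd y₀ hy₀).continuousAt (Metric.ball_mem_nhds _ hδ)] with y hyU hyT hyδ
    refine ⟨hyU, hyδ, fun x => ?_⟩
    have hT1 := ((hT'.contDiffAt (Metric.isOpen_ball.mem_nhds hyδ)).differentiableAt
      (by simp)).hasDerivAt.comp_hasFDerivAt y (hσd y hyU)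
    have e1 : fderiv ℝ τ y = deriv T (σ y) • fderiv ℝ σ y :=
      (hT1.congr_of_eventuallyEq (hyT.mono fun z hz => hz.2)).fderiv
    have e2 := ((hKd _ hyδ).comp_hasFDerivAt y (hσd y hyU)).fderiv
    have e3 : fderiv ℝ (fun y => K (σ y)) y = _ := e2
    rw [e3, e1, hyT.self_of_nhds.2]
    simp only [smul_apply, smul_eq_mul]
    ring
  -- This is the nonvanishing of the recurrence form at `y₀`.
  have hK0 : deriv K (σ y₀) ≠ 0 := by
    intro hcon
    obtain ⟨x, hx⟩ := hψ
    obtain ⟨hyU, hyδ, hy⟩ := hev.self_of_nhds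
    rw [← hy] at hx
    have e3 : fderiv ℝ (fun y => K (σ y)) y₀ = _ :=
      ((hKd _ hyδ).comp_hasFDerivAt y₀ (hσd y₀ hyU)).fderiv
    rw [e3, ← (hKd _ hyδ).deriv, hcon] at hx
    simp at hx
  obtain ⟨F, hF⟩ := exists_local_inverse Metric.isOpen_ball hK (Metric.mem_ball_self hδ) hK0
  refine ⟨K, F, ?_⟩
  filter_upwards [hev, (hσd y₀ hy₀).continuousAt.eventually hF] with y ⟨h1, h2, h3⟩ h4
  exact ⟨(hK.contDiffAt (Metric.isOpen_ball.mem_nhds h2)).comp y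
    (hσ.contDiffAt (hU.mem_nhds h1)), h3, h4⟩

end FunctionalDependence

/-! ### Computing curvature in arbitrary parametrizations. -/

section Parametrization

variable {n : ℕ} {M : Type*} [TopologicalSpace M] [ChartedSpace (EuclideanSpace ℝ (Fin n)) M]
  {F F' : EuclideanSpace ℝ (Fin n) → M} {V : Set (EuclideanSpace ℝ (Fin n))}
  {h : ∀ q : M, TangentSpace (𝓡 n) q →L[ℝ] TangentSpace (𝓡 n) q →L[ℝ] ℝ}

/-- The derivative of a parametrization, as an endomorphism of the model space. -/
def paramDeriv (F : EuclideanSpace ℝ (Fin n) → M) (y : EuclideanSpace ℝ (Fin n)) :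
    EuclideanSpace ℝ (Fin n) →L[ℝ] EuclideanSpace ℝ (Fin n) :=
  mfderiv 𝓘(ℝ, EuclideanSpace ℝ (Fin n)) (𝓡 n) F y

/-- The pullback of a field of bilinear forms under a parametrization. -/
def paramMetric (h : ∀ q : M, TangentSpace (𝓡 n) q →L[ℝ] TangentSpace (𝓡 n) q →L[ℝ] ℝ)
    (F : EuclideanSpace ℝ (Fin n) → M) (y : EuclideanSpace ℝ (Fin n)) :
    EuclideanSpace ℝ (Fin n) →L[ℝ] EuclideanSpace ℝ (Fin n) →L[ℝ] ℝ :=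
  ContinuousLinearMap.bilinearComp
    (h (F y) : EuclideanSpace ℝ (Fin n) →L[ℝ] EuclideanSpace ℝ (Fin n) →L[ℝ] ℝ)
    (paramDeriv F y) (paramDeriv F y)

theorem paramMetric_apply (y u v : EuclideanSpace ℝ (Fin n)) :
    paramMetric h F y u v = h (F y) (paramDeriv F y u) (paramDeriv F y v) := rfl

theorem inChart_eq (p : M) : inChart h p = paramMetric h (extChartAt (𝓡 n) p).symm := rfl

theorem paramDeriv_comp {ψ : EuclideanSpace ℝ (Fin n) → EuclideanSpace ℝ (Fin n)}
    {y : EuclideanSpace ℝ (Fin n)}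
    (hF : MDifferentiableAt 𝓘(ℝ, EuclideanSpace ℝ (Fin n)) (𝓡 n) F (ψ y))
    (hψ : DifferentiableAt ℝ ψ y) :
    paramDeriv (F ∘ ψ) y = (paramDeriv F (ψ y)).comp (fderiv ℝ ψ y) := by
  have := mfderiv_comp y hF hψ.mdifferentiableAt
  rw [mfderiv_eq_fderiv] at this
  exact this

theorem paramMetric_comp {ψ : EuclideanSpace ℝ (Fin n) → EuclideanSpace ℝ (Fin n)}
    {y : EuclideanSpace ℝ (Fin n)}
    (hF : MDifferentiableAt 𝓘(ℝ, EuclideanSpace ℝ (Fin n)) (𝓡 n) F (ψ y))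
    (hψ : DifferentiableAt ℝ ψ y) :
    paramMetric h (F ∘ ψ) y = pullback (paramMetric h F) ψ y := by
  ext u v
  rw [paramMetric_apply, paramDeriv_comp hF hψ]
  rfl

theorem paramDeriv_congr {y : EuclideanSpace ℝ (Fin n)} (hF : F =ᶠ[𝓝 y] F') :
    paramDeriv F y = paramDeriv F' y := hF.mfderiv_eq

theorem paramMetric_congr {y : EuclideanSpace ℝ (Fin n)} (hF : F =ᶠ[𝓝 y] F') :
    paramMetric h F y = paramMetric h F' y := by
  unfold paramMetric
  rw [paramDeriv_congr hF]
  have : ∀ q q' : M, q = q' →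
      (h q : EuclideanSpace ℝ (Fin n) →L[ℝ] EuclideanSpace ℝ (Fin n) →L[ℝ] ℝ) = h q' := by
    rintro q _ rfl; rfl
  rw [this _ _ hF.self_of_nhds]

/-- `F` is an immersion of the open set `V`. -/
structure IsParam (F : EuclideanSpace ℝ (Fin n) → M) (V : Set (EuclideanSpace ℝ (Fin n))) :
    Prop where
  isOpen : IsOpen V
  smooth : ContMDiffOn 𝓘(ℝ, EuclideanSpace ℝ (Fin n)) (𝓡 n) ∞ F V
  injective : ∀ y ∈ V, Function.Injective (paramDeriv F y)

theorem IsParam.contMDiffAt (hF : IsParam F V) {y : EuclideanSpace ℝ (Fin n)} (hy : y ∈ V) :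
    ContMDiffAt 𝓘(ℝ, EuclideanSpace ℝ (Fin n)) (𝓡 n) ∞ F y :=
  hF.smooth.contMDiffAt (hF.isOpen.mem_nhds hy)

theorem IsParam.mdifferentiableAt (hF : IsParam F V) {y : EuclideanSpace ℝ (Fin n)} (hy : y ∈ V) :
    MDifferentiableAt 𝓘(ℝ, EuclideanSpace ℝ (Fin n)) (𝓡 n) F y :=
  (hF.contMDiffAt hy).mdifferentiableAt (by simp)

theorem IsParam.surjective (hF : IsParam F V) {y : EuclideanSpace ℝ (Fin n)} (hy : y ∈ V) :
    Function.Surjective (paramDeriv F y) :=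
  (LinearMap.injective_iff_surjective (f := (paramDeriv F y :
    EuclideanSpace ℝ (Fin n) →ₗ[ℝ] EuclideanSpace ℝ (Fin n)))).1 (hF.injective y hy)

theorem IsParam.mono (hF : IsParam F V) {V' : Set (EuclideanSpace ℝ (Fin n))} (hV : IsOpen V')
    (h : V' ⊆ V) : IsParam F V' :=
  ⟨hV, hF.smooth.mono h, fun y hy => hF.injective y (h hy)⟩

variable [IsManifold (𝓡 n) ∞ M]

theorem isParam_chart (p : M) :
    IsParam (extChartAt (𝓡 n) p).symm (extChartAt (𝓡 n) p).target where
  isOpen := isOpen_extChartAt_target p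
  smooth := contMDiffOn_extChartAt_symm p
  injective y hy := by
    have := isInvertible_mfderivWithin_extChartAt_symm (I := 𝓡 n) hy
    rw [ModelWithCorners.range_eq_univ, mfderivWithin_univ] at this
    exact this.injective

theorem IsParam.coord_paramDeriv (hF : IsParam F V) {y : EuclideanSpace ℝ (Fin n)} (hy : y ∈ V)
    (u : EuclideanSpace ℝ (Fin n)) :
    coord (F y) (paramDeriv F y u) = fderiv ℝ (extChartAt (𝓡 n) (F y) ∘ F) y u := by
  have h1 : MDifferentiableAt (𝓡 n) 𝓘(ℝ, EuclideanSpace ℝ (Fin n)) (extChartAt (𝓡 n) (F y)) (F y) :=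
    mdifferentiableAt_extChartAt (mem_chart_source _ _)
  have := mfderiv_comp y h1 (hF.mdifferentiableAt hy)
  rw [mfderiv_eq_fderiv] at this
  rw [this]
  rfl

theorem IsParam.isLocalDiffeoOn_comp (hF : IsParam F V) (p : M)
    {W : Set (EuclideanSpace ℝ (Fin n))} (hW : IsOpen W) :
    IsLocalDiffeoOn (extChartAt (𝓡 n) p ∘ F)
      (V ∩ F ⁻¹' ((extChartAt (𝓡 n) p).source ∩ extChartAt (𝓡 n) p ⁻¹' W)) W := by
  have hop : IsOpen ((extChartAt (𝓡 n) p).source ∩ extChartAt (𝓡 n) p ⁻¹' W) :=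
    isOpen_extChartAt_preimage' p hW
  refine ⟨hF.smooth.continuousOn.isOpen_inter_preimage hF.isOpen hop, ?_, fun y hy => hy.2.2, ?_⟩
  · rw [← contMDiffOn_iff_contDiffOn]
    exact (contMDiffOn_extChartAt (n := ∞) (x := p)).comp (hF.smooth.mono inter_subset_left)
      fun y hy => by
        have := hy.2.1
        rwa [extChartAt_source] at this
  · intro y hy
    have h1 : MDifferentiableAt (𝓡 n) 𝓘(ℝ, EuclideanSpace ℝ (Fin n)) (extChartAt (𝓡 n) p) (F y) :=
      mdifferentiableAt_extChartAt (by have := hy.2.1; rwa [extChartAt_source] at this)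
    have := mfderiv_comp y h1 (hF.mdifferentiableAt hy.1)
    rw [mfderiv_eq_fderiv] at this
    rw [this]
    exact ((isInvertible_mfderiv_extChartAt hy.2.1).injective).comp (hF.injective y hy.1)

/-- Near `y` the map `F` is the inverse chart after the transition map. The preferred chart varies
with the point, so this is what allows a whole neighbourhood to be treated in one chart. -/
theorem IsParam.paramMetric_eventuallyEq (hF : IsParam F V) {y : EuclideanSpace ℝ (Fin n)}
    (hy : y ∈ V) {p : M} (hp : F y ∈ (extChartAt (𝓡 n) p).source) :
    paramMetric h F =ᶠ[𝓝 y] pullback (inChart h p) (extChartAt (𝓡 n) p ∘ F) := by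
  have hL := hF.isLocalDiffeoOn_comp p isOpen_univ
  filter_upwards [hL.isOpen.mem_nhds ⟨hy, hp, trivial⟩] with z hz
  have h1 : F =ᶠ[𝓝 z] (extChartAt (𝓡 n) p).symm ∘ (extChartAt (𝓡 n) p ∘ F) := by
    filter_upwards [hL.isOpen.mem_nhds hz] with x hx
    exact ((extChartAt (𝓡 n) p).left_inv hx.2.1).symm
  rw [paramMetric_congr h1, inChart_eq]
  exact paramMetric_comp ((isParam_chart p).mdifferentiableAt
    ((extChartAt (𝓡 n) p).map_source hz.2.1)) (differentiableAt_of_smooth hL.isOpen hL.smooth hz)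

/-- The curvature of a field of bilinear forms can be computed in any parametrization. -/
theorem IsParam.curv_eq (hF : IsParam F V) {y : EuclideanSpace ℝ (Fin n)} (hy : y ∈ V)
    {W : Set (EuclideanSpace ℝ (Fin n))} (hW : IsMetricOn (inChart h (F y)) W)
    (hyW : extChartAt (𝓡 n) (F y) (F y) ∈ W) (u v w t : EuclideanSpace ℝ (Fin n)) :
    curv h (F y) (paramDeriv F y u) (paramDeriv F y v) (paramDeriv F y w) (paramDeriv F y t) =
      curvatureForm (paramMetric h F) y u v w t := by
  rw [curvatureForm_congr (hF.paramMetric_eventuallyEq hy (mem_extChartAt_source (F y))),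
    hW.curvatureForm_pullback (hF.isLocalDiffeoOn_comp (F y) hW.isOpen)
      ⟨hy, mem_extChartAt_source (F y), hyW⟩]
  unfold curv
  simp only [hF.coord_paramDeriv hy]
  rfl

theorem IsParam.covDerivCurv_eq (hF : IsParam F V) {y : EuclideanSpace ℝ (Fin n)} (hy : y ∈ V)
    {W : Set (EuclideanSpace ℝ (Fin n))} (hW : IsMetricOn (inChart h (F y)) W)
    (hyW : extChartAt (𝓡 n) (F y) (F y) ∈ W) (a u v w t : EuclideanSpace ℝ (Fin n)) :
    covDerivCurv h (F y) (paramDeriv F y a) (paramDeriv F y u) (paramDeriv F y v)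
      (paramDeriv F y w) (paramDeriv F y t) =
      covDerivCurvatureForm (paramMetric h F) y a u v w t := by
  rw [covDerivCurvatureForm_congr (hF.paramMetric_eventuallyEq hy (mem_extChartAt_source (F y))),
    hW.covDerivCurvatureForm_pullback (hF.isLocalDiffeoOn_comp (F y) hW.isOpen)
      ⟨hy, mem_extChartAt_source (F y), hyW⟩]
  unfold covDerivCurv
  simp only [hF.coord_paramDeriv hy]
  rfl

theorem IsParam.diff_eq (hF : IsParam F V) {y : EuclideanSpace ℝ (Fin n)} (hy : y ∈ V)
    {σ : M → ℝ} (hσ : MDifferentiableAt (𝓡 n) 𝓘(ℝ, ℝ) σ (F y)) (u : EuclideanSpace ℝ (Fin n)) :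
    diff σ (F y) (paramDeriv F y u) = fderiv ℝ (σ ∘ F) y u := by
  have := mfderiv_comp y hσ (hF.mdifferentiableAt hy)
  rw [mfderiv_eq_fderiv] at this
  rw [this]
  rfl

theorem IsParam.contMDiffOn_paramDeriv (hF : IsParam F V)
    {v : EuclideanSpace ℝ (Fin n) → EuclideanSpace ℝ (Fin n)} (hv : ContDiffOn ℝ ∞ v V) :
    ContMDiffOn 𝓘(ℝ, EuclideanSpace ℝ (Fin n)) (𝓡 n).tangent ∞
      (fun y => (⟨F y, paramDeriv F y (v y)⟩ : TangentBundle (𝓡 n) M)) V := by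
  have h1 := hF.smooth.contMDiffOn_tangentMapWithin (m := ∞) (by simp) hF.isOpen.uniqueMDiffOn
  have h2 : ContMDiffOn 𝓘(ℝ, EuclideanSpace ℝ (Fin n)) (𝓘(ℝ, EuclideanSpace ℝ (Fin n))).tangent ∞
      (fun y => (⟨y, v y⟩ : TangentBundle 𝓘(ℝ, EuclideanSpace ℝ (Fin n))
        (EuclideanSpace ℝ (Fin n)))) V :=
    contMDiffOn_vectorSpace_iff_contDiffOn.2 hv
  refine (h1.comp h2 fun y hy => hy).congr fun y hy => ?_
  simp only [Function.comp, tangentMapWithin]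
  rw [mfderivWithin_of_isOpen hF.isOpen hy]
  rfl

theorem Metric.isMetricOn_paramMetric (g : Metric n M) (hF : IsParam F V) :
    IsMetricOn (paramMetric g.val F) V where
  isOpen := hF.isOpen
  smooth := by
    rw [contDiffOn_clm_apply]
    intro u
    rw [contDiffOn_clm_apply]
    intro v
    rw [← contMDiffOn_iff_contDiffOn]
    have h1 := g.smooth.comp_contMDiffOn hF.smooth
    intro y hy
    have h2 : ContMDiffWithinAt 𝓘(ℝ, EuclideanSpace ℝ (Fin n)) _ ∞ (fun y => TotalSpace.mk' ℝ
        (E := Bundle.Trivial M ℝ) (F y) (g.val (F y) (paramDeriv F y u) (paramDeriv F y v))) V y :=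
      ContMDiffWithinAt.clm_bundle_apply₂ (F₁ := EuclideanSpace ℝ (Fin n))
        (F₂ := EuclideanSpace ℝ (Fin n)) (F₃ := ℝ) (E₁ := fun q : M => TangentSpace (𝓡 n) q)
        (E₂ := fun q : M => TangentSpace (𝓡 n) q) (E₃ := Bundle.Trivial M ℝ)
        (b := F) (ψ := fun y => g.val (F y)) (h1 y hy)
        (hF.contMDiffOn_paramDeriv (v := fun _ => u) contDiffOn_const y hy)
        (hF.contMDiffOn_paramDeriv (v := fun _ => v) contDiffOn_const y hy)
    rw [contMDiffWithinAt_totalSpace] at h2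
    exact h2.2
  symm y _ u v := g.symm _ _ _
  nondeg y hy u hu := by
    refine hF.injective y hy ?_
    rw [map_zero]
    refine g.nondeg (F y) _ fun z => ?_
    obtain ⟨v, hv⟩ := hF.surjective hy z
    have := hu v
    rwa [paramMetric_apply, hv] at this

end Parametrization

/-! ### Passage between local coordinates and the manifold. -/

section LocalToGlobal

variable {n : ℕ} {M : Type*} [TopologicalSpace M] [ChartedSpace (EuclideanSpace ℝ (Fin n)) M]
  [IsManifold (𝓡 n) ∞ M]
  {F : EuclideanSpace ℝ (Fin n) → M} {V : Set (EuclideanSpace ℝ (Fin n))} {g : Metric n M}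

theorem IsParam.curv_metric (hF : IsParam F V) (g : Metric n M) {y : EuclideanSpace ℝ (Fin n)}
    (hy : y ∈ V) (u v w t : EuclideanSpace ℝ (Fin n)) :
    curv g.val (F y) (paramDeriv F y u) (paramDeriv F y v) (paramDeriv F y w) (paramDeriv F y t) =
      curvatureForm (paramMetric g.val F) y u v w t :=
  hF.curv_eq hy (g.isMetricOn_paramMetric (isParam_chart (F y))) (mem_extChartAt_target _) u v w t

theorem IsParam.covDerivCurv_metric (hF : IsParam F V) (g : Metric n M)
    {y : EuclideanSpace ℝ (Fin n)} (hy : y ∈ V) (a u v w t : EuclideanSpace ℝ (Fin n)) :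
    covDerivCurv g.val (F y) (paramDeriv F y a) (paramDeriv F y u) (paramDeriv F y v)
      (paramDeriv F y w) (paramDeriv F y t) =
      covDerivCurvatureForm (paramMetric g.val F) y a u v w t :=
  hF.covDerivCurv_eq hy (g.isMetricOn_paramMetric (isParam_chart (F y))) (mem_extChartAt_target _)
    a u v w t

theorem IsParam.contDiffOn_comp (hF : IsParam F V) {σ : M → ℝ} {U : Set M}
    (hσ : ContMDiffOn (𝓡 n) 𝓘(ℝ, ℝ) ∞ σ U) (h : MapsTo F V U) : ContDiffOn ℝ ∞ (σ ∘ F) V := by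
  rw [← contMDiffOn_iff_contDiffOn]
  exact hσ.comp hF.smooth h

theorem isOpen_chart_preimage (p : M) {U : Set M} (hU : IsOpen U) :
    IsOpen ((extChartAt (𝓡 n) p).target ∩ (extChartAt (𝓡 n) p).symm ⁻¹' U) :=
  (continuousOn_extChartAt_symm p).isOpen_inter_preimage (isOpen_extChartAt_target p) hU

/-- The factor is smooth only on `U`, so the preferred chart is first restricted to the preimage of
`U`. -/
theorem IsParam.curv_conformal (hF : IsParam F V) (g : Metric n M) {ρ : M → ℝ} {U : Set M}
    (hU : IsOpen U) (hρ : ContMDiffOn (𝓡 n) 𝓘(ℝ, ℝ) ∞ ρ U) {y : EuclideanSpace ℝ (Fin n)}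
    (hy : y ∈ V) (hyU : F y ∈ U) (u v w t : EuclideanSpace ℝ (Fin n)) :
    curv (fun r => Real.exp (2 * ρ r) • g.val r) (F y)
      (paramDeriv F y u) (paramDeriv F y v) (paramDeriv F y w) (paramDeriv F y t) =
      curvatureForm (fun z => Real.exp (2 * ρ (F z)) • paramMetric g.val F z) y u v w t := by
  have hop := isOpen_chart_preimage (n := n) (F y) hU
  have hc := (isParam_chart (F y)).mono hop inter_subset_left
  have hW := (g.isMetricOn_paramMetric hc).conformal
    (hc.contDiffOn_comp hρ fun z hz => hz.2)
  exact hF.curv_eq (h := fun r => Real.exp (2 * ρ r) • g.val r) hy hW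
    ⟨mem_extChartAt_target _, by rw [mem_preimage, extChartAt_to_inv]; exact hyU⟩ u v w t

theorem ConformallyFlatAt.exists_local {y : EuclideanSpace ℝ (Fin n)}
    (hF : IsParam F V) (hy : y ∈ V) (h : ConformallyFlatAt g.val (F y)) :
    ∃ W, IsOpen W ∧ y ∈ W ∧ W ⊆ V ∧ ∃ ρ : EuclideanSpace ℝ (Fin n) → ℝ, ContDiffOn ℝ ∞ ρ W ∧
      ∀ z ∈ W, ∀ u v w t,
        curvatureForm (fun x => Real.exp (2 * ρ x) • paramMetric g.val F x) z u v w t = 0 := by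
  obtain ⟨U, ρ, hU, hyU, hρ, hflat⟩ := h
  have hW := hF.smooth.continuousOn.isOpen_inter_preimage hF.isOpen hU
  refine ⟨V ∩ F ⁻¹' U, hW, ⟨hy, hyU⟩, inter_subset_left, ρ ∘ F,
    (hF.mono hW inter_subset_left).contDiffOn_comp hρ fun z hz => hz.2, fun z hz u v w t => ?_⟩
  have := hF.curv_conformal g hU hρ hz.1 hz.2 u v w t
  exact this.symm.trans (hflat _ hz.2 _ _ _ _)

theorem conformallyFlatAt_of_local {p : M} {W : Set (EuclideanSpace ℝ (Fin n))} (hW : IsOpen W)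
    (hp : extChartAt (𝓡 n) p p ∈ W) (hWt : W ⊆ (extChartAt (𝓡 n) p).target)
    {ρ : EuclideanSpace ℝ (Fin n) → ℝ} (hρ : ContDiffOn ℝ ∞ ρ W)
    (h : ∀ z ∈ W, ∀ u v w t, curvatureForm (fun x => Real.exp (2 * ρ x) •
      paramMetric g.val (extChartAt (𝓡 n) p).symm x) z u v w t = 0) :
    ConformallyFlatAt g.val p := by
  have hU : IsOpen ((extChartAt (𝓡 n) p).source ∩ extChartAt (𝓡 n) p ⁻¹' W) :=
    isOpen_extChartAt_preimage' p hW
  have hF := (isParam_chart p).mono hW hWt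
  have hρ' : ContMDiffOn (𝓡 n) 𝓘(ℝ, ℝ) ∞ (ρ ∘ extChartAt (𝓡 n) p)
      ((extChartAt (𝓡 n) p).source ∩ extChartAt (𝓡 n) p ⁻¹' W) :=
    (contMDiffOn_iff_contDiffOn.2 hρ).comp ((contMDiffOn_extChartAt (n := ∞) (x := p)).mono
      fun q hq => by have := hq.1; rwa [extChartAt_source] at this) fun q hq => hq.2
  refine ⟨_, ρ ∘ extChartAt (𝓡 n) p, hU, ⟨mem_extChartAt_source p, hp⟩, hρ', ?_⟩
  -- Points are written as images of coordinates, so that all tangent vectors come from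
  -- `paramDeriv`; the left inverse of the chart carries the result to `q`.
  have key : ∀ z ∈ W, ∀ x y w t : TangentSpace (𝓡 n) ((extChartAt (𝓡 n) p).symm z),
      curv (fun r => Real.exp (2 * (ρ ∘ extChartAt (𝓡 n) p) r) • g.val r)
        ((extChartAt (𝓡 n) p).symm z) x y w t = 0 := by
    intro z hz x y w t
    obtain ⟨x, rfl⟩ := hF.surjective hz x
    obtain ⟨y, rfl⟩ := hF.surjective hz y
    obtain ⟨w, rfl⟩ := hF.surjective hz w
    obtain ⟨t, rfl⟩ := hF.surjective hz t
    rw [hF.curv_conformal g hU hρ' hz ⟨(extChartAt (𝓡 n) p).map_target (hWt hz),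
      by rw [mem_preimage, (extChartAt (𝓡 n) p).right_inv (hWt hz)]; exact hz⟩, ← h z hz x y w t]
    refine curvatureForm_congr ?_ x y w t
    filter_upwards [hW.mem_nhds hz] with x hx
    simp only [Function.comp, (extChartAt (𝓡 n) p).right_inv (hWt hx)]
  intro q hq
  have := key _ hq.2
  rwa [(extChartAt (𝓡 n) p).left_inv hq.1] at this

theorem Metric.isCurvatureLike (g : Metric n M) (q : M) :
    IsCurvatureLike (E := TangentSpace (𝓡 n) q) (curv g.val q) := by
  have h := (g.isMetricOn_paramMetric (isParam_chart q)).isCurvatureLike (mem_extChartAt_target q)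
  have ha : ∀ x x' : TangentSpace (𝓡 n) q, coord q (x + x') = coord q x + coord q x' :=
    fun x x' => map_add _ x x'
  have hs : ∀ (c : ℝ) (x : TangentSpace (𝓡 n) q), coord q (c • x) = c • coord q x :=
    fun c x => map_smul _ c x
  refine ⟨fun x x' y z u => ?_, fun c x y z u => ?_, fun x y z u => h.anti₁ _ _ _ _,
    fun x y z u => h.anti₂ _ _ _ _, fun x y z u => h.cyc _ _ _ _⟩
  · unfold curv
    rw [ha]
    exact h.add₁ _ _ _ _ _
  · unfold curv
    rw [hs]
    exact h.smul₁ _ _ _ _ _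

theorem constantCurvatureAt_of_eq {q : M} {c : ℝ}
    (h : ∀ x y : TangentSpace (𝓡 n) q, curv g.val q x y y x = c * pi1 g.val q x y y x) :
    ConstantCurvatureAt g.val q :=
  ⟨c, fun x y hxy => by unfold sectional; rw [h, mul_div_assoc, div_self hxy, mul_one]⟩

/-- A covector field with smooth coordinates in the charts is smooth. -/
theorem smoothOneForm_of_local {α : ∀ q : M, TangentSpace (𝓡 n) q →L[ℝ] ℝ}
    (h : ∀ p : M, ∃ ψ : EuclideanSpace ℝ (Fin n) → EuclideanSpace ℝ (Fin n) →L[ℝ] ℝ,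
      ContDiffAt ℝ ∞ ψ (extChartAt (𝓡 n) p p) ∧ ∀ᶠ y in 𝓝 (extChartAt (𝓡 n) p p), ∀ u,
        α ((extChartAt (𝓡 n) p).symm y) (paramDeriv (extChartAt (𝓡 n) p).symm y u) = ψ y u) :
    SmoothOneForm α := by
  intro p
  obtain ⟨ψ, hψ, hev⟩ := h p
  refine (contMDiffAt_hom_bundle (E₂ := Bundle.Trivial M ℝ) _).2 ⟨contMDiffAt_id, ?_⟩
  have hφ : ContMDiffAt (𝓡 n) 𝓘(ℝ, EuclideanSpace ℝ (Fin n)) ∞ (extChartAt (𝓡 n) p) p :=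
    contMDiffAt_extChartAt
  refine ((contMDiffAt_iff_contDiffAt.2 hψ).comp p hφ).congr_of_eventuallyEq ?_
  filter_upwards [(continuousAt_extChartAt (I := 𝓡 n) p).eventually hev,
    chart_source_mem_nhds (EuclideanSpace ℝ (Fin n)) p] with q hq1 hq2
  have hq3 : (extChartAt (𝓡 n) p).symm (extChartAt (𝓡 n) p q) = q :=
    (extChartAt (𝓡 n) p).left_inv (by rwa [extChartAt_source])
  have hα : ∀ q q' : M, q = q' → (α q : EuclideanSpace ℝ (Fin n) →L[ℝ] ℝ) = α q' := by
    rintro q _ rfl; rfl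
  ext u
  have e0 : (trivializationAt ℝ (Bundle.Trivial M ℝ) p).continuousLinearMapAt ℝ q
      = ContinuousLinearMap.id ℝ ℝ := Bundle.Trivial.continuousLinearMapAt_trivialization ℝ M ℝ q
  have e1 := congrArg (fun l : ℝ →L[ℝ] ℝ => l (α q ((trivializationAt (EuclideanSpace ℝ (Fin n))
    (TangentSpace (𝓡 n)) p).symmL ℝ q u))) e0
  refine Eq.trans e1 ?_
  -- In the chart at `p`, the inverse trivialization of the tangent bundle is the differential of
  -- the inverse chart.
  have e2 : ((trivializationAt (EuclideanSpace ℝ (Fin n)) (TangentSpace (𝓡 n) (M := M)) p).symmL ℝ q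
      : EuclideanSpace ℝ (Fin n) →L[ℝ] EuclideanSpace ℝ (Fin n)) =
      paramDeriv (extChartAt (𝓡 n) p).symm (extChartAt (𝓡 n) p q) := by
    have := TangentBundle.symmL_trivializationAt (I := 𝓡 n) hq2
    rw [ModelWithCorners.range_eq_univ, mfderivWithin_univ] at this
    exact this
  have e3 := congrArg (fun l : EuclideanSpace ℝ (Fin n) →L[ℝ] EuclideanSpace ℝ (Fin n) =>
    (α q : EuclideanSpace ℝ (Fin n) →L[ℝ] ℝ) (l u)) e2
  refine e3.trans ((congrArg (fun l : EuclideanSpace ℝ (Fin n) →L[ℝ] ℝ =>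
    l (paramDeriv (extChartAt (𝓡 n) p).symm (extChartAt (𝓡 n) p q) u)) (hα _ _ hq3.symm)).trans
    (hq1 u))

theorem contMDiff_vectorField_of_local {X : ∀ q : M, TangentSpace (𝓡 n) q}
    (h : ∀ p : M, ∃ V, IsOpen V ∧ extChartAt (𝓡 n) p p ∈ V ∧ V ⊆ (extChartAt (𝓡 n) p).target ∧
      ∃ v : EuclideanSpace ℝ (Fin n) → EuclideanSpace ℝ (Fin n), ContDiffOn ℝ ∞ v V ∧
        ∀ y ∈ V, X ((extChartAt (𝓡 n) p).symm y) = paramDeriv (extChartAt (𝓡 n) p).symm y (v y)) :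
    ContMDiff (𝓡 n) (𝓡 n).tangent ∞ (fun q => (⟨q, X q⟩ : TangentBundle (𝓡 n) M)) := by
  intro p
  obtain ⟨V, hV, hpV, hVt, v, hv, hX⟩ := h p
  have hF := (isParam_chart p).mono hV hVt
  have h1 := (hF.contMDiffOn_paramDeriv hv).contMDiffAt (hV.mem_nhds hpV)
  have hφ : ContMDiffAt (𝓡 n) 𝓘(ℝ, EuclideanSpace ℝ (Fin n)) ∞ (extChartAt (𝓡 n) p) p :=
    contMDiffAt_extChartAt
  refine (h1.comp p hφ).congr_of_eventuallyEq ?_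
  filter_upwards [(continuousAt_extChartAt (I := 𝓡 n) p).eventually (hV.mem_nhds hpV),
    extChartAt_source_mem_nhds (I := 𝓡 n) p] with q hq1 hq2
  have hq3 : (extChartAt (𝓡 n) p).symm (extChartAt (𝓡 n) p q) = q :=
    (extChartAt (𝓡 n) p).left_inv hq2
  simp only [Function.comp]
  rw [← hX _ hq1, hq3]

end LocalToGlobal

/-! ### Consequences of the basic curvature relation. -/

section ConformalRelation

variable {E : Type*} [NormedAddCommGroup E] [NormedSpace ℝ E] [FiniteDimensional ℝ E]
  {G : E → E →L[ℝ] E →L[ℝ] ℝ} {U : Set E} {σ : E → ℝ}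

/-- The curvature of `G` satisfies `(e^{2σ} - 1) R = φ(- Hess σ + dσ ⊗ dσ + l G)` at each point,
for a scalar `l`. -/
def CurvatureRelation (G : E → E →L[ℝ] E →L[ℝ] ℝ) (σ : E → ℝ) (U : Set E) : Prop :=
  ∀ y ∈ U, ∃ l : ℝ, ∀ u v w t, (Real.exp (2 * σ y) - 1) * curvatureForm G y u v w t =
    kn (G y) (-hessian G σ y + (fderiv ℝ σ y).smulRight (fderiv ℝ σ y) + l • G y) u v w t

theorem exp_two_mul_sub_one_ne_zero {s : ℝ} (hs : s ≠ 0) : Real.exp (2 * s) - 1 ≠ 0 := by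
  rw [sub_ne_zero]
  intro h
  rw [Real.exp_eq_one_iff] at h
  exact hs (by linarith)

theorem CurvatureRelation.exists_kn (h : CurvatureRelation G σ U) (hG : IsMetricOn G U)
    (hσ : ContDiffOn ℝ ∞ σ U) {y : E} (hy : y ∈ U) (hs : σ y ≠ 0) :
    ∃ Q : E →L[ℝ] E →L[ℝ] ℝ, (∀ u v, Q u v = Q v u) ∧
      ∀ u v w t, curvatureForm G y u v w t = kn (G y) Q u v w t := by
  obtain ⟨l, hl⟩ := h y hy
  have h0 := exp_two_mul_sub_one_ne_zero hs
  refine ⟨(Real.exp (2 * σ y) - 1)⁻¹ •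
    (-hessian G σ y + (fderiv ℝ σ y).smulRight (fderiv ℝ σ y) + l • G y), fun u v => ?_,
    fun u v w t => ?_⟩
  · simp only [add_apply, smul_apply, neg_apply, ContinuousLinearMap.smulRight_apply, smul_eq_mul]
    rw [hG.hessian_symm hσ hy u v, hG.symm y hy u v]
    ring
  · refine mul_left_cancel₀ h0 ?_
    rw [hl]
    unfold kn
    simp only [add_apply, smul_apply, neg_apply, ContinuousLinearMap.smulRight_apply, smul_eq_mul]
    field_simp

theorem CurvatureRelation.curvature_eq_schouten_of_ne_zero (h : CurvatureRelation G σ U)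
    (hG : IsMetricOn G U) (hσ : ContDiffOn ℝ ∞ σ U) (hd : 3 ≤ Module.finrank ℝ E)
    (hs : ∀ y ∈ U, σ y ≠ 0) :
    ∀ y ∈ U, (∀ u v, schouten G y u v = schouten G y v u) ∧
      ∀ u v w t, curvatureForm G y u v w t = kn (G y) (schouten G y) u v w t :=
  hG.curvature_eq_schouten hd subset_rfl subset_closure fun y hy => h.exists_kn hG hσ hy (hs y hy)

/-- The relation determines `R` only where `σ ≠ 0`. This set is dense, since `σ` vanishing on an
open set would have zero differential there. -/
theorem CurvatureRelation.curvature_eq_schouten (h : CurvatureRelation G σ U)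
    (hG : IsMetricOn G U) (hσ : ContDiffOn ℝ ∞ σ U) (hw : ∀ y ∈ U, fderiv ℝ σ y ≠ 0)
    (hd : 3 ≤ Module.finrank ℝ E) :
    ∀ y ∈ U, (∀ u v, schouten G y u v = schouten G y v u) ∧
      ∀ u v w t, curvatureForm G y u v w t = kn (G y) (schouten G y) u v w t := by
  refine hG.curvature_eq_schouten hd (D := U ∩ {y | σ y ≠ 0}) inter_subset_left ?_
    fun y hy => h.exists_kn hG hσ hy.1 hy.2
  intro y hy
  by_contra hcon
  rw [mem_closure_iff_frequently, not_frequently] at hcon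
  refine hw y hy ?_
  rw [Filter.EventuallyEq.fderiv_eq (f := fun _ => (0 : ℝ))]
  · simp
  · filter_upwards [hcon, hG.isOpen.mem_nhds hy] with z hz hzU
    by_contra h0
    exact hz ⟨hzU, h0⟩

theorem CurvatureRelation.exists_schoutenRelation (h : CurvatureRelation G σ U)
    (hG : IsMetricOn G U) (hd : 3 ≤ Module.finrank ℝ E)
    (hR : ∀ y ∈ U, ∀ u v w t, curvatureForm G y u v w t = kn (G y) (schouten G y) u v w t) :
    ∃ lam, SchoutenRelation G (schouten G) σ lam U := by
  choose! lam hlam using h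
  refine ⟨lam, fun y hy u v => ?_⟩
  -- Adding a tensor in the kernel of `φ` to the Schouten form does not change the curvature, so by
  -- uniqueness that tensor is zero.
  have := hG.schouten_eq hd hy (Q := schouten G y + ((Real.exp (2 * σ y) - 1) • schouten G y -
    (-hessian G σ y + (fderiv ℝ σ y).smulRight (fderiv ℝ σ y) + lam y • G y))) (fun u v w t => by
      have e1 := hlam y hy u v w t
      rw [hR y hy] at e1 ⊢
      unfold kn at e1 ⊢
      simp only [add_apply, smul_apply, neg_apply, sub_apply, ContinuousLinearMap.smulRight_apply,
        smul_eq_mul] at e1 ⊢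
      linear_combination -e1)
  have e2 := congrArg (fun B => B u v) this
  simp only [add_apply, smul_apply, neg_apply, sub_apply, ContinuousLinearMap.smulRight_apply,
    smul_eq_mul] at e2
  linarith

/-- In dimension at least four the Codazzi equation comes from Bianchi. Otherwise the Schouten form
coincides locally with the tensor of a flattening factor, whose Codazzi equation is known. -/
theorem IsMetricOn.isSchoutenOn_schouten (hG : IsMetricOn G U) (hd : 3 ≤ Module.finrank ℝ E)
    (hs : ∀ y ∈ U, ∀ u v, schouten G y u v = schouten G y v u)
    (hR : ∀ y ∈ U, ∀ u v w t, curvatureForm G y u v w t = kn (G y) (schouten G y) u v w t)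
    (h : 4 ≤ Module.finrank ℝ E ∨ ∀ y ∈ U, ∃ W, IsOpen W ∧ y ∈ W ∧ W ⊆ U ∧
      ∃ ρ : E → ℝ, ContDiffOn ℝ ∞ ρ W ∧ ∀ z ∈ W, ∀ u v w t,
        curvatureForm (fun x => Real.exp (2 * ρ x) • G x) z u v w t = 0) :
    IsSchoutenOn G (schouten G) U := by
  rcases h with h | h
  · exact hG.isSchoutenOn_of_four_le h hG.smooth_schouten hs hR
  · refine ⟨hG.smooth_schouten, hs, hR, fun y hy a u v => ?_⟩
    obtain ⟨W, hW, hyW, hWU, ρ, hρ, hflat⟩ := h y hy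
    have hGW := hG.mono hW hWU
    have hP := hGW.isSchoutenOn_confSchouten hρ hflat
    have he : schouten G =ᶠ[𝓝 y] confSchouten G ρ := by
      filter_upwards [hW.mem_nhds hyW] with z hz
      exact hGW.schouten_eq hd hz (hP.curvature z hz)
    have := hP.codazzi y hyW a u v
    unfold covBil at this ⊢
    rwa [he.fderiv_eq, he.self_of_nhds]

end ConformalRelation

/-! ### The curvature relation of a conformal diffeomorphism. -/

section Diffeo

variable {n : ℕ} {M : Type*} [TopologicalSpace M] [ChartedSpace (EuclideanSpace ℝ (Fin n)) M]
  [IsManifold (𝓡 n) ∞ M] {M' : Type*} [TopologicalSpace M']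
  [ChartedSpace (EuclideanSpace ℝ (Fin n)) M'] [IsManifold (𝓡 n) ∞ M']
  {g : Metric n M} {g' : Metric n M'} {f : M → M'} {σ : M → ℝ}
  {F : EuclideanSpace ℝ (Fin n) → M} {V : Set (EuclideanSpace ℝ (Fin n))}

theorem weaklyDegenerate_of_isotropic (g : Metric n M) {q : M} {x y : TangentSpace (𝓡 n) q}
    (hx : x ≠ 0) (hxx : g.val q x x = 0) (hxy : g.val q x y = 0) (hyy : g.val q y y ≠ 0) :
    WeaklyDegenerate g.val q x y := by
  constructor
  · rw [LinearIndependent.pair_iff]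
    intro s t hst
    have h1 := congrArg (g.val q y) hst
    have hyx : g.val q y x = 0 := by rw [g.symm, hxy]
    have ht : t = 0 := by
      simp only [map_add, map_smul, smul_eq_mul, hyx, mul_zero, zero_add, map_zero] at h1
      exact (mul_eq_zero.1 h1).resolve_right hyy
    subst ht
    rw [zero_smul, add_zero] at hst
    exact ⟨(smul_eq_zero.1 hst).resolve_right hx, rfl⟩
  · have : (!![g.val q x x, g.val q x y; g.val q y x, g.val q y y] : Matrix (Fin 2) (Fin 2) ℝ)
        = Matrix.diagonal ![0, g.val q y y] := by
      rw [g.symm q y x, hxx, hxy]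
      ext i j
      fin_cases i <;> fin_cases j <;> simp
    rw [this, Matrix.rank_diagonal, Fintype.card_subtype]
    rw [show (Finset.univ.filter fun i : Fin 2 => ![0, g.val q y y] i ≠ 0) = {1} by
      ext i; fin_cases i <;> simp [hyy]]
    simp

/-- Conformality multiplies `π₁` by `e^{4σ}`, so the quotient of sectional curvatures is that of
curvature tensors up to this factor, as required by `exists_eq_of_tendsto_ratio`. -/
theorem exists_curv_relation (hn : 3 ≤ n) (hg : g.Indefinite)
    (hK : ∀ p : M, ¬ ConstantCurvatureAt g.val p)
    (hf : ∀ (p : M) (x y : TangentSpace (𝓡 n) p), WeaklyDegenerate g.val p x y →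
      CurvatureRatioTendstoOne g g' f p x y)
    (hconf : ∀ (p : M) (x y : TangentSpace (𝓡 n) p),
      g'.val (f p) (mfderiv (𝓡 n) (𝓡 n) f p x) (mfderiv (𝓡 n) (𝓡 n) f p y)
        = Real.exp (2 * σ p) * g.val p x y) (q : M) :
    ∃ k : ℝ, ∀ x y z u : TangentSpace (𝓡 n) q,
      curv g'.val (f q) (mfderiv (𝓡 n) (𝓡 n) f q x) (mfderiv (𝓡 n) (𝓡 n) f q y)
        (mfderiv (𝓡 n) (𝓡 n) f q z) (mfderiv (𝓡 n) (𝓡 n) f q u) =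
      Real.exp (2 * σ q) ^ 2 * curv g.val q x y z u + k * pi1 g.val q x y z u := by
  obtain ⟨e, he, hee⟩ := hg q
  have hR' := g'.isCurvatureLike (f q)
  refine exists_eq_of_tendsto_ratio (E := EuclideanSpace ℝ (Fin n)) (g := g.val q)
    (R := curv g.val q) (R' := fun x y z u : TangentSpace (𝓡 n) q =>
      curv g'.val (f q) (mfderiv (𝓡 n) (𝓡 n) f q x) (mfderiv (𝓡 n) (𝓡 n) f q y)
        (mfderiv (𝓡 n) (𝓡 n) f q z) (mfderiv (𝓡 n) (𝓡 n) f q u)) (g.symm q) (g.nondeg q)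
    (by rwa [finrank_euclideanSpace_fin]) he hee (g.isCurvatureLike q) ?_
    (pow_ne_zero 2 (Real.exp_ne_zero _)) ?_ ?_
  · refine ⟨fun x x' y z u => ?_, fun c x y z u => ?_, fun x y z u => hR'.anti₁ _ _ _ _,
      fun x y z u => hR'.anti₂ _ _ _ _, fun x y z u => hR'.cyc _ _ _ _⟩
    · exact (congrArg (fun a => curv g'.val (f q) a _ _ _)
        (map_add (mfderiv (𝓡 n) (𝓡 n) f q) x x')).trans (hR'.add₁ _ _ _ _ _)
    · exact (congrArg (fun a => curv g'.val (f q) a _ _ _)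
        (map_smul (mfderiv (𝓡 n) (𝓡 n) f q) c x)).trans (hR'.smul₁ _ _ _ _ _)
  -- `R ≠ 0` at `q`, since zero curvature is constant.
  · by_contra hcon
    push Not at hcon
    exact hK q (constantCurvatureAt_of_eq (c := 0) fun x y =>
      (hcon x y y x).trans (zero_mul _).symm)
  · intro x y hx hxx hxy hyy
    have hpi : ∀ a b : TangentSpace (𝓡 n) q, pi1 g'.val (f q) (mfderiv (𝓡 n) (𝓡 n) f q a)
        (mfderiv (𝓡 n) (𝓡 n) f q b) (mfderiv (𝓡 n) (𝓡 n) f q b) (mfderiv (𝓡 n) (𝓡 n) f q a) =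
        Real.exp (2 * σ q) ^ 2 * pi1 g.val q a b b a := by
      intro a b
      unfold pi1
      rw [hconf, hconf, hconf, hconf]
      ring
    have hE := Real.exp_ne_zero (2 * σ q)
    have key := hf q x y (weaklyDegenerate_of_isotropic g hx hxx hxy hyy)
    unfold CurvatureRatioTendstoOne at key
    have hset : {w : TangentSpace (𝓡 n) q × TangentSpace (𝓡 n) q |
        pi1 g.val q w.1 w.2 w.2 w.1 ≠ 0 ∧
        pi1 g'.val (f q) (mfderiv (𝓡 n) (𝓡 n) f q w.1) (mfderiv (𝓡 n) (𝓡 n) f q w.2)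
          (mfderiv (𝓡 n) (𝓡 n) f q w.2) (mfderiv (𝓡 n) (𝓡 n) f q w.1) ≠ 0 ∧
        sectional g.val q w.1 w.2 ≠ 0} = {w | pi1 g.val q w.1 w.2 w.2 w.1 ≠ 0 ∧
        curv g.val q w.1 w.2 w.2 w.1 ≠ 0} := by
      ext w
      simp only [mem_ofPred_eq, hpi, sectional, ne_eq, mul_eq_zero, div_eq_zero_iff, pow_eq_zero_iff,
        OfNat.ofNat_ne_zero, not_false_iff, hE]
      tauto
    rw [hset] at key
    simp only [sectional, hpi] at key
    exact key

/-- The target is parametrized by `f ∘ F`, so both metrics live on the same open set; injectivity of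
the differential follows from conformality and nondegeneracy. -/
theorem IsParam.comp_of_conformal (hF : IsParam F V) (hfs : ContMDiff (𝓡 n) (𝓡 n) ∞ f)
    (hconf : ∀ (p : M) (x y : TangentSpace (𝓡 n) p),
      g'.val (f p) (mfderiv (𝓡 n) (𝓡 n) f p x) (mfderiv (𝓡 n) (𝓡 n) f p y)
        = Real.exp (2 * σ p) * g.val p x y) :
    IsParam (f ∘ F) V ∧ ∀ y ∈ V,
      (∀ u, paramDeriv (f ∘ F) y u = mfderiv (𝓡 n) (𝓡 n) f (F y) (paramDeriv F y u)) ∧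
      paramMetric g'.val (f ∘ F) y = Real.exp (2 * σ (F y)) • paramMetric g.val F y := by
  have hD : ∀ y ∈ V, ∀ u,
      paramDeriv (f ∘ F) y u = mfderiv (𝓡 n) (𝓡 n) f (F y) (paramDeriv F y u) := by
    intro y hy u
    have h1 := mfderiv_comp y ((hfs (F y)).mdifferentiableAt (by simp)) (hF.mdifferentiableAt hy)
    exact congrArg (fun l : EuclideanSpace ℝ (Fin n) →L[ℝ] EuclideanSpace ℝ (Fin n) => l u) h1
  have hM : ∀ y ∈ V, paramMetric g'.val (f ∘ F) y =
      Real.exp (2 * σ (F y)) • paramMetric g.val F y := by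
    intro y hy
    ext u v
    rw [paramMetric_apply, hD y hy, hD y hy]
    exact hconf (F y) _ _
  refine ⟨⟨hF.isOpen, hfs.comp_contMDiffOn hF.smooth, fun y hy => ?_⟩,
    fun y hy => ⟨hD y hy, hM y hy⟩⟩
  rw [injective_iff_map_eq_zero]
  intro u hu
  refine (g.isMetricOn_paramMetric hF).nondeg y hy u fun v => ?_
  have e1 := congrArg (fun B => B u v) (hM y hy)
  rw [paramMetric_apply, hu] at e1
  have e2 : g'.val ((f ∘ F) y) 0 (paramDeriv (f ∘ F) y v) = 0 := by
    rw [map_zero]; rfl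
  have e3 : (0 : ℝ) = Real.exp (2 * σ (F y)) * paramMetric g.val F y u v := e2.symm.trans e1
  exact (mul_eq_zero.1 e3.symm).resolve_left (Real.exp_ne_zero _)

/-- Two expressions for the pulled-back curvature are compared: the conformal change formula and the
pointwise identity obtained from the limits. -/
theorem curvatureRelation (hn : 3 ≤ n) (hg : g.Indefinite)
    (hK : ∀ p : M, ¬ ConstantCurvatureAt g.val p) (hfs : ContMDiff (𝓡 n) (𝓡 n) ∞ f)
    (hf : ∀ (p : M) (x y : TangentSpace (𝓡 n) p), WeaklyDegenerate g.val p x y →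
      CurvatureRatioTendstoOne g g' f p x y)
    (hσ : ContMDiff (𝓡 n) 𝓘(ℝ, ℝ) ∞ σ)
    (hconf : ∀ (p : M) (x y : TangentSpace (𝓡 n) p),
      g'.val (f p) (mfderiv (𝓡 n) (𝓡 n) f p x) (mfderiv (𝓡 n) (𝓡 n) f p y)
        = Real.exp (2 * σ p) * g.val p x y) (hF : IsParam F V) :
    CurvatureRelation (paramMetric g.val F) (σ ∘ F) V := by
  intro y hy
  obtain ⟨k, hk⟩ := exists_curv_relation hn hg hK hf hconf (F y)
  obtain ⟨hF', hf'⟩ := hF.comp_of_conformal hfs hconf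
  have hG := g.isMetricOn_paramMetric hF
  have hs : ContDiffOn ℝ ∞ (σ ∘ F) V := hF.contDiffOn_comp hσ.contMDiffOn (mapsTo_univ F V)
  set G := paramMetric g.val F with hGdef
  set s := σ ∘ F with hsdef
  -- The first term is the trace part of `confSchouten`; the second absorbs `k π₁ = (k/2) φ(g)`
  -- after division by `e^{2σ}`.
  refine ⟨-(1 / 2 * G y (gradient G s y) (gradient G s y)) - k / (2 * Real.exp (2 * s y)),
    fun u v w t => ?_⟩
  have e1 := hk (paramDeriv F y u) (paramDeriv F y v) (paramDeriv F y w) (paramDeriv F y t)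
  rw [hF.curv_metric g hy, ← hGdef] at e1
  have e2 := hF'.curv_metric g' hy u v w t
  simp only [(hf' y hy).1] at e2
  have e3 : curvatureForm (paramMetric g'.val (f ∘ F)) y u v w t =
      curvatureForm (fun z => Real.exp (2 * s z) • G z) y u v w t :=
    curvatureForm_congr (by
      filter_upwards [hF.isOpen.mem_nhds hy] with z hz using (hf' z hz).2) u v w t
  have e4 := hG.curvatureForm_conformal hs hy u v w t
  have e5 : Real.exp (2 * s y) * (curvatureForm G y u v w t - kn (G y) (confSchouten G s y) u v w t)
      = Real.exp (2 * s y) ^ 2 * curvatureForm G y u v w t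
        + k * (G y u t * G y v w - G y u w * G y v t) :=
    e4.symm.trans (e3.symm.trans (e2.symm.trans e1))
  have hE := Real.exp_ne_zero (2 * s y)
  unfold kn at e5 ⊢
  simp only [confSchouten_apply] at e5
  simp only [add_apply, smul_apply, neg_apply, ContinuousLinearMap.smulRight_apply, smul_eq_mul]
  refine mul_left_cancel₀ hE ?_
  field_simp
  linear_combination -2 * e5

end Diffeo

/-! ### Gradients and smooth functions in parametrizations. -/

section Gradient

variable {n : ℕ} {M : Type*} [TopologicalSpace M] [ChartedSpace (EuclideanSpace ℝ (Fin n)) M]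
  [IsManifold (𝓡 n) ∞ M] {g : Metric n M} {σ : M → ℝ}
  {F : EuclideanSpace ℝ (Fin n) → M} {V : Set (EuclideanSpace ℝ (Fin n))}

theorem grad_apply (g : Metric n M) (σ : M → ℝ) (q : M) (x : TangentSpace (𝓡 n) q) :
    g.val q (grad g.val σ q) x = diff σ q x :=
  apply_inverse (E := EuclideanSpace ℝ (Fin n)) (B := g.val q) (g.nondeg q) (diff σ q) x

theorem grad_eq_smul {h : M → ℝ} {q : M} {k : ℝ}
    (hk : ∀ x : TangentSpace (𝓡 n) q, diff h q x = k * diff σ q x) :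
    grad g.val h q = k • grad g.val σ q := by
  have : diff (n := n) h q = k • diff σ q := ContinuousLinearMap.ext fun x => hk x
  unfold grad
  rw [this, map_smul]

theorem IsParam.contDiffOn_comp_smooth (hF : IsParam F V) (hσ : ContMDiff (𝓡 n) 𝓘(ℝ, ℝ) ∞ σ) :
    ContDiffOn ℝ ∞ (σ ∘ F) V :=
  hF.contDiffOn_comp hσ.contMDiffOn (mapsTo_univ F V)

theorem IsParam.diff_paramDeriv (hF : IsParam F V) (hσ : ContMDiff (𝓡 n) 𝓘(ℝ, ℝ) ∞ σ)
    {y : EuclideanSpace ℝ (Fin n)} (hy : y ∈ V) (u : EuclideanSpace ℝ (Fin n)) :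
    diff σ (F y) (paramDeriv F y u) = fderiv ℝ (σ ∘ F) y u :=
  hF.diff_eq hy ((hσ (F y)).mdifferentiableAt (by simp)) u

theorem IsParam.paramDeriv_gradient (hF : IsParam F V) (g : Metric n M)
    (hσ : ContMDiff (𝓡 n) 𝓘(ℝ, ℝ) ∞ σ) {y : EuclideanSpace ℝ (Fin n)} (hy : y ∈ V) :
    paramDeriv F y (gradient (paramMetric g.val F) (σ ∘ F) y) = grad g.val σ (F y) := by
  refine eq_of_forall_apply (E := EuclideanSpace ℝ (Fin n)) (B := g.val (F y)) (g.nondeg (F y))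
    fun z => ?_
  obtain ⟨v, rfl⟩ := hF.surjective hy z
  have e1 := (g.isMetricOn_paramMetric hF).apply_gradient (σ ∘ F) hy v
  exact e1.trans ((hF.diff_paramDeriv hσ hy v).symm.trans (grad_apply g σ (F y) _).symm)

theorem IsParam.gradient_sq (hF : IsParam F V) (g : Metric n M)
    (hσ : ContMDiff (𝓡 n) 𝓘(ℝ, ℝ) ∞ σ) {y : EuclideanSpace ℝ (Fin n)} (hy : y ∈ V) :
    paramMetric g.val F y (gradient (paramMetric g.val F) (σ ∘ F) y)
      (gradient (paramMetric g.val F) (σ ∘ F) y) =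
      g.val (F y) (grad g.val σ (F y)) (grad g.val σ (F y)) := by
  rw [paramMetric_apply, hF.paramDeriv_gradient g hσ hy]

theorem IsParam.fderiv_ne_zero (hF : IsParam F V) (hσ : ContMDiff (𝓡 n) 𝓘(ℝ, ℝ) ∞ σ)
    {y : EuclideanSpace ℝ (Fin n)} (hy : y ∈ V) (h : grad g.val σ (F y) ≠ 0) :
    fderiv ℝ (σ ∘ F) y ≠ 0 := by
  intro h0
  refine h ?_
  rw [← hF.paramDeriv_gradient g hσ hy]
  unfold gradient
  rw [h0]
  simp only [map_zero]
  rfl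

theorem contMDiff_of_chart {h : M → ℝ} (hh : ∀ p : M,
    ContDiffOn ℝ ∞ (h ∘ (extChartAt (𝓡 n) p).symm) (extChartAt (𝓡 n) p).target) :
    ContMDiff (𝓡 n) 𝓘(ℝ, ℝ) ∞ h := by
  intro p
  have h1 := (hh p).contDiffAt ((isOpen_extChartAt_target p).mem_nhds (mem_extChartAt_target p))
  have hφ : ContMDiffAt (𝓡 n) 𝓘(ℝ, EuclideanSpace ℝ (Fin n)) ∞ (extChartAt (𝓡 n) p) p :=
    contMDiffAt_extChartAt
  refine ((contMDiffAt_iff_contDiffAt.2 h1).comp p hφ).congr_of_eventuallyEq ?_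
  filter_upwards [extChartAt_source_mem_nhds (I := 𝓡 n) p] with q hq
  simp only [Function.comp, (extChartAt (𝓡 n) p).left_inv hq]

/-- A property of the points of `M` can be checked in the charts. -/
theorem forall_of_chart {p : M → Prop}
    (h : ∀ q : M, ∀ y ∈ (extChartAt (𝓡 n) q).target, p ((extChartAt (𝓡 n) q).symm y)) (q : M) :
    p q := by
  have := h q _ (mem_extChartAt_target q)
  rwa [extChartAt_to_inv] at this

end Gradient

/-! ### Case (a), and conformal flatness for nonvanishing gradient. -/

section Main

variable {n : ℕ} {M : Type*} [TopologicalSpace M] [ChartedSpace (EuclideanSpace ℝ (Fin n)) M]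
  [IsManifold (𝓡 n) ∞ M] {g : Metric n M} {σ : M → ℝ}
  {F : EuclideanSpace ℝ (Fin n) → M} {V : Set (EuclideanSpace ℝ (Fin n))}

/-- With `dσ = 0` the relation says that `(e^{2σ} - 1) R` equals `2 l π₁`; where `σ ≠ 0` this is
constant curvature. -/
theorem eq_zero_of_grad_eq_zero (hK : ∀ p : M, ¬ ConstantCurvatureAt g.val p)
    (hσ : ContMDiff (𝓡 n) 𝓘(ℝ, ℝ) ∞ σ)
    (hrel : ∀ F V, IsParam F V → CurvatureRelation (paramMetric g.val F) (σ ∘ F) V)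
    (h : ∀ p, grad g.val σ p = 0) (p : M) : σ p = 0 := by
  revert p
  refine forall_of_chart (n := n) fun q y hy => ?_
  have hF := isParam_chart (n := n) q
  set F := (extChartAt (𝓡 n) q).symm
  have hd : ∀ z ∈ (extChartAt (𝓡 n) q).target, fderiv ℝ (σ ∘ F) z = 0 := by
    intro z hz
    ext u
    have e := grad_apply g σ (F z) (paramDeriv F z u)
    rw [h, map_zero] at e
    exact (hF.diff_paramDeriv hσ hz u).symm.trans e.symm
  by_contra h0
  obtain ⟨l, hl⟩ := hrel F _ hF y hy
  have hH : hessian (paramMetric g.val F) (σ ∘ F) y = 0 := by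
    ext u v
    rw [hessian_apply, Filter.EventuallyEq.fderiv_eq (f := fun _ => 0)
      (by filter_upwards [hF.isOpen.mem_nhds hy] with z hz using hd z hz), hd y hy]
    simp
  have ht : Real.exp (2 * (σ ∘ F) y) - 1 ≠ 0 := exp_two_mul_sub_one_ne_zero h0
  refine hK (F y) (constantCurvatureAt_of_eq
    (c := 2 * l / (Real.exp (2 * (σ ∘ F) y) - 1)) fun x z => ?_)
  obtain ⟨u, rfl⟩ := hF.surjective hy x
  obtain ⟨v, rfl⟩ := hF.surjective hy z
  rw [hF.curv_metric g hy]
  have e := hl u v v u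
  rw [hH, hd y hy] at e
  have e2 : pi1 g.val (F y) (paramDeriv F y u) (paramDeriv F y v) (paramDeriv F y v)
      (paramDeriv F y u) = paramMetric g.val F y u u * paramMetric g.val F y v v
        - paramMetric g.val F y u v * paramMetric g.val F y v u := rfl
  rw [e2]
  refine mul_left_cancel₀ ht ?_
  rw [e]
  unfold kn
  simp only [add_apply, smul_apply, neg_apply, zero_apply, ContinuousLinearMap.smulRight_apply,
    smul_eq_mul]
  field_simp
  ring

/-- On the open set `σ ≠ 0` the curvature is `φ` of the Schouten form, and in dimension at least
four this makes the metric conformally flat there. -/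
theorem eq_zero_of_nowhereConformallyFlat (hn : 4 ≤ n) (hσ : ContMDiff (𝓡 n) 𝓘(ℝ, ℝ) ∞ σ)
    (hrel : ∀ F V, IsParam F V → CurvatureRelation (paramMetric g.val F) (σ ∘ F) V)
    (h : NowhereConformallyFlat g.val) (p : M) : σ p = 0 := by
  by_contra h0
  have hop := isOpen_chart_preimage (n := n) p (isOpen_compl_singleton.preimage hσ.continuous
    : IsOpen (σ ⁻¹' {0}ᶜ))
  have hF := (isParam_chart (n := n) p).mono hop inter_subset_left
  have hd : Module.finrank ℝ (EuclideanSpace ℝ (Fin n)) = n := finrank_euclideanSpace_fin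
  have hG := g.isMetricOn_paramMetric hF
  have hR := (hrel _ _ hF).curvature_eq_schouten_of_ne_zero hG (hF.contDiffOn_comp_smooth hσ)
    (by omega) fun y hy => hy.2
  have hP := hG.isSchoutenOn_schouten (by omega) (fun y hy => (hR y hy).1)
    (fun y hy => (hR y hy).2) (Or.inl (by omega))
  obtain ⟨W, hW, hpW, hWV, ρ, hρ, hflat⟩ := hG.exists_flat_conformal hP
    (y₀ := extChartAt (𝓡 n) p p) ⟨mem_extChartAt_target p, by
      rw [mem_preimage, mem_preimage, extChartAt_to_inv]; exact h0⟩
  exact h p (conformallyFlatAt_of_local hW hpW (hWV.trans inter_subset_left) hρ hflat)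

theorem IsParam.isSchoutenOn (hF : IsParam F V) (hn : 3 ≤ n) (hσ : ContMDiff (𝓡 n) 𝓘(ℝ, ℝ) ∞ σ)
    (hrel : CurvatureRelation (paramMetric g.val F) (σ ∘ F) V)
    (hw : ∀ p, grad g.val σ p ≠ 0) (h : 4 ≤ n ∨ (n = 3 ∧ ConformallyFlat g.val)) :
    IsSchoutenOn (paramMetric g.val F) (schouten (paramMetric g.val F)) V ∧
      ∃ lam, SchoutenRelation (paramMetric g.val F) (schouten (paramMetric g.val F)) (σ ∘ F) lam V ∧
        ContDiffOn ℝ ∞ lam V := by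
  have hd : Module.finrank ℝ (EuclideanSpace ℝ (Fin n)) = n := finrank_euclideanSpace_fin
  have hG := g.isMetricOn_paramMetric hF
  have hs := hF.contDiffOn_comp_smooth hσ
  have hR := hrel.curvature_eq_schouten hG hs (fun y hy => hF.fderiv_ne_zero hσ hy (hw (F y)))
    (by omega)
  obtain ⟨lam, hlam⟩ := hrel.exists_schoutenRelation hG (by omega) fun y hy => (hR y hy).2
  refine ⟨hG.isSchoutenOn_schouten (by omega) (fun y hy => (hR y hy).1) (fun y hy => (hR y hy).2) ?_,
    lam, hlam, hlam.smooth hG hs hG.smooth_schouten (by omega)⟩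
  rcases h with h | ⟨-, h⟩
  · exact Or.inl (by omega)
  · exact Or.inr fun y hy => (h (F y)).exists_local hF hy

theorem conformallyFlat_of_relation (hn : 3 ≤ n) (hσ : ContMDiff (𝓡 n) 𝓘(ℝ, ℝ) ∞ σ)
    (hrel : ∀ F V, IsParam F V → CurvatureRelation (paramMetric g.val F) (σ ∘ F) V)
    (hw : ∀ p, grad g.val σ p ≠ 0) (h : 4 ≤ n ∨ (n = 3 ∧ ConformallyFlat g.val)) :
    ConformallyFlat g.val := by
  intro p
  have hF := isParam_chart (n := n) p
  obtain ⟨hP, -⟩ := hF.isSchoutenOn hn hσ (hrel _ _ hF) hw h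
  obtain ⟨W, hW, hpW, hWV, ρ, hρ, hflat⟩ := (g.isMetricOn_paramMetric hF).exists_flat_conformal hP
    (mem_extChartAt_target p)
  exact conformallyFlatAt_of_local hW hpW hWV hρ hflat

end Main

/-! ### Case (b): isotropic gradient. -/

section Isotropic

variable {n : ℕ} {M : Type*} [TopologicalSpace M] [ChartedSpace (EuclideanSpace ℝ (Fin n)) M]
  [IsManifold (𝓡 n) ∞ M] {g : Metric n M} {σ : M → ℝ}
  {F : EuclideanSpace ℝ (Fin n) → M} {V : Set (EuclideanSpace ℝ (Fin n))}

/-- The local form of the metric when `∇σ` is isotropic: `R = τ φ(dσ ⊗ dσ)`, where `τ ≠ 0` depends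
on `σ` only, and `R` is recurrent. -/
theorem IsParam.isotropic (hF : IsParam F V) (hn : 3 ≤ n)
    (hK : ∀ p : M, ¬ ConstantCurvatureAt g.val p) (hσ : ContMDiff (𝓡 n) 𝓘(ℝ, ℝ) ∞ σ)
    (hrel : CurvatureRelation (paramMetric g.val F) (σ ∘ F) V)
    (hw : ∀ p, grad g.val σ p ≠ 0 ∧ g.val p (grad g.val σ p) (grad g.val σ p) = 0)
    (h : 4 ≤ n ∨ (n = 3 ∧ ConformallyFlat g.val)) :
    ∃ τ : EuclideanSpace ℝ (Fin n) → ℝ, ContDiffOn ℝ ∞ τ V ∧ ∀ y ∈ V, τ y ≠ 0 ∧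
      (∃ k : ℝ, ∀ x, fderiv ℝ τ y x = k * fderiv ℝ (σ ∘ F) y x) ∧
      (∀ u v w t, curvatureForm (paramMetric g.val F) y u v w t = τ y * kn (paramMetric g.val F y)
        ((fderiv ℝ (σ ∘ F) y).smulRight (fderiv ℝ (σ ∘ F) y)) u v w t) ∧
      ∀ a u v w t, covDerivCurvatureForm (paramMetric g.val F) y a u v w t =
        (fderiv ℝ τ y a / τ y
          + 2 * (1 - (Real.exp (2 * σ (F y)) - 1) * τ y) * fderiv ℝ (σ ∘ F) y a)
        * curvatureForm (paramMetric g.val F) y u v w t := by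
  have hd : 3 ≤ Module.finrank ℝ (EuclideanSpace ℝ (Fin n)) := by
    rwa [finrank_euclideanSpace_fin]
  obtain ⟨hP, lam, hlam, hl⟩ := hF.isSchoutenOn hn hσ hrel (fun p => (hw p).1) h
  have hG := g.isMetricOn_paramMetric hF
  have hs := hF.contDiffOn_comp_smooth hσ
  obtain ⟨τ, hτ, hτ'⟩ := hlam.isotropic hG hs
    (fun y hy => hF.fderiv_ne_zero hσ hy (hw (F y)).1) hP hl hd
    (fun y hy => by rw [hF.gradient_sq g hσ hy]; exact (hw (F y)).2)
  refine ⟨τ, hτ, fun y hy => ?_⟩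
  obtain ⟨h1, h2, h3⟩ := hτ' y hy
  have hR : ∀ u v w t, curvatureForm (paramMetric g.val F) y u v w t =
      τ y * kn (paramMetric g.val F y)
        ((fderiv ℝ (σ ∘ F) y).smulRight (fderiv ℝ (σ ∘ F) y)) u v w t := by
    intro u v w t
    rw [hP.curvature y hy]
    unfold kn
    simp only [h1, ContinuousLinearMap.smulRight_apply, smul_eq_mul, smul_apply]
    ring
  -- Otherwise the curvature at this point would be zero, hence constant.
  have h0 : τ y ≠ 0 := by
    intro h0
    refine hK (F y) (constantCurvatureAt_of_eq (c := 0) fun x z => ?_)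
    obtain ⟨u, rfl⟩ := hF.surjective hy x
    obtain ⟨v, rfl⟩ := hF.surjective hy z
    rw [hF.curv_metric g hy, hR, h0, zero_mul, zero_mul]
  refine ⟨h0, h2, hR, fun a u v w t => ?_⟩
  rw [hG.covDerivCurvatureForm_of_kn hP.smooth hP.curvature hy, hR]
  simp only [h3]
  unfold kn
  simp only [ContinuousLinearMap.smulRight_apply, smul_eq_mul, smul_apply, Function.comp]
  field_simp

/-- The cyclic identity for a curvature tensor of the form `τ φ(w ⊗ w)`. -/
theorem IsParam.cyclic (hF : IsParam F V) (hσ : ContMDiff (𝓡 n) 𝓘(ℝ, ℝ) ∞ σ)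
    {y : EuclideanSpace ℝ (Fin n)} (hy : y ∈ V) {τ : ℝ}
    (hR : ∀ u v w t, curvatureForm (paramMetric g.val F) y u v w t = τ * kn (paramMetric g.val F y)
      ((fderiv ℝ (σ ∘ F) y).smulRight (fderiv ℝ (σ ∘ F) y)) u v w t)
    (x v z u t : TangentSpace (𝓡 n) (F y)) :
    diff σ (F y) x * curv g.val (F y) v z u t + diff σ (F y) v * curv g.val (F y) z x u t
      + diff σ (F y) z * curv g.val (F y) x v u t = 0 := by
  obtain ⟨x, rfl⟩ := hF.surjective hy x
  obtain ⟨v, rfl⟩ := hF.surjective hy v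
  obtain ⟨z, rfl⟩ := hF.surjective hy z
  obtain ⟨u, rfl⟩ := hF.surjective hy u
  obtain ⟨t, rfl⟩ := hF.surjective hy t
  simp only [hF.curv_metric g hy, hF.diff_paramDeriv hσ hy, hR]
  unfold kn
  simp only [ContinuousLinearMap.smulRight_apply, smul_eq_mul, smul_apply]
  ring

/-- Everywhere `∇R = m dσ ⊗ R`. If `m` is not identically zero the recurrence form is `m dσ`;
otherwise `R` is parallel and `dσ` satisfies the cyclic identity. -/
theorem isotropic_conclusion [Nonempty M] (hn : 3 ≤ n)
    (hK : ∀ p : M, ¬ ConstantCurvatureAt g.val p) (hσ : ContMDiff (𝓡 n) 𝓘(ℝ, ℝ) ∞ σ)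
    (hrel : ∀ F V, IsParam F V → CurvatureRelation (paramMetric g.val F) (σ ∘ F) V)
    (hw : ∀ p, grad g.val σ p ≠ 0 ∧ g.val p (grad g.val σ p) (grad g.val σ p) = 0)
    (h : 4 ≤ n ∨ (n = 3 ∧ ConformallyFlat g.val)) :
    IsKStar g ∧
      ∀ p : M,
        ((∃ a x y z u : TangentSpace (𝓡 n) p, covDerivCurv g.val p a x y z u ≠ 0) ∨
          (∀ᶠ q in 𝓝 p, ∀ a x y z u : TangentSpace (𝓡 n) q,
            covDerivCurv g.val q a x y z u = 0)) →
        ∃ (U : Set M) (v : M → ℝ) (F : ℝ → ℝ), IsOpen U ∧ p ∈ U ∧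
          IsRecurrenceFunctionOn g.val U v ∧
          ∀ q ∈ U, ContDiffAt ℝ ∞ F (v q) ∧ σ q = F (v q) := by
  have hloc := fun p : M => (isParam_chart (n := n) p).isotropic hn hK hσ
    (hrel _ _ (isParam_chart p)) hw h
  choose τ hτ hτ' using hloc
  have hFp := fun p : M => isParam_chart (n := n) p
  have hdiff0 : ∀ q : M, diff (n := n) σ q ≠ 0 := by
    intro q h0
    refine (hw q).1 ?_
    unfold grad
    rw [h0, map_zero]
  have hcyc : ∀ q : M, ∀ x v z u t : TangentSpace (𝓡 n) q,
      diff σ q x * curv g.val q v z u t + diff σ q v * curv g.val q z x u t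
        + diff σ q z * curv g.val q x v u t = 0 :=
    forall_of_chart (n := n) fun q y hy => (hFp q).cyclic hσ hy (hτ' q y hy).2.2.1
  have hne : ∀ q : M, ∃ x y z u : TangentSpace (𝓡 n) q, curv g.val q x y z u ≠ 0 := by
    intro q
    by_contra hcon
    push Not at hcon
    exact hK q (constantCurvatureAt_of_eq (c := 0) fun x y =>
      (hcon x y y x).trans (zero_mul _).symm)
  have hm : ∀ q : M, ∃ m : ℝ, ∀ a x y z u : TangentSpace (𝓡 n) q,
      covDerivCurv g.val q a x y z u = m * diff σ q a * curv g.val q x y z u := by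
    refine forall_of_chart (n := n) fun q y hy => ?_
    obtain ⟨-, ⟨k, hk⟩, -, hcov⟩ := hτ' q y hy
    refine ⟨k / τ q y + 2 * (1 - (Real.exp (2 * σ ((extChartAt (𝓡 n) q).symm y)) - 1) * τ q y),
      fun a x v z u => ?_⟩
    obtain ⟨a, rfl⟩ := (hFp q).surjective hy a
    obtain ⟨x, rfl⟩ := (hFp q).surjective hy x
    obtain ⟨v, rfl⟩ := (hFp q).surjective hy v
    obtain ⟨z, rfl⟩ := (hFp q).surjective hy z
    obtain ⟨u, rfl⟩ := (hFp q).surjective hy u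
    rw [(hFp q).covDerivCurv_metric g hy, (hFp q).curv_metric g hy,
      (hFp q).diff_paramDeriv hσ hy, hcov, hk]
    ring
  choose m hm using hm
  -- The pointwise factor `m` agrees with the smooth local expression, because some component of `R`
  -- is nonzero and can be cancelled. Hence `m dσ` is smooth.
  have hψ : ∀ q : M, ∀ y ∈ (extChartAt (𝓡 n) q).target, ∀ u,
      m ((extChartAt (𝓡 n) q).symm y) * fderiv ℝ (σ ∘ (extChartAt (𝓡 n) q).symm) y u =
        fderiv ℝ (τ q) y u / τ q y
          + 2 * (1 - (Real.exp (2 * σ ((extChartAt (𝓡 n) q).symm y)) - 1) * τ q y)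
            * fderiv ℝ (σ ∘ (extChartAt (𝓡 n) q).symm) y u := by
    intro q y hy a
    obtain ⟨x, v, z, u, hxu⟩ := hne ((extChartAt (𝓡 n) q).symm y)
    obtain ⟨x, rfl⟩ := (hFp q).surjective hy x
    obtain ⟨v, rfl⟩ := (hFp q).surjective hy v
    obtain ⟨z, rfl⟩ := (hFp q).surjective hy z
    obtain ⟨u, rfl⟩ := (hFp q).surjective hy u
    have e1 := hm ((extChartAt (𝓡 n) q).symm y) (paramDeriv (extChartAt (𝓡 n) q).symm y a)
      (paramDeriv (extChartAt (𝓡 n) q).symm y x) (paramDeriv (extChartAt (𝓡 n) q).symm y v)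
      (paramDeriv (extChartAt (𝓡 n) q).symm y z) (paramDeriv (extChartAt (𝓡 n) q).symm y u)
    rw [(hFp q).covDerivCurv_metric g hy, (hFp q).curv_metric g hy,
      (hFp q).diff_paramDeriv hσ hy, (hτ' q y hy).2.2.2] at e1
    rw [(hFp q).curv_metric g hy] at hxu
    exact (mul_right_cancel₀ hxu e1).symm
  have hsm : ∀ q : M, ContDiffOn ℝ ∞ (fun y => (τ q y)⁻¹ • fderiv ℝ (τ q) y
      + (2 * (1 - (Real.exp (2 * σ ((extChartAt (𝓡 n) q).symm y)) - 1) * τ q y)) •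
        fderiv ℝ (σ ∘ (extChartAt (𝓡 n) q).symm) y) (extChartAt (𝓡 n) q).target := by
    intro q
    have hs := (hFp q).contDiffOn_comp_smooth hσ
    have hT := hτ q
    have hop := (hFp q).isOpen
    exact ((hT.inv fun y hy => (hτ' q y hy).1).smul (smooth_fderiv hop hT)).add
      ((contDiffOn_const.mul (contDiffOn_const.sub
        (((Real.contDiff_exp.comp_contDiffOn (contDiffOn_const.mul hs)).sub
          contDiffOn_const).mul hT))).smul (smooth_fderiv hop hs))
  have hσform : SmoothOneForm (diff (n := n) σ) := smoothOneForm_of_local fun p =>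
    ⟨_, (smooth_fderiv (hFp p).isOpen ((hFp p).contDiffOn_comp_smooth hσ)).contDiffAt
      ((hFp p).isOpen.mem_nhds (mem_extChartAt_target p)), by
      filter_upwards [(hFp p).isOpen.mem_nhds (mem_extChartAt_target p)] with y hy u
      exact (hFp p).diff_paramDeriv hσ hy u⟩
  have hαform : SmoothOneForm (fun q : M => m q • diff (n := n) σ q) :=
    smoothOneForm_of_local fun p => ⟨_, (hsm p).contDiffAt
      ((hFp p).isOpen.mem_nhds (mem_extChartAt_target p)), by
      filter_upwards [(hFp p).isOpen.mem_nhds (mem_extChartAt_target p)] with y hy u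
      refine (congrArg (fun r : ℝ => m ((extChartAt (𝓡 n) p).symm y) * r)
        ((hFp p).diff_paramDeriv hσ hy u)).trans ?_
      rw [hψ p y hy]
      simp only [add_apply, smul_apply, smul_eq_mul]
      ring⟩
  refine ⟨⟨?_, ?_⟩, fun p hp => ?_⟩
  · obtain ⟨p⟩ := ‹Nonempty M›
    exact ⟨p, hne p⟩
  · by_cases hα : ∃ p : M, m p ≠ 0
    · obtain ⟨p, hp⟩ := hα
      exact ⟨_, hαform, ⟨p, smul_ne_zero hp (hdiff0 p)⟩, Or.inl fun q _ a x y z u => hm q a x y z u⟩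
    · push Not at hα
      obtain ⟨p⟩ := ‹Nonempty M›
      exact ⟨_, hσform, ⟨p, hdiff0 p⟩, Or.inr ⟨fun q _ a x y z u => by
        rw [hm, hα, zero_mul, zero_mul], fun q _ x y z u v => hcyc q x y z u v⟩⟩
  · rcases hp with hp | hp
    · have hy₀ := mem_extChartAt_target (I := 𝓡 n) p
      have hs := (hFp p).contDiffOn_comp_smooth hσ
      have hinv : (extChartAt (𝓡 n) p).symm (extChartAt (𝓡 n) p p) = p := extChartAt_to_inv p
      have hψ₀ : ∃ x, fderiv ℝ (τ p) (extChartAt (𝓡 n) p p) x / τ p (extChartAt (𝓡 n) p p)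
          + 2 * (1 - (Real.exp (2 * (σ ∘ (extChartAt (𝓡 n) p).symm) (extChartAt (𝓡 n) p p)) - 1)
            * τ p (extChartAt (𝓡 n) p p))
            * fderiv ℝ (σ ∘ (extChartAt (𝓡 n) p).symm) (extChartAt (𝓡 n) p p) x ≠ 0 := by
        by_contra hcon
        push Not at hcon
        obtain ⟨a, x, v, z, u, hau⟩ := hp
        -- The hypothesis lives over `p`, the parametrization over the inverse chart at the
        -- coordinates of `p`; the two are equal but not by definition.
        have key : ∀ q : M, q = p → ∃ a x v z u : TangentSpace (𝓡 n) q,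
            covDerivCurv g.val q a x v z u ≠ 0 := by
          rintro q rfl; exact ⟨a, x, v, z, u, hau⟩
        obtain ⟨a, x, v, z, u, hau⟩ := key _ hinv
        obtain ⟨a, rfl⟩ := (hFp p).surjective hy₀ a
        refine hau ((hm _ _ x v z u).trans (mul_eq_zero_of_left ?_ _))
        exact ((congrArg (m _ * ·) ((hFp p).diff_paramDeriv hσ hy₀ a)).trans
          (hψ p _ hy₀ a)).trans (hcon a)
      obtain ⟨K, K', hev⟩ := exists_recurrence_potential (hFp p).isOpen hs (hτ p)
        (fun y hy => (hτ' p y hy).2.1) hy₀ ((hFp p).fderiv_ne_zero hσ hy₀ (hw _).1)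
        (hτ' p _ hy₀).1 hψ₀
      obtain ⟨a, ha⟩ := hψ₀
      have hψc : ∀ᶠ y in 𝓝 (extChartAt (𝓡 n) p p), fderiv ℝ (τ p) y a / τ p y
          + 2 * (1 - (Real.exp (2 * (σ ∘ (extChartAt (𝓡 n) p).symm) y) - 1) * τ p y)
            * fderiv ℝ (σ ∘ (extChartAt (𝓡 n) p).symm) y a ≠ 0 := by
        have hc := (((hsm p).clm_apply (contDiffOn_const (c := a))).continuousOn.continuousAt
          ((hFp p).isOpen.mem_nhds hy₀))
        have hform : ∀ y, ((τ p y)⁻¹ • fderiv ℝ (τ p) y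
            + (2 * (1 - (Real.exp (2 * σ ((extChartAt (𝓡 n) p).symm y)) - 1) * τ p y)) •
            fderiv ℝ (σ ∘ (extChartAt (𝓡 n) p).symm) y) a = fderiv ℝ (τ p) y a / τ p y
          + 2 * (1 - (Real.exp (2 * (σ ∘ (extChartAt (𝓡 n) p).symm) y) - 1) * τ p y)
            * fderiv ℝ (σ ∘ (extChartAt (𝓡 n) p).symm) y a := by
          intro y
          simp only [add_apply, smul_apply, smul_eq_mul, Function.comp]
          ring
        simp only [hform] at hc
        exact hc.eventually_ne ha
      obtain ⟨W, hWsub, hW, hpW⟩ := mem_nhds_iff.1 ((hev.and hψc).and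
        ((hFp p).isOpen.mem_nhds hy₀))
      have hφ : ContMDiffOn (𝓡 n) 𝓘(ℝ, EuclideanSpace ℝ (Fin n)) ∞ (extChartAt (𝓡 n) p)
          (extChartAt (𝓡 n) p).source := by
        rw [extChartAt_source]; exact contMDiffOn_extChartAt
      have hU : IsOpen ((extChartAt (𝓡 n) p).source ∩ extChartAt (𝓡 n) p ⁻¹' W) :=
        isOpen_extChartAt_preimage' p hW
      have hvs : ContMDiffOn (𝓡 n) 𝓘(ℝ, ℝ) ∞ (fun q => K (σ q))
          ((extChartAt (𝓡 n) p).source ∩ extChartAt (𝓡 n) p ⁻¹' W) := by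
        have h1 : ContDiffOn ℝ ∞ (fun y => K ((σ ∘ (extChartAt (𝓡 n) p).symm) y)) W :=
          fun y hy => (hWsub hy).1.1.1.contDiffWithinAt
        refine ((contMDiffOn_iff_contDiffOn.2 h1).comp (hφ.mono inter_subset_left)
          fun q hq => hq.2).congr fun q hq => ?_
        simp only [Function.comp, (extChartAt (𝓡 n) p).left_inv hq.1]
      have hdv : ∀ y ∈ W, ∀ u, diff (fun q => K (σ q)) ((extChartAt (𝓡 n) p).symm y)
          (paramDeriv (extChartAt (𝓡 n) p).symm y u) =
          m ((extChartAt (𝓡 n) p).symm y) * fderiv ℝ (σ ∘ (extChartAt (𝓡 n) p).symm) y u := by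
        intro y hy u
        have hyt := (hWsub hy).2
        have hmem : (extChartAt (𝓡 n) p).symm y ∈
            (extChartAt (𝓡 n) p).source ∩ extChartAt (𝓡 n) p ⁻¹' W :=
          ⟨(extChartAt (𝓡 n) p).map_target hyt, by
            rw [mem_preimage, (extChartAt (𝓡 n) p).right_inv hyt]; exact hy⟩
        rw [(hFp p).diff_eq hyt ((hvs.contMDiffAt (hU.mem_nhds hmem)).mdifferentiableAt (by simp)),
          hψ p y hyt]
        exact (hWsub hy).1.1.2.1 u
      have key : ∀ y ∈ W, (diff (n := n) (fun q => K (σ q)) ((extChartAt (𝓡 n) p).symm y) ≠ 0 ∧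
          ∀ b x v z u, covDerivCurv g.val ((extChartAt (𝓡 n) p).symm y) b x v z u =
            diff (fun q => K (σ q)) ((extChartAt (𝓡 n) p).symm y) b *
              curv g.val ((extChartAt (𝓡 n) p).symm y) x v z u) ∧
          ContDiffAt ℝ ∞ K' (K (σ ((extChartAt (𝓡 n) p).symm y))) ∧
          σ ((extChartAt (𝓡 n) p).symm y) = K' (K (σ ((extChartAt (𝓡 n) p).symm y))) := by
        intro y hy
        have hyt := (hWsub hy).2
        refine ⟨⟨fun h0 => ?_, fun b x v z u => ?_⟩, (hWsub hy).1.1.2.2.1,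
          (hWsub hy).1.1.2.2.2.symm⟩
        · have e1 := hdv y hy a
          rw [h0, hψ p y hyt] at e1
          exact (hWsub hy).1.2 e1.symm
        · obtain ⟨b, rfl⟩ := (hFp p).surjective hyt b
          exact (hm _ _ x v z u).trans (congrArg (· * _)
            ((congrArg (m _ * ·) ((hFp p).diff_paramDeriv hσ hyt b)).trans (hdv y hy b).symm))
      have key' : ∀ q ∈ (extChartAt (𝓡 n) p).source ∩ extChartAt (𝓡 n) p ⁻¹' W,
          (diff (n := n) (fun q => K (σ q)) q ≠ 0 ∧
          ∀ b x v z u, covDerivCurv g.val q b x v z u =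
            diff (fun q => K (σ q)) q b * curv g.val q x v z u) ∧
          ContDiffAt ℝ ∞ K' (K (σ q)) ∧ σ q = K' (K (σ q)) := by
        intro q hq
        have := key _ hq.2
        rwa [(extChartAt (𝓡 n) p).left_inv hq.1] at this
      exact ⟨_, fun q => K (σ q), K', hU, ⟨mem_extChartAt_source p, hpW⟩,
        ⟨hvs, fun q hq => (key' q hq).1.1, Or.inl fun q hq => (key' q hq).1.2⟩,
        fun q hq => (key' q hq).2⟩
    -- Where `∇R = 0` on an open set, `σ` is a recurrence function of the second kind, with `F` the
    -- identity.
    · obtain ⟨U, hUs, hU, hpU⟩ := mem_nhds_iff.1 hp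
      exact ⟨U, σ, id, hU, hpU, ⟨hσ.contMDiffOn, fun q _ => hdiff0 q,
        Or.inr ⟨fun q hq => hUs hq, fun q _ => hcyc q⟩⟩, fun q _ => ⟨contDiffAt_id, rfl⟩⟩

end Isotropic

/-! ### Case (c): nowhere isotropic gradient. -/

section NonIsotropic

variable {n : ℕ} {M : Type*} [TopologicalSpace M] [ChartedSpace (EuclideanSpace ℝ (Fin n)) M]
  [IsManifold (𝓡 n) ∞ M] {g : Metric n M} {σ : M → ℝ}
  {F : EuclideanSpace ℝ (Fin n) → M} {V : Set (EuclideanSpace ℝ (Fin n))}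

/-- The curvature is `R = φ(κ g + τ dσ ⊗ dσ)`, where `dκ`, `dτ` and `d(g(∇σ, ∇σ))` are
proportional to `dσ`. -/
theorem IsParam.exists_coeff (hF : IsParam F V) (hn : 3 ≤ n) (hσ : ContMDiff (𝓡 n) 𝓘(ℝ, ℝ) ∞ σ)
    (hrel : CurvatureRelation (paramMetric g.val F) (σ ∘ F) V)
    (hw : ∀ p, grad g.val σ p ≠ 0) (h : 4 ≤ n ∨ (n = 3 ∧ ConformallyFlat g.val)) :
    ∃ κ τ : EuclideanSpace ℝ (Fin n) → ℝ, ContDiffOn ℝ ∞ κ V ∧ ContDiffOn ℝ ∞ τ V ∧ ∀ y ∈ V,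
      (∀ u v w t, curvatureForm (paramMetric g.val F) y u v w t = kn (paramMetric g.val F y)
        (κ y • paramMetric g.val F y
          + τ y • (fderiv ℝ (σ ∘ F) y).smulRight (fderiv ℝ (σ ∘ F) y)) u v w t) ∧
      (∃ k : ℝ, ∀ x, fderiv ℝ κ y x = k * fderiv ℝ (σ ∘ F) y x) ∧
      (∃ k : ℝ, ∀ x, fderiv ℝ τ y x = k * fderiv ℝ (σ ∘ F) y x) ∧
      ∃ k : ℝ, ∀ x, fderiv ℝ (fun z => paramMetric g.val F z
        (gradient (paramMetric g.val F) (σ ∘ F) z) (gradient (paramMetric g.val F) (σ ∘ F) z)) y x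
        = k * fderiv ℝ (σ ∘ F) y x := by
  have hd : 3 ≤ Module.finrank ℝ (EuclideanSpace ℝ (Fin n)) := by
    rwa [finrank_euclideanSpace_fin]
  obtain ⟨hP, lam, hlam, hl⟩ := hF.isSchoutenOn hn hσ hrel hw h
  have hG := g.isMetricOn_paramMetric hF
  have hs := hF.contDiffOn_comp_smooth hσ
  have hw' := fun y hy => hF.fderiv_ne_zero hσ hy (hw (F y))
  obtain ⟨κ, τ, hκ, hτ, hPe, -⟩ := hlam.exists_eq hG hs hw' hP hl hd
  refine ⟨κ, τ, hκ, hτ, fun y hy => ?_⟩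
  obtain ⟨-, h1, h2⟩ := hlam.fderiv_coeff hG hs hw' hP hd hκ hτ hPe hy
  refine ⟨fun u v w t => ?_, ⟨_, h1⟩, h2, ?_⟩
  · rw [hP.curvature y hy]
    unfold kn
    simp only [hPe y hy, add_apply, ContinuousLinearMap.smulRight_apply, smul_eq_mul, smul_apply]
  · set G := paramMetric g.val F
    set w := fderiv ℝ (σ ∘ F) y
    set X := gradient G (σ ∘ F) y
    -- The differential of `|∇σ|²` is `2 Hess σ(·, ∇σ)`, evaluated by the Schouten relation with `P
    -- = κ G + τ dσ ⊗ dσ`.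
    refine ⟨2 * (w X + lam y - (Real.exp (2 * (σ ∘ F) y) - 1) * (κ y + τ y * w X)), fun a => ?_⟩
    have k1 := hG.fderiv_gradient_sq hs hy a
    have k2 := hlam y hy a X
    have k3 : G y a X = w a := by rw [hG.symm y hy, hG.apply_gradient _ hy]
    rw [hPe y hy, k3] at k2
    rw [k1]
    linear_combination 2 * k2

/-- The coefficients of `R = φ(κ g + τ dσ ⊗ dσ)` are determined by `R`. -/
theorem IsMetricOn.coeff_unique {E : Type*} [NormedAddCommGroup E] [NormedSpace ℝ E]
    [FiniteDimensional ℝ E] {G : E → E →L[ℝ] E →L[ℝ] ℝ} {U : Set E} (hG : IsMetricOn G U)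
    (hd : 3 ≤ Module.finrank ℝ E) {y : E} (hy : y ∈ U) {w : E →L[ℝ] ℝ} (hw : w ≠ 0)
    {κ τ κ' τ' : ℝ}
    (h : ∀ a b c d, curvatureForm G y a b c d = kn (G y) (κ • G y + τ • w.smulRight w) a b c d)
    (h' : ∀ a b c d,
      curvatureForm G y a b c d = kn (G y) (κ' • G y + τ' • w.smulRight w) a b c d) :
    κ = κ' ∧ τ = τ' := by
  have e := (hG.schouten_eq hd hy h).symm.trans (hG.schouten_eq hd hy h')
  have e' : ∀ u v, κ * G y u v + τ * (w u * w v) = κ' * G y u v + τ' * (w u * w v) :=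
    fun u v => by
      simpa only [add_apply, ContinuousLinearMap.smulRight_apply, smul_eq_mul, smul_apply]
        using congrArg (fun B => B u v) e
  obtain ⟨a, ha⟩ : ∃ a, w a = 1 := by
    obtain ⟨a, ha⟩ : ∃ a, w a ≠ 0 := by
      by_contra hcon
      push Not at hcon
      exact hw (ContinuousLinearMap.ext hcon)
    exact ⟨(w a)⁻¹ • a, by simp [ha]⟩
  -- Wedging with `w` removes the `τ` terms and leaves `(κ - κ') w ∧ g = 0`.
  have k := (eq_zero_of_wedge (hG.nondeg y hy) hd ha (θ := (κ - κ') • w) (η := 0)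
    fun x u v => by
      simp only [smul_apply, smul_eq_mul, zero_apply]
      linear_combination -w x * e' u v + w u * e' x v).1 a
  rw [smul_apply, ha, smul_eq_mul, mul_one, sub_eq_zero] at k
  have := e' a a
  rw [k, ha] at this
  exact ⟨k, by linarith⟩

/-- From `R = 2κ π₁ + τ φ(dσ ⊗ dσ)`, normalizing `∇σ` to `V` replaces `dσ ⊗ dσ` by `|g(∇σ,∇σ)| B`.
This gives `H = 2κ` and `N - H = τ |g(∇σ,∇σ)|`, whose differentials are multiples of `dσ`. -/
theorem quasiConstant_conclusion (hn : 3 ≤ n) (hσ : ContMDiff (𝓡 n) 𝓘(ℝ, ℝ) ∞ σ)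
    (hrel : ∀ F V, IsParam F V → CurvatureRelation (paramMetric g.val F) (σ ∘ F) V)
    (hw : ∀ p, g.val p (grad g.val σ p) (grad g.val σ p) ≠ 0)
    (h : 4 ≤ n ∨ (n = 3 ∧ ConformallyFlat g.val)) :
    ∃ (H N : M → ℝ) (V : ∀ p : M, TangentSpace (𝓡 n) p),
      IsQuasiConstantCurvature g H N V ∧
      ∀ p : M, (∃ k : ℝ, grad g.val H p = k • grad g.val σ p) ∧
        (∃ k : ℝ, grad g.val N p = k • grad g.val σ p) ∧
        (∃ k : ℝ, V p = k • grad g.val σ p) := by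
  have hw0 : ∀ p, grad g.val σ p ≠ 0 := fun p h0 => hw p (by rw [h0, map_zero])
  have hd : 3 ≤ Module.finrank ℝ (EuclideanSpace ℝ (Fin n)) := by
    rwa [finrank_euclideanSpace_fin]
  have hFp := fun p : M => isParam_chart (n := n) p
  choose κ τ hκ hτ hc using fun p : M => (hFp p).exists_coeff hn hσ (hrel _ _ (hFp p)) hw0 h
  have hglob : ∀ q : M, ∃ c d : ℝ, ∀ x y z u : TangentSpace (𝓡 n) q, curv g.val q x y z u =
      2 * c * pi1 g.val q x y z u
        + d * phi g.val q (fun a b => diff σ q a * diff σ q b) x y z u := by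
    refine forall_of_chart (n := n) fun p y hy => ⟨κ p y, τ p y, fun x v z u => ?_⟩
    obtain ⟨x, rfl⟩ := (hFp p).surjective hy x
    obtain ⟨v, rfl⟩ := (hFp p).surjective hy v
    obtain ⟨z, rfl⟩ := (hFp p).surjective hy z
    obtain ⟨u, rfl⟩ := (hFp p).surjective hy u
    rw [(hFp p).curv_metric g hy, (hc p y hy).1]
    unfold kn phi pi1
    simp only [(hFp p).diff_paramDeriv hσ hy, add_apply, ContinuousLinearMap.smulRight_apply,
      smul_eq_mul, smul_apply, paramMetric_apply]
    ring
  choose c d hcd using hglob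
  -- Uniqueness of the coefficients identifies the pointwise choices `c, d` with the smooth local
  -- functions, which makes them smooth globally.
  have hloc : ∀ p : M, ∀ y ∈ (extChartAt (𝓡 n) p).target,
      c ((extChartAt (𝓡 n) p).symm y) = κ p y ∧ d ((extChartAt (𝓡 n) p).symm y) = τ p y := by
    intro p y hy
    refine (g.isMetricOn_paramMetric (hFp p)).coeff_unique hd hy
      ((hFp p).fderiv_ne_zero hσ hy (hw0 _)) (fun x v z u => ?_) (hc p y hy).1
    refine ((hFp p).curv_metric g hy x v z u).symm.trans ((hcd _ _ _ _ _).trans ?_)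
    unfold kn phi pi1
    simp only [(hFp p).diff_paramDeriv hσ hy, add_apply, ContinuousLinearMap.smulRight_apply,
      smul_eq_mul, smul_apply, paramMetric_apply]
    ring
  set ν : M → ℝ := fun q => g.val q (grad g.val σ q) (grad g.val σ q) with hν
  have hνF : ∀ p : M, EqOn (ν ∘ (extChartAt (𝓡 n) p).symm)
      (fun z => paramMetric g.val (extChartAt (𝓡 n) p).symm z
        (gradient (paramMetric g.val (extChartAt (𝓡 n) p).symm) (σ ∘ (extChartAt (𝓡 n) p).symm) z)
        (gradient (paramMetric g.val (extChartAt (𝓡 n) p).symm) (σ ∘ (extChartAt (𝓡 n) p).symm) z))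
      (extChartAt (𝓡 n) p).target := fun p y hy => ((hFp p).gradient_sq g hσ hy).symm
  have hgs : ∀ p : M, ContDiffOn ℝ ∞ (gradient (paramMetric g.val (extChartAt (𝓡 n) p).symm)
      (σ ∘ (extChartAt (𝓡 n) p).symm)) (extChartAt (𝓡 n) p).target := fun p =>
    (g.isMetricOn_paramMetric (hFp p)).smooth_gradient ((hFp p).contDiffOn_comp_smooth hσ)
  have hνs : ContMDiff (𝓡 n) 𝓘(ℝ, ℝ) ∞ ν := contMDiff_of_chart fun p =>
    ((((g.isMetricOn_paramMetric (hFp p)).smooth.clm_apply (hgs p)).clm_apply (hgs p))).congr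
      (hνF p)
  have habs : ContMDiff (𝓡 n) 𝓘(ℝ, ℝ) ∞ (fun q => |ν q|) := fun q =>
    (contMDiffAt_iff_contDiffAt.2 (contDiffAt_abs (hw q))).comp q (hνs q)
  have hcs : ContMDiff (𝓡 n) 𝓘(ℝ, ℝ) ∞ c := contMDiff_of_chart fun p =>
    (hκ p).congr fun y hy => (hloc p y hy).1
  have hds : ContMDiff (𝓡 n) 𝓘(ℝ, ℝ) ∞ d := contMDiff_of_chart fun p =>
    (hτ p).congr fun y hy => (hloc p y hy).2
  have hHs : ContMDiff (𝓡 n) 𝓘(ℝ, ℝ) ∞ (fun q => 2 * c q) := contMDiff_const.mul hcs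
  have hNs : ContMDiff (𝓡 n) 𝓘(ℝ, ℝ) ∞ (fun q => 2 * c q + d q * |ν q|) :=
    hHs.add (hds.mul habs)
  have hprop : ∀ {f : M → ℝ}, ContMDiff (𝓡 n) 𝓘(ℝ, ℝ) ∞ f →
      (∀ p : M, ∀ y ∈ (extChartAt (𝓡 n) p).target, ∃ k : ℝ, ∀ x,
        fderiv ℝ (f ∘ (extChartAt (𝓡 n) p).symm) y x =
          k * fderiv ℝ (σ ∘ (extChartAt (𝓡 n) p).symm) y x) →
      ∀ q, ∃ k : ℝ, grad g.val f q = k • grad g.val σ q := by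
    intro f hf hk
    refine forall_of_chart (n := n) fun p y hy => ?_
    obtain ⟨k, hk⟩ := hk p y hy
    refine ⟨k, grad_eq_smul fun x => ?_⟩
    obtain ⟨x, rfl⟩ := (hFp p).surjective hy x
    exact ((hFp p).diff_paramDeriv hf hy x).trans ((hk x).trans
      (congrArg (k * ·) ((hFp p).diff_paramDeriv hσ hy x).symm))
  have heq : ∀ {f f' : EuclideanSpace ℝ (Fin n) → ℝ} {p : M} {y : EuclideanSpace ℝ (Fin n)},
      y ∈ (extChartAt (𝓡 n) p).target → EqOn f f' (extChartAt (𝓡 n) p).target →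
      DifferentiableAt ℝ f' y → HasFDerivAt f (fderiv ℝ f' y) y := fun {f f' p y} hy he hf =>
    hf.hasFDerivAt.congr_of_eventuallyEq (he.eventuallyEq_of_mem ((hFp p).isOpen.mem_nhds hy))
  have hdc : ∀ p : M, ∀ y ∈ (extChartAt (𝓡 n) p).target,
      HasFDerivAt (c ∘ (extChartAt (𝓡 n) p).symm) (fderiv ℝ (κ p) y) y := fun p y hy =>
    heq hy (fun z hz => (hloc p z hz).1) (differentiableAt_of_smooth (hFp p).isOpen (hκ p) hy)
  have hdd : ∀ p : M, ∀ y ∈ (extChartAt (𝓡 n) p).target,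
      HasFDerivAt (d ∘ (extChartAt (𝓡 n) p).symm) (fderiv ℝ (τ p) y) y := fun p y hy =>
    heq hy (fun z hz => (hloc p z hz).2) (differentiableAt_of_smooth (hFp p).isOpen (hτ p) hy)
  have hdν : ∀ p : M, ∀ y ∈ (extChartAt (𝓡 n) p).target,
      HasFDerivAt (ν ∘ (extChartAt (𝓡 n) p).symm) _ y := fun p y hy =>
    heq hy (hνF p) (differentiableAt_of_smooth (hFp p).isOpen
      (((g.isMetricOn_paramMetric (hFp p)).smooth.clm_apply (hgs p)).clm_apply (hgs p)) hy)
  have hpos : ∀ q, 0 < |ν q| := fun q => abs_pos.2 (hw q)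
  have hsq : ∀ q, √|ν q| * √|ν q| = |ν q| := fun q => Real.mul_self_sqrt (abs_nonneg _)
  have hne : ∀ q, √|ν q| ≠ 0 := fun q => (Real.sqrt_pos.2 (hpos q)).ne'
  refine ⟨fun q => 2 * c q, fun q => 2 * c q + d q * |ν q|,
    fun q => (√|ν q|)⁻¹ • grad g.val σ q,
    ⟨conformallyFlat_of_relation hn hσ hrel hw0 h, hHs, hNs, ?_, fun q => ?_, fun q x y z u => ?_⟩,
    fun q => ⟨hprop hHs (fun p y hy => ?_) q, hprop hNs (fun p y hy => ?_) q, _, rfl⟩⟩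
  · refine contMDiff_vectorField_of_local fun p => ⟨_, (hFp p).isOpen, mem_extChartAt_target p,
      Subset.rfl, fun y => (√|ν ((extChartAt (𝓡 n) p).symm y)|)⁻¹ •
        gradient (paramMetric g.val (extChartAt (𝓡 n) p).symm) (σ ∘ (extChartAt (𝓡 n) p).symm) y,
      ((((hFp p).contDiffOn_comp_smooth habs).sqrt fun y _ => (hpos _).ne').inv
        fun y _ => hne _).smul (hgs p), fun y hy => ?_⟩
    rw [map_smul]
    exact congrArg _ ((hFp p).paramDeriv_gradient g hσ hy).symm
  · have e : g.val q ((√|ν q|)⁻¹ • grad g.val σ q) ((√|ν q|)⁻¹ • grad g.val σ q)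
        = |ν q|⁻¹ * ν q := by
      rw [map_smul, map_smul, smul_apply, smul_eq_mul, smul_eq_mul, ← mul_assoc, ← mul_inv, hsq]
    rw [e]
    rcases lt_or_gt_of_ne (hw q) with h0 | h0
    · right
      rw [abs_of_neg h0, inv_neg, neg_mul, inv_mul_cancel₀ (hw q)]
    · left
      rw [abs_of_pos h0, inv_mul_cancel₀ (hw q)]
  · have e : ∀ a, g.val q a ((√|ν q|)⁻¹ • grad g.val σ q) = (√|ν q|)⁻¹ * diff σ q a := fun a => by
      rw [map_smul, g.symm, grad_apply, smul_eq_mul]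
    rw [hcd]
    unfold phi
    simp only [e]
    have h1 := hsq q
    have h2 := hne q
    generalize √|ν q| = s at h1 h2 ⊢
    rw [← h1]
    field_simp
    ring
  · obtain ⟨k, hk⟩ := (hc p y hy).2.1
    refine ⟨2 * k, fun x => ?_⟩
    have : HasFDerivAt ((fun q => 2 * c q) ∘ (extChartAt (𝓡 n) p).symm) _ y :=
      (hdc p y hy).const_mul 2
    rw [this.fderiv, smul_apply, hk, smul_eq_mul, mul_assoc]
  · obtain ⟨h1, ⟨k, hk⟩, ⟨l, hl⟩, m, hm⟩ := hc p y hy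
    have hda : HasFDerivAt (fun z => |ν ((extChartAt (𝓡 n) p).symm z)|) _ y :=
      (hasDerivAt_abs (hw _)).comp_hasFDerivAt (h₂ := abs) y (hdν p y hy)
    have : HasFDerivAt ((fun q => 2 * c q + d q * |ν q|) ∘ (extChartAt (𝓡 n) p).symm) _ y :=
      ((hdc p y hy).const_mul 2).add ((hdd p y hy).mul hda)
    -- The product rule for `2c + d |ν|`; the sign comes from differentiating `|ν|` where `ν ≠ 0`.
    refine ⟨2 * k + d ((extChartAt (𝓡 n) p).symm y)
      * (SignType.sign (ν ((extChartAt (𝓡 n) p).symm y)) * m)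
      + |ν ((extChartAt (𝓡 n) p).symm y)| * l, fun x => ?_⟩
    rw [this.fderiv]
    simp only [add_apply, smul_apply, smul_eq_mul, hk, hl, hm, Function.comp]
    ring

end NonIsotropic

end PseudoRiem

end

/-! ### The theorem. -/

open PseudoRiem in
theorem theorem2 {n : ℕ} (hn : 3 ≤ n)
    {M : Type*} [TopologicalSpace M] [T2Space M] [SecondCountableTopology M] [Nonempty M]
    [ChartedSpace (EuclideanSpace ℝ (Fin n)) M] [IsManifold (𝓡 n) ∞ M]
    {M' : Type*} [TopologicalSpace M'] [T2Space M'] [SecondCountableTopology M']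
    [ChartedSpace (EuclideanSpace ℝ (Fin n)) M'] [IsManifold (𝓡 n) ∞ M']
    (g : Metric n M) (g' : Metric n M') (hg : g.Indefinite)
    (hK : ∀ p : M, ¬ ConstantCurvatureAt g.val p)
    (f : M ≃ₘ^∞⟮𝓡 n, 𝓡 n⟯ M')
    (hf : ∀ (p : M) (x y : TangentSpace (𝓡 n) p), WeaklyDegenerate g.val p x y →
      CurvatureRatioTendstoOne g g' f p x y)
    (σ : M → ℝ) (hσ : ContMDiff (𝓡 n) 𝓘(ℝ, ℝ) ∞ σ)
    (hconf : ∀ (p : M) (x y : TangentSpace (𝓡 n) p),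
      g'.val (f p) (mfderiv (𝓡 n) (𝓡 n) f p x) (mfderiv (𝓡 n) (𝓡 n) f p y)
        = Real.exp (2 * σ p) * g.val p x y) :
    -- (a)
    (((∀ p, grad g.val σ p = 0) ∨ (4 ≤ n ∧ NowhereConformallyFlat g.val)) →
      IsIsometry g g' f) ∧
    -- (b)
    ((∀ p, grad g.val σ p ≠ 0 ∧ g.val p (grad g.val σ p) (grad g.val σ p) = 0) →
      (4 ≤ n ∨ (n = 3 ∧ ConformallyFlat g.val)) →
      ConformallyFlat g.val ∧ IsKStar g ∧
      ∀ p : M,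
        ((∃ a x y z u : TangentSpace (𝓡 n) p, covDerivCurv g.val p a x y z u ≠ 0) ∨
          (∀ᶠ q in 𝓝 p, ∀ a x y z u : TangentSpace (𝓡 n) q,
            covDerivCurv g.val q a x y z u = 0)) →
        ∃ (U : Set M) (v : M → ℝ) (F : ℝ → ℝ), IsOpen U ∧ p ∈ U ∧
          IsRecurrenceFunctionOn g.val U v ∧
          ∀ q ∈ U, ContDiffAt ℝ ∞ F (v q) ∧ σ q = F (v q)) ∧
    -- (c)
    ((∀ p, g.val p (grad g.val σ p) (grad g.val σ p) ≠ 0) →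
      (4 ≤ n ∨ (n = 3 ∧ ConformallyFlat g.val)) →
      ∃ (H N : M → ℝ) (V : ∀ p : M, TangentSpace (𝓡 n) p),
        IsQuasiConstantCurvature g H N V ∧
        ∀ p : M, (∃ k : ℝ, grad g.val H p = k • grad g.val σ p) ∧
          (∃ k : ℝ, grad g.val N p = k • grad g.val σ p) ∧
          (∃ k : ℝ, V p = k • grad g.val σ p)) := by
  have hrel : ∀ F V, IsParam F V → CurvatureRelation (paramMetric g.val F) (σ ∘ F) V :=
    fun F V hF => curvatureRelation hn hg hK f.contMDiff hf hσ hconf hF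
  have hiso : (∀ p, σ p = 0) → IsIsometry g g' f := fun h0 p x y => by
    rw [hconf, h0, mul_zero, Real.exp_zero, one_mul]
  refine ⟨?_, fun hw h => ?_, fun hw h => quasiConstant_conclusion hn hσ hrel hw h⟩
  · rintro (h | ⟨h4, h⟩)
    · exact hiso (eq_zero_of_grad_eq_zero hK hσ hrel h)
    · exact hiso (eq_zero_of_nowhereConformallyFlat h4 hσ hrel h)
  · exact ⟨conformallyFlat_of_relation hn hσ hrel (fun p => (hw p).1) h,
      isotropic_conclusion hn hK hσ hrel hw h⟩
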